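/- Let $\Bbbk$ be a field and $\otimes=\otimes_{\Bbbk}$. A *dual quasi-bialgebra* $(H,m,u,\Delta,\varepsilon,\omega)$ is a coassociative counital coalgebra $(H,\Delta,\varepsilon)$ over $\Bbbk$ with coalgebra maps $m:H\otimes H\to H$, $u:\Bbbk\to H$ (write $hk=m(h\otimes k)$, $1_H=u(1)$) and a convolution invertible linear map $\omega:H\otimes H\otimes H\to\Bbbk$ (the reassociator) such that, with $*$ the convolution product, $$\omega(H\otimes H\otimes m)*\omega(m\otimes H\otimes H)=(\varepsilon\otimes\omega)*\omega(H\otimes m\otimes H)*(\omega\otimes\varepsilon),$$ $\omega(h\otimes k\otimes l)=\varepsilon(h)\varepsilon(k)\varepsilon(l)$ whenever $1_H\in\{h,k,l\}$, $\;m(H\otimes m)*\omega=\omega*m(m\otimes H)$, and $1_Hh=h=h1_H$. A *dual quasi-Hopf algebra* is a dual quasi-bialgebra with a coalgebra antimorphism $s:H\to H$ and $\alpha,\beta\in H^*$ such that for all $h\in H$ $$h_1\beta(h_2)s(h_3)=\beta(h)1_H,\qquad s(h_1)\alpha(h_2)h_3=\alpha(h)1_H,$$ $$\omega(h_1\otimes\beta(h_2)s(h_3)\alpha(h_4)\otimes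 h_5)=\varepsilon(h)=\omega^{-1}(s(h_1)\otimes\alpha(h_2)h_3\beta(h_4)\otimes s(h_5)).$$ Let ${}^H\mathfrak M$ be the category of left $H$-comodules and left colinear maps. Let ${}^H\mathfrak M_H^H$ be the category of right dual quasi-Hopf $H$-bicomodules, i.e. right modules over the algebra $H$ in the monoidal category of $H$-bicomodules: $H$-bicomodules $M$ with a linear map $M\otimes H\to M$, $x\otimes h\mapsto xh$, which is left and right colinear for the codiagonal coactions $x\otimes h\mapsto x_{-1}h_1\otimes(x_0\otimes h_2)$ and $x\otimes h\mapsto(x_0\otimes h_1)\otimes x_1h_2$ on $M\otimes H$, and satisfies $x1_H=x$ and $$(xh)l=\omega^{-1}(x_{-1}\otimes h_1\otimes l_1)\,x_0(h_2l_2)\,\omega(x_1\otimes h_3\otimes l_3);$$ morphisms are the left and right colinear, $H$-linear maps. Let $G:{}^H\mathfrak M_H^H\to{}^H\mathfrak M$ send $M$ to the left subcomodule $M^{coH}=\{x\in M\mid x_0\otimes x_1=x\otimes 1_H\}$ (and restrict morphisms), and let $F:{}^H\mathfrak M\to{}^H\mathfrak M_H^H$ send $V$ to $V\otimes H$ (and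 $f$ to $f\otimes H$) with left coaction $v\otimes h\mapsto v_{-1}h_1\otimes(v_0\otimes h_2)$, right coaction $v\otimes h\mapsto(v\otimes h_1)\otimes h_2$ and action $(v\otimes h)l=\omega^{-1}(v_{-1}\otimes h_1\otimes l_1)\,v_0\otimes h_2l_2$. **Corollary.** Let $(H,m,u,\Delta,\varepsilon,\omega,s,\alpha,\beta)$ be a dual quasi-Hopf algebra. Then $F$ is left adjoint to $G$, with counit $\epsilon_M:M^{coH}\otimes H\to M$, $\epsilon_M(x\otimes h)=xh$, and unit $\eta_V:V\to(V\otimes H)^{coH}$, $\eta_V(v)=v\otimes 1_H$, and this adjunction is an equivalence of categories: $\epsilon$ and $\eta$ are natural isomorphisms, so that $F$ and $G$ are equivalences. -/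

import Mathlib

open CategoryTheory TensorProduct WithConv
open scoped TensorProduct

universe v u

namespace DualQuasi

noncomputable section

/-! ### Coactions of coalgebras -/

/-- A left coaction of the coalgebra `C` on `V`, written `ρ v = v₍₋₁₎ ⊗ v₍₀₎`. -/
@[ext]
structure LeftCoaction (k : Type*) (C : Type*) (V : Type*) [Field k] [AddCommGroup C] [Module k C]
    [Coalgebra k C] [AddCommGroup V] [Module k V] where
  ρ : V →ₗ[k] C ⊗[k] V
  coassoc : (TensorProduct.assoc k C C V).toLinearMap ∘ₗ
    LinearMap.rTensor V (Coalgebra.comul (R := k) (A := C)) ∘ₗ ρ = LinearMap.lTensor C ρ ∘ₗ ρ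
  counit : (TensorProduct.lid k V).toLinearMap ∘ₗ
    LinearMap.rTensor V (Coalgebra.counit (R := k) (A := C)) ∘ₗ ρ = LinearMap.id

/-- A right coaction of the coalgebra `C` on `V`, written `ρ v = v₍₀₎ ⊗ v₍₁₎`. -/
@[ext]
structure RightCoaction (k : Type*) (C : Type*) (V : Type*) [Field k] [AddCommGroup C] [Module k C]
    [Coalgebra k C] [AddCommGroup V] [Module k V] where
  ρ : V →ₗ[k] V ⊗[k] C
  coassoc : (TensorProduct.assoc k V C C).toLinearMap ∘ₗ LinearMap.rTensor C ρ ∘ₗ ρ =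
    LinearMap.lTensor V (Coalgebra.comul (R := k) (A := C)) ∘ₗ ρ
  counit : (TensorProduct.rid k V).toLinearMap ∘ₗ
    LinearMap.lTensor V (Coalgebra.counit (R := k) (A := C)) ∘ₗ ρ = LinearMap.id

section Coactions

variable {k : Type*} {C D E V W X : Type*} [Field k]
  [AddCommGroup C] [Module k C] [Coalgebra k C] [AddCommGroup D] [Module k D] [Coalgebra k D]
  [AddCommGroup V] [Module k V] [AddCommGroup W] [Module k W] [AddCommGroup X] [Module k X]

/-- A coalgebra coacts on itself from the left by its comultiplication. -/
def LeftCoaction.reg (k : Type*) (C : Type*) [Field k] [AddCommGroup C] [Module k C]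
    [Coalgebra k C] : LeftCoaction k C C where
  ρ := Coalgebra.comul
  coassoc := Coalgebra.coassoc
  counit := by ext x; simp

/-- A coalgebra coacts on itself from the right by its comultiplication. -/
def RightCoaction.reg (k : Type*) (C : Type*) [Field k] [AddCommGroup C] [Module k C]
    [Coalgebra k C] : RightCoaction k C C where
  ρ := Coalgebra.comul
  coassoc := Coalgebra.coassoc
  counit := by ext x; simp

/-- Corestriction of a left coaction along a coalgebra map `π`: `v ↦ π v₍₋₁₎ ⊗ v₍₀₎`. -/
def LeftCoaction.push (a : LeftCoaction k C V) (π : C →ₗc[k] D) : LeftCoaction k D V where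
  ρ := LinearMap.rTensor V π.toLinearMap ∘ₗ a.ρ
  coassoc := by
    have h := congrArg (fun f => TensorProduct.map π.toLinearMap
      (TensorProduct.map π.toLinearMap LinearMap.id) ∘ₗ f) a.coassoc
    have e1 : (TensorProduct.assoc k D D V).toLinearMap ∘ₗ
        LinearMap.rTensor V (Coalgebra.comul (R := k) (A := D)) ∘ₗ
          LinearMap.rTensor V π.toLinearMap =
        TensorProduct.map π.toLinearMap (TensorProduct.map π.toLinearMap LinearMap.id) ∘ₗ
          (TensorProduct.assoc k C C V).toLinearMap ∘ₗ
            LinearMap.rTensor V (Coalgebra.comul (R := k) (A := C)) := by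
      rw [← LinearMap.rTensor_comp, ← π.map_comp_comul]
      ext c v
      simp only [LinearMap.rTensor_comp, AlgebraTensorModule.curry_apply, curry_apply,
        LinearMap.coe_restrictScalars, LinearMap.comp_apply, LinearMap.rTensor_tmul]
      induction Coalgebra.comul (R := k) c with
      | zero => simp
      | tmul x y => simp
      | add x y hx hy => simp only [map_add, add_tmul, hx, hy]
    have e2 : LinearMap.lTensor D (LinearMap.rTensor V π.toLinearMap ∘ₗ a.ρ) ∘ₗ
          LinearMap.rTensor V π.toLinearMap =
        TensorProduct.map π.toLinearMap (TensorProduct.map π.toLinearMap LinearMap.id) ∘ₗ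
          LinearMap.lTensor C a.ρ := by
      ext c v
      simp [LinearMap.rTensor]
    rw [← LinearMap.comp_assoc _ _ (LinearMap.lTensor D _), e2, LinearMap.comp_assoc, ← h,
      ← LinearMap.comp_assoc, ← LinearMap.comp_assoc, LinearMap.comp_assoc _ _ (TensorProduct.assoc k D D V).toLinearMap, e1]
    rfl
  counit := by
    rw [← LinearMap.comp_assoc a.ρ, ← LinearMap.rTensor_comp, π.counit_comp, a.counit]

/-- Corestriction of a right coaction along a coalgebra map `π`: `v ↦ v₍₀₎ ⊗ π v₍₁₎`. -/
def RightCoaction.push (a : RightCoaction k C V) (π : C →ₗc[k] D) : RightCoaction k D V where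
  ρ := LinearMap.lTensor V π.toLinearMap ∘ₗ a.ρ
  coassoc := by
    have h := congrArg (fun f => TensorProduct.map LinearMap.id
      (TensorProduct.map π.toLinearMap π.toLinearMap) ∘ₗ f) a.coassoc
    have e1 : LinearMap.lTensor V (Coalgebra.comul (R := k) (A := D)) ∘ₗ
          LinearMap.lTensor V π.toLinearMap =
        TensorProduct.map LinearMap.id (TensorProduct.map π.toLinearMap π.toLinearMap) ∘ₗ
            LinearMap.lTensor V (Coalgebra.comul (R := k) (A := C)) := by
      rw [← LinearMap.lTensor_comp, ← π.map_comp_comul, LinearMap.lTensor_comp]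
      rfl
    have e2 : (TensorProduct.assoc k V D D).toLinearMap ∘ₗ
        LinearMap.rTensor D (LinearMap.lTensor V π.toLinearMap ∘ₗ a.ρ) ∘ₗ
          LinearMap.lTensor V π.toLinearMap =
        TensorProduct.map LinearMap.id (TensorProduct.map π.toLinearMap π.toLinearMap) ∘ₗ
          (TensorProduct.assoc k V C C).toLinearMap ∘ₗ LinearMap.rTensor C a.ρ := by
      ext v c
      simp only [LinearMap.rTensor_comp, AlgebraTensorModule.curry_apply, curry_apply,
        LinearMap.coe_restrictScalars, LinearMap.comp_apply, LinearMap.rTensor_tmul,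
        LinearMap.lTensor_tmul]
      induction a.ρ v with
      | zero => simp
      | tmul x y => simp
      | add x y hx hy => simp only [map_add, add_tmul, hx, hy]
    rw [← LinearMap.comp_assoc a.ρ _ (LinearMap.lTensor V Coalgebra.comul), e1,
      LinearMap.comp_assoc, ← h, ← LinearMap.comp_assoc a.ρ, ← LinearMap.comp_assoc a.ρ, e2]
    rfl
  counit := by
    rw [← LinearMap.comp_assoc a.ρ, ← LinearMap.lTensor_comp, π.counit_comp, a.counit]

/-- The tensor product of two left coactions, `v ⊗ w ↦ (v₍₋₁₎ ⊗ w₍₋₁₎) ⊗ (v₍₀₎ ⊗ w₍₀₎)`. -/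
def LeftCoaction.tensor (a : LeftCoaction k C V) (b : LeftCoaction k D W) :
    LeftCoaction k (C ⊗[k] D) (V ⊗[k] W) where
  ρ := (TensorProduct.tensorTensorTensorComm k C V D W).toLinearMap ∘ₗ TensorProduct.map a.ρ b.ρ
  coassoc := by
    let Φ : (C ⊗[k] (C ⊗[k] V)) ⊗[k] (D ⊗[k] (D ⊗[k] W)) →ₗ[k]
        (C ⊗[k] D) ⊗[k] ((C ⊗[k] D) ⊗[k] (V ⊗[k] W)) :=
      LinearMap.lTensor (C ⊗[k] D)
        (TensorProduct.tensorTensorTensorComm k C V D W).toLinearMap ∘ₗ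
        (TensorProduct.tensorTensorTensorComm k C (C ⊗[k] V) D (D ⊗[k] W)).toLinearMap
    have e1 : ∀ x y, (TensorProduct.assoc k (C ⊗[k] D) (C ⊗[k] D) (V ⊗[k] W))
        (LinearMap.rTensor (V ⊗[k] W) (Coalgebra.comul (R := k) (A := C ⊗[k] D))
          (TensorProduct.tensorTensorTensorComm k C V D W (x ⊗ₜ y))) =
        Φ ((TensorProduct.assoc k C C V (LinearMap.rTensor V Coalgebra.comul x)) ⊗ₜ
          (TensorProduct.assoc k D D W (LinearMap.rTensor W Coalgebra.comul y))) := by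
      intro x y
      induction x with
      | zero => simp
      | add x x' hx hx' => simp only [map_add, add_tmul, hx, hx']
      | tmul c v =>
        induction y with
        | zero => simp
        | add x x' hx hx' => simp only [map_add, tmul_add, hx, hx']
        | tmul d w =>
          simp only [tensorTensorTensorComm_tmul, LinearMap.rTensor_tmul, comul_tmul]
          induction Coalgebra.comul (R := k) c with
          | zero => simp
          | add x x' hx hx' => simp only [map_add, add_tmul, hx, hx']
          | tmul c c' =>
            induction Coalgebra.comul (R := k) d with
            | zero => simp
            | add x x' hx hx' => simp only [map_add, add_tmul, tmul_add, hx, hx']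
            | tmul d d' => simp [Φ]
    have e2 : ∀ x y, (LinearMap.lTensor (C ⊗[k] D)
        ((TensorProduct.tensorTensorTensorComm k C V D W).toLinearMap ∘ₗ
          TensorProduct.map a.ρ b.ρ))
          (TensorProduct.tensorTensorTensorComm k C V D W (x ⊗ₜ y)) =
        Φ ((LinearMap.lTensor C a.ρ x) ⊗ₜ (LinearMap.lTensor D b.ρ y)) := by
      intro x y
      induction x with
      | zero => simp
      | add x x' hx hx' => simp only [map_add, add_tmul, hx, hx']
      | tmul c v =>
        induction y with
        | zero => simp
        | add x x' hx hx' => simp only [map_add, tmul_add, hx, hx']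
        | tmul d w => simp [Φ]
    ext v w
    have ha := LinearMap.congr_fun a.coassoc v
    have hb := LinearMap.congr_fun b.coassoc w
    simp only [LinearMap.comp_apply, LinearEquiv.coe_coe] at ha hb
    have h1 := e1 (a.ρ v) (b.ρ w)
    have h2 := e2 (a.ρ v) (b.ρ w)
    rw [ha, hb] at h1
    exact h1.trans h2.symm
  counit := by
    have e : ∀ x y, TensorProduct.lid k (V ⊗[k] W)
        (LinearMap.rTensor (V ⊗[k] W) (Coalgebra.counit (R := k) (A := C ⊗[k] D))
          (TensorProduct.tensorTensorTensorComm k C V D W (x ⊗ₜ y))) =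
        (TensorProduct.lid k V (LinearMap.rTensor V Coalgebra.counit x)) ⊗ₜ
          (TensorProduct.lid k W (LinearMap.rTensor W Coalgebra.counit y)) := by
      intro x y
      induction x with
      | zero => simp
      | add x x' hx hx' => simp only [map_add, add_tmul, hx, hx']
      | tmul c v =>
        induction y with
        | zero => simp
        | add x x' hx hx' => simp only [map_add, tmul_add, hx, hx']
        | tmul d w =>
          simp only [tensorTensorTensorComm_tmul, LinearMap.rTensor_tmul, counit_tmul,
            TensorProduct.lid_tmul, smul_tmul_smul, smul_eq_mul]
          rw [mul_comm]
    ext v w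
    have ha := LinearMap.congr_fun a.counit v
    have hb := LinearMap.congr_fun b.counit w
    simp only [LinearMap.comp_apply, LinearEquiv.coe_coe] at ha hb
    have h1 := e (a.ρ v) (b.ρ w)
    rw [ha, hb] at h1
    exact h1

/-- The tensor product of two right coactions, `v ⊗ w ↦ (v₍₀₎ ⊗ w₍₀₎) ⊗ (v₍₁₎ ⊗ w₍₁₎)`. -/
def RightCoaction.tensor (a : RightCoaction k C V) (b : RightCoaction k D W) :
    RightCoaction k (C ⊗[k] D) (V ⊗[k] W) where
  ρ := (TensorProduct.tensorTensorTensorComm k V C W D).toLinearMap ∘ₗ TensorProduct.map a.ρ b.ρ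
  coassoc := by
    let Φ : (V ⊗[k] (C ⊗[k] C)) ⊗[k] (W ⊗[k] (D ⊗[k] D)) →ₗ[k]
        (V ⊗[k] W) ⊗[k] ((C ⊗[k] D) ⊗[k] (C ⊗[k] D)) :=
      LinearMap.lTensor (V ⊗[k] W)
        (TensorProduct.tensorTensorTensorComm k C C D D).toLinearMap ∘ₗ
        (TensorProduct.tensorTensorTensorComm k V (C ⊗[k] C) W (D ⊗[k] D)).toLinearMap
    have e1 : ∀ x y, (LinearMap.lTensor (V ⊗[k] W) (Coalgebra.comul (R := k) (A := C ⊗[k] D))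
          (TensorProduct.tensorTensorTensorComm k V C W D (x ⊗ₜ y))) =
        Φ ((LinearMap.lTensor V Coalgebra.comul x) ⊗ₜ
          (LinearMap.lTensor W Coalgebra.comul y)) := by
      intro x y
      induction x with
      | zero => simp
      | add x x' hx hx' => simp only [map_add, add_tmul, hx, hx']
      | tmul v c =>
        induction y with
        | zero => simp
        | add x x' hx hx' => simp only [map_add, tmul_add, hx, hx']
        | tmul w d => simp [Φ]; rfl
    have e2 : ∀ x y, TensorProduct.assoc k (V ⊗[k] W) (C ⊗[k] D) (C ⊗[k] D)
        (LinearMap.rTensor (C ⊗[k] D)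
          ((TensorProduct.tensorTensorTensorComm k V C W D).toLinearMap ∘ₗ
          TensorProduct.map a.ρ b.ρ)
          (TensorProduct.tensorTensorTensorComm k V C W D (x ⊗ₜ y))) =
        Φ ((TensorProduct.assoc k V C C (LinearMap.rTensor C a.ρ x)) ⊗ₜ
          (TensorProduct.assoc k W D D (LinearMap.rTensor D b.ρ y))) := by
      intro x y
      induction x with
      | zero => simp
      | add x x' hx hx' => simp only [map_add, add_tmul, hx, hx']
      | tmul v c =>
        induction y with
        | zero => simp
        | add x x' hx hx' => simp only [map_add, tmul_add, hx, hx']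
        | tmul w d =>
          simp only [tensorTensorTensorComm_tmul, LinearMap.rTensor_tmul, LinearMap.comp_apply,
            TensorProduct.map_tmul]
          induction a.ρ v with
          | zero => simp
          | add x x' hx hx' => simp only [map_add, add_tmul, hx, hx']
          | tmul c c' =>
            induction b.ρ w with
            | zero => simp
            | add x x' hx hx' => simp only [map_add, add_tmul, tmul_add, hx, hx']
            | tmul d d' => simp [Φ]
    ext v w
    have ha := LinearMap.congr_fun a.coassoc v
    have hb := LinearMap.congr_fun b.coassoc w
    simp only [LinearMap.comp_apply, LinearEquiv.coe_coe] at ha hb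
    have h1 := e1 (a.ρ v) (b.ρ w)
    have h2 := e2 (a.ρ v) (b.ρ w)
    rw [ha, hb] at h2
    exact h2.trans h1.symm
  counit := by
    have e : ∀ x y, TensorProduct.rid k (V ⊗[k] W)
        (LinearMap.lTensor (V ⊗[k] W) (Coalgebra.counit (R := k) (A := C ⊗[k] D))
          (TensorProduct.tensorTensorTensorComm k V C W D (x ⊗ₜ y))) =
        (TensorProduct.rid k V (LinearMap.lTensor V Coalgebra.counit x)) ⊗ₜ
          (TensorProduct.rid k W (LinearMap.lTensor W Coalgebra.counit y)) := by
      intro x y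
      induction x with
      | zero => simp
      | add x x' hx hx' => simp only [map_add, add_tmul, hx, hx']
      | tmul c v =>
        induction y with
        | zero => simp
        | add x x' hx hx' => simp only [map_add, tmul_add, hx, hx']
        | tmul d w =>
          simp only [tensorTensorTensorComm_tmul, LinearMap.lTensor_tmul, counit_tmul,
            TensorProduct.rid_tmul, smul_tmul_smul, smul_eq_mul]
          rw [mul_comm]
    ext v w
    have ha := LinearMap.congr_fun a.counit v
    have hb := LinearMap.congr_fun b.counit w
    simp only [LinearMap.comp_apply, LinearEquiv.coe_coe] at ha hb
    have h1 := e (a.ρ v) (b.ρ w)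
    rw [ha, hb] at h1
    exact h1

/-- The operator `v ↦ f(v₍₋₁₎) v₍₀₎` of a functional `f` on a left comodule. -/
def LeftCoaction.op (a : LeftCoaction k C V) (f : C →ₗ[k] k) : V →ₗ[k] V :=
  (TensorProduct.lid k V).toLinearMap ∘ₗ LinearMap.rTensor V f ∘ₗ a.ρ

/-- The operator `v ↦ v₍₀₎ f(v₍₁₎)` of a functional `f` on a right comodule. -/
def RightCoaction.op (a : RightCoaction k C V) (f : C →ₗ[k] k) : V →ₗ[k] V :=
  (TensorProduct.rid k V).toLinearMap ∘ₗ LinearMap.lTensor V f ∘ₗ a.ρ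

/-- A left and a right coaction on the same space commute (bicomodule). -/
def Compat (a : LeftCoaction k C V) (b : RightCoaction k D V) : Prop :=
  (TensorProduct.assoc k C V D).toLinearMap ∘ₗ LinearMap.rTensor D a.ρ ∘ₗ b.ρ =
    LinearMap.lTensor C b.ρ ∘ₗ a.ρ

/-- The convolution product `(f ∗ g)(c) = f(c₍₁₎) g(c₍₂₎)` of a functional `f` with a linear
map `g`. -/
def convL (f : C →ₗ[k] k) (g : C →ₗ[k] V) : C →ₗ[k] V :=
  (TensorProduct.lid k V).toLinearMap ∘ₗ TensorProduct.map f g ∘ₗ Coalgebra.comul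

/-- The convolution product `(g ∗ f)(c) = g(c₍₁₎) f(c₍₂₎)` of a linear map `g` with a
functional `f`. -/
def convR (g : C →ₗ[k] V) (f : C →ₗ[k] k) : C →ₗ[k] V :=
  (TensorProduct.rid k V).toLinearMap ∘ₗ TensorProduct.map g f ∘ₗ Coalgebra.comul

theorem LeftCoaction.op_comp (a : LeftCoaction k C V) (f g : C →ₗ[k] k) :
    a.op f ∘ₗ a.op g = a.op (toConv g * toConv f).ofConv := by
  have e1 : ∀ x : C ⊗[k] V, a.op f (TensorProduct.lid k V (LinearMap.rTensor V g x)) =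
      TensorProduct.lid k V (TensorProduct.map g
        ((TensorProduct.lid k V).toLinearMap ∘ₗ LinearMap.rTensor V f)
          (LinearMap.lTensor C a.ρ x)) := by
    intro x
    induction x with
    | zero => simp
    | add x y hx hy => simp only [map_add, hx, hy]
    | tmul c v => simp [LeftCoaction.op]
  have e2 : ∀ x : C ⊗[k] V, TensorProduct.lid k V
      (LinearMap.rTensor V (toConv g * toConv f).ofConv x) =
      TensorProduct.lid k V (TensorProduct.map g
        ((TensorProduct.lid k V).toLinearMap ∘ₗ LinearMap.rTensor V f)
          (TensorProduct.assoc k C C V (LinearMap.rTensor V Coalgebra.comul x))) := by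
    intro x
    induction x with
    | zero => simp
    | add x y hx hy => simp only [map_add, hx, hy]
    | tmul c v =>
      simp only [LinearMap.convMul_def, LinearMap.rTensor_tmul, LinearMap.comp_apply]
      induction Coalgebra.comul (R := k) c with
      | zero => simp
      | add x y hx hy => simp only [map_add, add_tmul, hx, hy]
      | tmul c v => simp [smul_smul, mul_comm]
  ext v
  have h := LinearMap.congr_fun a.coassoc v
  simp only [LinearMap.comp_apply, LinearEquiv.coe_coe] at h
  have h1 := e1 (a.ρ v)
  have h2 := e2 (a.ρ v)
  rw [h] at h2
  exact h1.trans h2.symm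

theorem LeftCoaction.op_counit (a : LeftCoaction k C V) : a.op Coalgebra.counit = LinearMap.id :=
  a.counit

/-- `φ` is colinear along the linear map `π` of coefficients. -/
def Colin (a : LeftCoaction k C V) (b : LeftCoaction k D W) (π : C →ₗ[k] D) (φ : V →ₗ[k] W) :
    Prop :=
  b.ρ ∘ₗ φ = TensorProduct.map π φ ∘ₗ a.ρ

/-- Naturality of the operators `op` under colinear maps. -/
theorem Colin.op_natural {a : LeftCoaction k C V} {b : LeftCoaction k D W}
    {π : C →ₗ[k] D} {φ : V →ₗ[k] W} (h : Colin a b π φ) (f : D →ₗ[k] k) : b.op f ∘ₗ φ = φ ∘ₗ a.op (f ∘ₗ π) := by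
  unfold Colin at h
  unfold LeftCoaction.op
  rw [LinearMap.comp_assoc, LinearMap.comp_assoc, h, ← LinearMap.comp_assoc a.ρ,
    ← LinearMap.comp_assoc a.ρ, ← LinearMap.comp_assoc a.ρ, ← LinearMap.comp_assoc a.ρ]
  congr 1
  ext c v
  simp

theorem Compat.op_comm {a : LeftCoaction k C V} {b : RightCoaction k D V} (h : Compat a b)
    (f : C →ₗ[k] k) (g : D →ₗ[k] k) : a.op f ∘ₗ b.op g = b.op g ∘ₗ a.op f := by
  have e1 : ∀ x : V ⊗[k] D, a.op f (TensorProduct.rid k V (LinearMap.lTensor V g x)) =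
      TensorProduct.lid k V (TensorProduct.map f
        ((TensorProduct.rid k V).toLinearMap ∘ₗ LinearMap.lTensor V g)
          (TensorProduct.assoc k C V D (LinearMap.rTensor D a.ρ x))) := by
    intro x
    induction x with
    | zero => simp
    | add x y hx hy => simp only [map_add, hx, hy]
    | tmul v d =>
      simp only [LeftCoaction.op, LinearMap.rTensor_tmul, LinearMap.lTensor_tmul,
        LinearMap.comp_apply, LinearEquiv.coe_coe, TensorProduct.rid_tmul, map_smul]
      induction a.ρ v with
      | zero => simp
      | add x y hx hy => simp only [map_add, add_tmul, smul_add, hx, hy]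
      | tmul c v => simp [smul_smul, mul_comm]
  have e2 : ∀ x : C ⊗[k] V, b.op g (TensorProduct.lid k V (LinearMap.rTensor V f x)) =
      TensorProduct.lid k V (TensorProduct.map f
        ((TensorProduct.rid k V).toLinearMap ∘ₗ LinearMap.lTensor V g)
          (LinearMap.lTensor C b.ρ x)) := by
    intro x
    induction x with
    | zero => simp
    | add x y hx hy => simp only [map_add, hx, hy]
    | tmul v d => simp [RightCoaction.op]
  ext v
  have h := LinearMap.congr_fun h v
  simp only [LinearMap.comp_apply, LinearEquiv.coe_coe] at h
  have h1 := e1 (b.ρ v)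
  have h2 := e2 (a.ρ v)
  rw [h] at h1
  exact h1.trans h2.symm

theorem Compat.tensor {E Y : Type*} [AddCommGroup E] [Module k E] [Coalgebra k E]
    [AddCommGroup Y] [Module k Y] [Coalgebra k Y]
    {a : LeftCoaction k C V} {b : RightCoaction k D V} (h : Compat a b)
    {a' : LeftCoaction k E W} {b' : RightCoaction k Y W} (h' : Compat a' b') :
    Compat (a.tensor a') (b.tensor b') := by
  let Φ : (C ⊗[k] (V ⊗[k] D)) ⊗[k] (E ⊗[k] (W ⊗[k] Y)) →ₗ[k]
      (C ⊗[k] E) ⊗[k] ((V ⊗[k] W) ⊗[k] (D ⊗[k] Y)) :=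
    LinearMap.lTensor (C ⊗[k] E)
      (TensorProduct.tensorTensorTensorComm k V D W Y).toLinearMap ∘ₗ
      (TensorProduct.tensorTensorTensorComm k C (V ⊗[k] D) E (W ⊗[k] Y)).toLinearMap
  have e1 : ∀ x y, TensorProduct.assoc k (C ⊗[k] E) (V ⊗[k] W) (D ⊗[k] Y)
      (LinearMap.rTensor (D ⊗[k] Y) (a.tensor a').ρ
        (TensorProduct.tensorTensorTensorComm k V D W Y (x ⊗ₜ y))) =
      Φ ((TensorProduct.assoc k C V D (LinearMap.rTensor D a.ρ x)) ⊗ₜ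
        (TensorProduct.assoc k E W Y (LinearMap.rTensor Y a'.ρ y))) := by
    intro x y
    induction x with
    | zero => simp
    | add x x' hx hx' => simp only [map_add, add_tmul, hx, hx']
    | tmul v c =>
      induction y with
      | zero => simp
      | add x x' hx hx' => simp only [map_add, tmul_add, hx, hx']
      | tmul w d =>
        simp only [LeftCoaction.tensor, tensorTensorTensorComm_tmul, LinearMap.rTensor_tmul,
          LinearMap.comp_apply, TensorProduct.map_tmul]
        induction a.ρ v with
        | zero => simp
        | add x x' hx hx' => simp only [map_add, add_tmul, hx, hx']
        | tmul c c' =>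
          induction a'.ρ w with
          | zero => simp
          | add x x' hx hx' => simp only [map_add, add_tmul, tmul_add, hx, hx']
          | tmul d d' => simp [Φ]
  have e2 : ∀ x y, LinearMap.lTensor (C ⊗[k] E) (b.tensor b').ρ
        (TensorProduct.tensorTensorTensorComm k C V E W (x ⊗ₜ y)) =
      Φ ((LinearMap.lTensor C b.ρ x) ⊗ₜ (LinearMap.lTensor E b'.ρ y)) := by
    intro x y
    induction x with
    | zero => simp
    | add x x' hx hx' => simp only [map_add, add_tmul, hx, hx']
    | tmul v c =>
      induction y with
      | zero => simp
      | add x x' hx hx' => simp only [map_add, tmul_add, hx, hx']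
      | tmul w d => simp [Φ, RightCoaction.tensor]
  unfold Compat
  ext v w
  have ha := LinearMap.congr_fun h v
  have hb := LinearMap.congr_fun h' w
  simp only [LinearMap.comp_apply, LinearEquiv.coe_coe] at ha hb
  have h1 := e1 (b.ρ v) (b'.ρ w)
  have h2 := e2 (a.ρ v) (a'.ρ w)
  rw [ha, hb] at h1
  exact h1.trans h2.symm

theorem Compat.reg : Compat (LeftCoaction.reg k C) (RightCoaction.reg k C) :=
  Coalgebra.coassoc

theorem Compat.push {E : Type*} [AddCommGroup E] [Module k E] [Coalgebra k E]
    {a : LeftCoaction k C V} {b : RightCoaction k D V} (h : Compat a b) (π : C →ₗc[k] E) :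
    Compat (a.push π) b := by
  have h1 := congrArg (fun f => LinearMap.rTensor (V ⊗[k] D) π.toLinearMap ∘ₗ f) h
  have e1 : (TensorProduct.assoc k E V D).toLinearMap ∘ₗ
      LinearMap.rTensor D (a.push π).ρ = LinearMap.rTensor (V ⊗[k] D) π.toLinearMap ∘ₗ
        (TensorProduct.assoc k C V D).toLinearMap ∘ₗ LinearMap.rTensor D a.ρ := by
    ext v d
    simp only [LeftCoaction.push, AlgebraTensorModule.curry_apply, curry_apply,
        LinearMap.coe_restrictScalars, LinearMap.comp_apply, LinearMap.rTensor_tmul]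
    induction a.ρ v with
    | zero => simp
    | add x y hx hy => simp only [map_add, add_tmul, hx, hy]
    | tmul c v => simp
  have e2 : LinearMap.lTensor E b.ρ ∘ₗ LinearMap.rTensor V π.toLinearMap =
      LinearMap.rTensor (V ⊗[k] D) π.toLinearMap ∘ₗ LinearMap.lTensor C b.ρ := by
    ext c v
    simp
  unfold Compat
  rw [← LinearMap.comp_assoc, e1]
  refine h1.trans ?_
  change _ = LinearMap.lTensor E b.ρ ∘ₗ LinearMap.rTensor V π.toLinearMap ∘ₗ a.ρ
  rw [← LinearMap.comp_assoc a.ρ _ (LinearMap.lTensor E b.ρ), e2]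
  rfl

theorem RightCoaction.op_comp (a : RightCoaction k C V) (f g : C →ₗ[k] k) :
    a.op f ∘ₗ a.op g = a.op (toConv f * toConv g).ofConv := by
  have e1 : ∀ x : V ⊗[k] C, a.op f (TensorProduct.rid k V (LinearMap.lTensor V g x)) =
      TensorProduct.rid k V (LinearMap.lTensor V
        ((TensorProduct.lid k k).toLinearMap ∘ₗ TensorProduct.map f g)
          (TensorProduct.assoc k V C C (LinearMap.rTensor C a.ρ x))) := by
    intro x
    induction x with
    | zero => simp
    | add x y hx hy => simp only [map_add, hx, hy]
    | tmul v c =>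
      simp only [RightCoaction.op, LinearMap.rTensor_tmul, LinearMap.lTensor_tmul,
        LinearMap.comp_apply, LinearEquiv.coe_coe, TensorProduct.rid_tmul, map_smul]
      induction a.ρ v with
      | zero => simp
      | add x y hx hy => simp only [map_add, add_tmul, smul_add, hx, hy]
      | tmul c v => simp [smul_smul, mul_comm]
  have e2 : ∀ x : V ⊗[k] C, TensorProduct.rid k V
      (LinearMap.lTensor V (toConv f * toConv g).ofConv x) =
      TensorProduct.rid k V (LinearMap.lTensor V
        ((TensorProduct.lid k k).toLinearMap ∘ₗ TensorProduct.map f g)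
          (LinearMap.lTensor V Coalgebra.comul x)) := by
    intro x
    induction x with
    | zero => simp
    | add x y hx hy => simp only [map_add, hx, hy]
    | tmul v c =>
      simp only [LinearMap.convMul_def, LinearMap.lTensor_tmul, LinearMap.comp_apply]
      induction Coalgebra.comul (R := k) c with
      | zero => simp
      | add x y hx hy => simp only [map_add, tmul_add, hx, hy]
      | tmul c v => simp
  ext v
  have h := LinearMap.congr_fun a.coassoc v
  simp only [LinearMap.comp_apply, LinearEquiv.coe_coe] at h
  have h1 := e1 (a.ρ v)
  have h2 := e2 (a.ρ v)
  rw [h] at h1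
  exact h1.trans h2.symm

theorem RightCoaction.op_counit (a : RightCoaction k C V) :
    a.op Coalgebra.counit = LinearMap.id :=
  a.counit

theorem Compat.ρ_op {a : LeftCoaction k C V} {b : RightCoaction k D V} (h : Compat a b)
    (f : C →ₗ[k] k) : b.ρ ∘ₗ a.op f = LinearMap.rTensor D (a.op f) ∘ₗ b.ρ := by
  have e1 : b.ρ ∘ₗ (TensorProduct.lid k V).toLinearMap ∘ₗ LinearMap.rTensor V f =
      (TensorProduct.lid k (V ⊗[k] D)).toLinearMap ∘ₗ LinearMap.rTensor (V ⊗[k] D) f ∘ₗ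
        LinearMap.lTensor C b.ρ := by
    ext c v
    simp
  have e2 : LinearMap.rTensor D (a.op f) =
      (TensorProduct.lid k (V ⊗[k] D)).toLinearMap ∘ₗ LinearMap.rTensor (V ⊗[k] D) f ∘ₗ
        (TensorProduct.assoc k C V D).toLinearMap ∘ₗ LinearMap.rTensor D a.ρ := by
    ext v d
    simp only [LeftCoaction.op, AlgebraTensorModule.curry_apply, curry_apply,
        LinearMap.coe_restrictScalars, LinearMap.comp_apply, LinearMap.rTensor_tmul]
    induction a.ρ v with
    | zero => simp
    | add x y hx hy => simp only [map_add, add_tmul, hx, hy]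
    | tmul c v => simp [smul_tmul']
  have h' := congrArg (fun g => (TensorProduct.lid k (V ⊗[k] D)).toLinearMap ∘ₗ
    LinearMap.rTensor (V ⊗[k] D) f ∘ₗ g) h
  rw [e2]
  refine Eq.trans ?_ h'.symm
  exact congrArg (fun g => g ∘ₗ a.ρ) e1

theorem LeftCoaction.op_tensor_counit (a : LeftCoaction k C V) (b : LeftCoaction k D W)
    (f : C →ₗ[k] k) :
    (a.tensor b).op ((TensorProduct.lid k k).toLinearMap ∘ₗ
      TensorProduct.map f Coalgebra.counit) = LinearMap.rTensor W (a.op f) := by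
  have e : ∀ x y, TensorProduct.lid k (V ⊗[k] W)
      (LinearMap.rTensor (V ⊗[k] W) ((TensorProduct.lid k k).toLinearMap ∘ₗ
        TensorProduct.map f (Coalgebra.counit (R := k) (A := D)))
        (TensorProduct.tensorTensorTensorComm k C V D W (x ⊗ₜ y))) =
      (TensorProduct.lid k V (LinearMap.rTensor V f x)) ⊗ₜ
        (TensorProduct.lid k W (LinearMap.rTensor W Coalgebra.counit y)) := by
    intro x y
    induction x with
    | zero => simp
    | add x x' hx hx' => simp only [map_add, add_tmul, hx, hx']
    | tmul c v =>
      induction y with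
      | zero => simp
      | add x x' hx hx' => simp only [map_add, tmul_add, hx, hx']
      | tmul d w => simp only [tensorTensorTensorComm_tmul, LinearMap.rTensor_tmul,
            TensorProduct.lid_tmul, smul_tmul_smul, smul_eq_mul, LinearMap.comp_apply,
            TensorProduct.map_tmul, LinearEquiv.coe_coe]
  ext v w
  have hb := LinearMap.congr_fun b.counit w
  simp only [LinearMap.comp_apply, LinearEquiv.coe_coe] at hb
  have h1 := e (a.ρ v) (b.ρ w)
  rw [hb] at h1
  exact h1

theorem Colin.rTensor {E : Type*} [AddCommGroup E] [Module k E] [Coalgebra k E]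
    {a : LeftCoaction k C V} {b : LeftCoaction k D W} {π : C →ₗ[k] D} {φ : V →ₗ[k] W}
    (h : Colin a b π φ) (c : LeftCoaction k E X) :
    Colin (a.tensor c) (b.tensor c) (LinearMap.rTensor E π) (LinearMap.rTensor X φ) := by
  have e : ∀ x y, TensorProduct.tensorTensorTensorComm k D W E X
      (TensorProduct.map π φ x ⊗ₜ y) =
      TensorProduct.map (LinearMap.rTensor E π) (LinearMap.rTensor X φ)
        (TensorProduct.tensorTensorTensorComm k C V E X (x ⊗ₜ y)) := by
    intro x y
    induction x with
    | zero => simp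
    | add x x' hx hx' => simp only [map_add, add_tmul, hx, hx']
    | tmul c v =>
      induction y with
      | zero => simp
      | add x x' hx hx' => simp only [map_add, tmul_add, hx, hx']
      | tmul d w => simp
  unfold Colin
  ext v x
  have h' := LinearMap.congr_fun h v
  simp only [LinearMap.comp_apply] at h'
  have h1 := e (a.ρ v) (c.ρ x)
  rw [← h'] at h1
  exact h1

/-- Multiplying the last two tensor factors by a coalgebra map `m` is colinear. -/
theorem Colin.mulLast (a : LeftCoaction k C V) (m : D ⊗[k] D →ₗc[k] D) :
    Colin ((a.tensor (LeftCoaction.reg k D)).tensor (LeftCoaction.reg k D))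
      (a.tensor (LeftCoaction.reg k D))
      (LinearMap.lTensor C m.toLinearMap ∘ₗ (TensorProduct.assoc k C D D).toLinearMap)
      (LinearMap.lTensor V m.toLinearMap ∘ₗ (TensorProduct.assoc k V D D).toLinearMap) := by
  have e : ∀ (x : C ⊗[k] V) (y z : D ⊗[k] D),
      TensorProduct.tensorTensorTensorComm k C V D D (x ⊗ₜ TensorProduct.map m.toLinearMap
        m.toLinearMap (TensorProduct.tensorTensorTensorComm k D D D D (y ⊗ₜ z))) =
      TensorProduct.map
        (LinearMap.lTensor C m.toLinearMap ∘ₗ (TensorProduct.assoc k C D D).toLinearMap)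
        (LinearMap.lTensor V m.toLinearMap ∘ₗ (TensorProduct.assoc k V D D).toLinearMap)
        (TensorProduct.tensorTensorTensorComm k (C ⊗[k] D) (V ⊗[k] D) D D
          (TensorProduct.tensorTensorTensorComm k C V D D (x ⊗ₜ y) ⊗ₜ z)) := by
    intro x y z
    induction x with
    | zero => simp
    | add x x' hx hx' => simp only [map_add, add_tmul, hx, hx']
    | tmul c v =>
      induction y with
      | zero => simp
      | add x x' hx hx' => simp only [map_add, tmul_add, add_tmul, hx, hx']
      | tmul d w =>
        induction z with
        | zero => simp
        | add x x' hx hx' => simp only [map_add, tmul_add, hx, hx']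
        | tmul d w => simp
  unfold Colin
  ext v x y
  have h := LinearMap.congr_fun m.map_comp_comul (x ⊗ₜ y)
  have h1 := e (a.ρ v) (Coalgebra.comul x) (Coalgebra.comul y)
  refine Eq.trans ?_ h1
  exact congrArg (fun z => TensorProduct.tensorTensorTensorComm k C V D D (a.ρ v ⊗ₜ z)) h.symm

theorem convL_eq (f : C →ₗ[k] k) (g : C →ₗ[k] V) :
    convL f g = g ∘ₗ (LeftCoaction.reg k C).op f := by
  unfold convL LeftCoaction.op
  rw [← LinearMap.comp_assoc, ← LinearMap.comp_assoc, ← LinearMap.comp_assoc]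
  congr 1
  ext c d
  simp

theorem convR_eq (f : C →ₗ[k] k) (g : C →ₗ[k] V) :
    convR g f = g ∘ₗ (RightCoaction.reg k C).op f := by
  unfold convR RightCoaction.op
  rw [← LinearMap.comp_assoc, ← LinearMap.comp_assoc, ← LinearMap.comp_assoc]
  congr 1
  ext c d
  simp

theorem LeftCoaction.map_op (a : LeftCoaction k C V) (f : C →ₗ[k] k) (g : C →ₗ[k] W) :
    LinearMap.rTensor V g ∘ₗ a.ρ ∘ₗ a.op f = LinearMap.rTensor V (convL f g) ∘ₗ a.ρ := by
  have e1 : LinearMap.rTensor V g ∘ₗ a.ρ ∘ₗ (TensorProduct.lid k V).toLinearMap ∘ₗ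
      LinearMap.rTensor V f =
      (TensorProduct.lid k _).toLinearMap ∘ₗ TensorProduct.map f (LinearMap.rTensor V g) ∘ₗ
        LinearMap.lTensor C a.ρ := by
    ext c v
    simp
  have e2 : LinearMap.rTensor V (convL f g) =
      (TensorProduct.lid k _).toLinearMap ∘ₗ TensorProduct.map f (LinearMap.rTensor V g) ∘ₗ
        (TensorProduct.assoc k C C V).toLinearMap ∘ₗ LinearMap.rTensor V Coalgebra.comul := by
    ext c v
    simp only [convL, AlgebraTensorModule.curry_apply, curry_apply,
        LinearMap.coe_restrictScalars, LinearMap.comp_apply, LinearMap.rTensor_tmul]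
    induction Coalgebra.comul (R := k) c with
    | zero => simp
    | add x y hx hy => simp only [map_add, add_tmul, hx, hy]
    | tmul c v => simp [smul_tmul']
  rw [e2]
  have h := congrArg (fun q => (TensorProduct.lid k _).toLinearMap ∘ₗ
    TensorProduct.map f (LinearMap.rTensor V g) ∘ₗ q) a.coassoc
  refine Eq.trans ?_ h.symm
  exact congrArg (fun q => q ∘ₗ a.ρ) e1

theorem LeftCoaction.op_map (a : LeftCoaction k C V) (f : C →ₗ[k] k) (g : C →ₗ[k] W) :
    TensorProduct.map g (a.op f) ∘ₗ a.ρ = LinearMap.rTensor V (convR g f) ∘ₗ a.ρ := by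
  have e1 : TensorProduct.map g (a.op f) =
      TensorProduct.map g ((TensorProduct.lid k V).toLinearMap ∘ₗ LinearMap.rTensor V f) ∘ₗ
        LinearMap.lTensor C a.ρ := by
    ext c v
    simp [LeftCoaction.op]
  have e2 : LinearMap.rTensor V (convR g f) =
      TensorProduct.map g ((TensorProduct.lid k V).toLinearMap ∘ₗ LinearMap.rTensor V f) ∘ₗ
        (TensorProduct.assoc k C C V).toLinearMap ∘ₗ LinearMap.rTensor V Coalgebra.comul := by
    ext c v
    simp only [convR, AlgebraTensorModule.curry_apply, curry_apply,
        LinearMap.coe_restrictScalars, LinearMap.comp_apply, LinearMap.rTensor_tmul]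
    induction Coalgebra.comul (R := k) c with
    | zero => simp
    | add x y hx hy => simp only [map_add, add_tmul, hx, hy]
    | tmul c v => simp [smul_tmul]
  rw [e2, e1]
  have h := congrArg (fun q => TensorProduct.map g
    ((TensorProduct.lid k V).toLinearMap ∘ₗ LinearMap.rTensor V f) ∘ₗ q) a.coassoc
  exact h.symm

end Coactions

/-! ### Dual quasi-bialgebras and dual quasi-Hopf algebras -/

section Cochains

variable {k H : Type*} [Field k] [AddCommGroup H] [Module k H] [Coalgebra k H]

/-- `m ⊗ H : (h ⊗ l) ⊗ p ↦ hl ⊗ p`. -/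
def mulLeft (m : H ⊗[k] H →ₗc[k] H) : H ⊗[k] H ⊗[k] H →ₗ[k] H ⊗[k] H :=
  LinearMap.rTensor H m.toLinearMap

/-- `H ⊗ m : (h ⊗ l) ⊗ p ↦ h ⊗ lp`. -/
def mulRight (m : H ⊗[k] H →ₗc[k] H) : H ⊗[k] H ⊗[k] H →ₗ[k] H ⊗[k] H :=
  LinearMap.lTensor H m.toLinearMap ∘ₗ (TensorProduct.assoc k H H H).toLinearMap

/-- `m ⊗ H ⊗ H : ((h ⊗ l) ⊗ p) ⊗ q ↦ (hl ⊗ p) ⊗ q`. -/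
def mul₁₂ (m : H ⊗[k] H →ₗc[k] H) : H ⊗[k] H ⊗[k] H ⊗[k] H →ₗ[k] H ⊗[k] H ⊗[k] H :=
  LinearMap.rTensor H (mulLeft m)

/-- `H ⊗ m ⊗ H : ((h ⊗ l) ⊗ p) ⊗ q ↦ (h ⊗ lp) ⊗ q`. -/
def mul₂₃ (m : H ⊗[k] H →ₗc[k] H) : H ⊗[k] H ⊗[k] H ⊗[k] H →ₗ[k] H ⊗[k] H ⊗[k] H :=
  LinearMap.rTensor H (mulRight m)

/-- `H ⊗ H ⊗ m : ((h ⊗ l) ⊗ p) ⊗ q ↦ (h ⊗ l) ⊗ pq`. -/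
def mul₃₄ (m : H ⊗[k] H →ₗc[k] H) : H ⊗[k] H ⊗[k] H ⊗[k] H →ₗ[k] H ⊗[k] H ⊗[k] H :=
  LinearMap.lTensor (H ⊗[k] H) m.toLinearMap ∘ₗ (TensorProduct.assoc k (H ⊗[k] H) H H).toLinearMap

/-- `ε ⊗ ω : ((h ⊗ l) ⊗ p) ⊗ q ↦ ε(h) ω(l ⊗ p ⊗ q)`. -/
def counitTensor (ω : H ⊗[k] H ⊗[k] H →ₗ[k] k) : H ⊗[k] H ⊗[k] H ⊗[k] H →ₗ[k] k :=
  (TensorProduct.lid k k).toLinearMap ∘ₗ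
    TensorProduct.map (Coalgebra.counit (R := k) (A := H)) ω ∘ₗ
    (TensorProduct.assoc k H (H ⊗[k] H) H).toLinearMap ∘ₗ
    LinearMap.rTensor H (TensorProduct.assoc k H H H).toLinearMap

/-- `ω ⊗ ε : ((h ⊗ l) ⊗ p) ⊗ q ↦ ω(h ⊗ l ⊗ p) ε(q)`. -/
def tensorCounit (ω : H ⊗[k] H ⊗[k] H →ₗ[k] k) : H ⊗[k] H ⊗[k] H ⊗[k] H →ₗ[k] k :=
  (TensorProduct.lid k k).toLinearMap ∘ₗ
    TensorProduct.map ω (Coalgebra.counit (R := k) (A := H))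

end Cochains

/-- A dual quasi-bialgebra structure on the coalgebra `H`: the multiplication `m` and the unit `u`
are coalgebra maps, the reassociator `ω` is a convolution invertible unital 3-cocycle, and `m` is
unital and quasi-associative. `WithConv` carries the convolution product of `(H ⊗ H ⊗ H)^*`. -/
structure DualQuasiBialgebra (k : Type v) (H : Type u) [Field k] [AddCommGroup H] [Module k H]
    [Coalgebra k H] where
  m : H ⊗[k] H →ₗc[k] H
  u : k →ₗc[k] H
  ω : (WithConv (H ⊗[k] H ⊗[k] H →ₗ[k] k))ˣ
  cocycle :
    toConv (ω.val.ofConv ∘ₗ mul₃₄ m) * toConv (ω.val.ofConv ∘ₗ mul₁₂ m) =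
      toConv (counitTensor ω.val.ofConv) * toConv (ω.val.ofConv ∘ₗ mul₂₃ m) *
        toConv (tensorCounit ω.val.ofConv)
  ω_one_left : ∀ h l : H, ω.val.ofConv (u 1 ⊗ₜ h ⊗ₜ l) =
    Coalgebra.counit (R := k) h * Coalgebra.counit (R := k) l
  ω_one_mid : ∀ h l : H, ω.val.ofConv (h ⊗ₜ u 1 ⊗ₜ l) =
    Coalgebra.counit (R := k) h * Coalgebra.counit (R := k) l
  ω_one_right : ∀ h l : H, ω.val.ofConv (h ⊗ₜ l ⊗ₜ u 1) =
    Coalgebra.counit (R := k) h * Coalgebra.counit (R := k) l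
  quasi_assoc :
    convR (m.toLinearMap ∘ₗ mulRight m) ω.val.ofConv =
      convL ω.val.ofConv (m.toLinearMap ∘ₗ mulLeft m)
  one_mul : ∀ h : H, m (u 1 ⊗ₜ h) = h
  mul_one : ∀ h : H, m (h ⊗ₜ u 1) = h

/-- A dual quasi-Hopf algebra structure on the coalgebra `H`: a dual quasi-bialgebra with an
antipode `(s, α, β)`. -/
structure DualQuasiHopfAlgebra (k : Type v) (H : Type u) [Field k] [AddCommGroup H] [Module k H]
    [Coalgebra k H] extends DualQuasiBialgebra k H where
  s : H →ₗ[k] H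
  α : H →ₗ[k] k
  β : H →ₗ[k] k
  /-- `s` is a coalgebra antimorphism: `s(h)₁ ⊗ s(h)₂ = s(h₂) ⊗ s(h₁)`. -/
  comul_s : Coalgebra.comul ∘ₗ s = TensorProduct.map s s ∘ₗ
    (TensorProduct.comm k H H).toLinearMap ∘ₗ Coalgebra.comul
  counit_s : Coalgebra.counit ∘ₗ s = Coalgebra.counit (R := k)
  /-- `h₁ β(h₂) s(h₃) = β(h) 1`. -/
  mul_β_s : ∀ h : H, m (LinearMap.lTensor H (convL β s) (Coalgebra.comul (R := k) h)) = β h • u 1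
  /-- `s(h₁) α(h₂) h₃ = α(h) 1`. -/
  mul_s_α : ∀ h : H, m (LinearMap.rTensor H (convR s α) (Coalgebra.comul (R := k) h)) = α h • u 1
  /-- `ω(h₁ ⊗ β(h₂) s(h₃) α(h₄) ⊗ h₅) = ε(h)`. -/
  ω_antipode : ω.val.ofConv ∘ₗ
      LinearMap.rTensor H (LinearMap.lTensor H (convR (convL β s) α) ∘ₗ Coalgebra.comul) ∘ₗ
        Coalgebra.comul = Coalgebra.counit
  /-- `ω⁻¹(s(h₁) ⊗ α(h₂) h₃ β(h₄) ⊗ s(h₅)) = ε(h)`. -/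
  ω_inv_antipode : ω⁻¹.val.ofConv ∘ₗ
      TensorProduct.map (TensorProduct.map s (convR (convL α LinearMap.id) β) ∘ₗ Coalgebra.comul)
        s ∘ₗ Coalgebra.comul = Coalgebra.counit

/-! ### Left comodules -/

/-- A left comodule over the coalgebra `H`. -/
structure LeftComodule (k : Type v) (H : Type u) [Field k] [AddCommGroup H] [Module k H]
    [Coalgebra k H] where
  carrier : Type u
  [addCommGroup : AddCommGroup carrier]
  [module : Module k carrier]
  left : LeftCoaction k H carrier

attribute [instance] LeftComodule.addCommGroup LeftComodule.module

section Category

variable {k : Type v} {H : Type u} [Field k] [AddCommGroup H] [Module k H] [Coalgebra k H]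

/-- Left colinear maps. -/
@[ext]
structure LeftComodule.Hom (V W : LeftComodule k H) where
  toLin : V.carrier →ₗ[k] W.carrier
  left_colin : W.left.ρ ∘ₗ toLin = LinearMap.lTensor H toLin ∘ₗ V.left.ρ

instance : Category (LeftComodule k H) where
  Hom := LeftComodule.Hom
  id V := ⟨LinearMap.id, by simp⟩
  comp f g := ⟨g.toLin ∘ₗ f.toLin, by
    rw [← LinearMap.comp_assoc, g.left_colin, LinearMap.comp_assoc, f.left_colin,
      LinearMap.lTensor_comp, LinearMap.comp_assoc]⟩

/-! ### Right dual quasi-Hopf bicomodules -/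

variable (B : DualQuasiBialgebra k H)

/-- The left coaction `(x ⊗ h) ↦ x₍₋₁₎ h₁ ⊗ (x₍₀₎ ⊗ h₂)` of `H` on `M ⊗ H`. -/
def DualQuasiBialgebra.tensorLeft {M : Type*} [AddCommGroup M] [Module k M]
    (a : LeftCoaction k H M) : LeftCoaction k H (M ⊗[k] H) :=
  (a.tensor (LeftCoaction.reg k H)).push B.m

/-- The right coaction `(x ⊗ h) ↦ (x₍₀₎ ⊗ h₁) ⊗ x₍₁₎ h₂` of `H` on `M ⊗ H`. -/
def DualQuasiBialgebra.tensorRight {M : Type*} [AddCommGroup M] [Module k M]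
    (b : RightCoaction k H M) : RightCoaction k H (M ⊗[k] H) :=
  (b.tensor (RightCoaction.reg k H)).push B.m

/-- The associativity constraint of the monoidal category of `H`-bicomodules at `M`, `H`, `H`:
`(x ⊗ h) ⊗ l ↦ ω⁻¹(x₍₋₁₎ ⊗ h₁ ⊗ l₁) x₍₀₎ ⊗ (h₂ ⊗ l₂) ω(x₍₁₎ ⊗ h₃ ⊗ l₃)`. -/
def DualQuasiBialgebra.assocConstraint {M : Type*} [AddCommGroup M] [Module k M]
    (a : LeftCoaction k H M) (b : RightCoaction k H M) :
    M ⊗[k] H ⊗[k] H →ₗ[k] M ⊗[k] (H ⊗[k] H) :=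
  (TensorProduct.assoc k M H H).toLinearMap ∘ₗ
    ((b.tensor (RightCoaction.reg k H)).tensor (RightCoaction.reg k H)).op B.ω.val.ofConv ∘ₗ
    ((a.tensor (LeftCoaction.reg k H)).tensor (LeftCoaction.reg k H)).op B.ω⁻¹.val.ofConv

/-- A right dual quasi-Hopf `H`-bicomodule: a right module over the algebra `H` in the monoidal
category of `H`-bicomodules. -/
structure QuasiHopfBicomodule where
  carrier : Type u
  [addCommGroup : AddCommGroup carrier]
  [module : Module k carrier]
  left : LeftCoaction k H carrier
  right : RightCoaction k H carrier
  compat : Compat left right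
  act : carrier ⊗[k] H →ₗ[k] carrier
  act_left_colin : left.ρ ∘ₗ act = LinearMap.lTensor H act ∘ₗ (B.tensorLeft left).ρ
  act_right_colin : right.ρ ∘ₗ act = LinearMap.rTensor H act ∘ₗ (B.tensorRight right).ρ
  act_one : ∀ x : carrier, act (x ⊗ₜ B.u 1) = x
  act_assoc : act ∘ₗ LinearMap.rTensor H act =
    act ∘ₗ LinearMap.lTensor carrier B.m.toLinearMap ∘ₗ B.assocConstraint left right

attribute [instance] QuasiHopfBicomodule.addCommGroup QuasiHopfBicomodule.module

variable {B}

/-- Left and right colinear, right `H`-linear maps. -/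
@[ext]
structure QuasiHopfBicomodule.Hom (M N : QuasiHopfBicomodule B) where
  toLin : M.carrier →ₗ[k] N.carrier
  left_colin : N.left.ρ ∘ₗ toLin = LinearMap.lTensor H toLin ∘ₗ M.left.ρ
  right_colin : N.right.ρ ∘ₗ toLin = LinearMap.rTensor H toLin ∘ₗ M.right.ρ
  map_act : toLin ∘ₗ M.act = N.act ∘ₗ LinearMap.rTensor H toLin

instance : Category (QuasiHopfBicomodule B) where
  Hom := QuasiHopfBicomodule.Hom
  id M := ⟨LinearMap.id, by simp, by simp, by simp⟩
  comp f g := ⟨g.toLin ∘ₗ f.toLin, by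
    rw [← LinearMap.comp_assoc, g.left_colin, LinearMap.comp_assoc, f.left_colin,
      LinearMap.lTensor_comp, LinearMap.comp_assoc], by
    rw [← LinearMap.comp_assoc, g.right_colin, LinearMap.comp_assoc, f.right_colin,
      LinearMap.rTensor_comp, LinearMap.comp_assoc], by
    rw [LinearMap.comp_assoc, f.map_act, ← LinearMap.comp_assoc, g.map_act,
      LinearMap.rTensor_comp, LinearMap.comp_assoc]⟩

/-! ### The functor `G`: right coinvariants -/

/-- The space of right coinvariants `{x | x₍₀₎ ⊗ x₍₁₎ = x ⊗ 1}`. -/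
def QuasiHopfBicomodule.coinv (M : QuasiHopfBicomodule B) : Submodule k M.carrier where
  carrier := {x | M.right.ρ x = x ⊗ₜ B.u 1}
  add_mem' := by
    intro x y hx hy
    simp only [Set.mem_ofPred_eq] at *
    rw [map_add, hx, hy, add_tmul]
  zero_mem' := by simp
  smul_mem' := by
    intro c x hx
    simp only [Set.mem_ofPred_eq] at *
    rw [map_smul, hx, smul_tmul']

theorem QuasiHopfBicomodule.lTensor_coinv_injective (M : QuasiHopfBicomodule B) :
    Function.Injective (LinearMap.lTensor H M.coinv.subtype) :=
  Module.Flat.lTensor_preserves_injective_linearMap _ M.coinv.injective_subtype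

theorem QuasiHopfBicomodule.left_mem_range (M : QuasiHopfBicomodule B) (x : M.coinv) :
    M.left.ρ x.1 ∈ LinearMap.range (LinearMap.lTensor H M.coinv.subtype) := by
  let τ : M.carrier →ₗ[k] M.carrier ⊗[k] H := (TensorProduct.mk k M.carrier H).flip (B.u 1)
  have hex : Function.Exact M.coinv.subtype (M.right.ρ - τ) := by
    intro y
    constructor
    · intro hy
      have hy' : M.right.ρ y = y ⊗ₜ B.u 1 := sub_eq_zero.1 hy
      exact ⟨⟨y, hy'⟩, rfl⟩
    · rintro ⟨y, rfl⟩
      exact sub_eq_zero.2 y.2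
  have hex' := Module.Flat.lTensor_exact H hex
  refine (hex' _).1 ?_
  have h := LinearMap.congr_fun M.compat x.1
  simp only [LinearMap.comp_apply, LinearEquiv.coe_coe] at h
  have hx : M.right.ρ x.1 = x.1 ⊗ₜ B.u 1 := x.2
  rw [hx, LinearMap.rTensor_tmul] at h
  rw [LinearMap.lTensor_sub, LinearMap.sub_apply, ← h, sub_eq_zero]
  induction M.left.ρ x.1 with
  | zero => simp
  | add y z hy hz => simp only [map_add, add_tmul, hy, hz]
  | tmul c v => simp [τ]

/-- The left coaction restricted to the right coinvariants. -/
def QuasiHopfBicomodule.coinvρ (M : QuasiHopfBicomodule B) : M.coinv →ₗ[k] H ⊗[k] M.coinv :=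
  (LinearEquiv.ofInjective _ M.lTensor_coinv_injective).symm.toLinearMap ∘ₗ
    LinearMap.codRestrict _ (M.left.ρ ∘ₗ M.coinv.subtype) M.left_mem_range

theorem QuasiHopfBicomodule.coinvρ_spec (M : QuasiHopfBicomodule B) :
    LinearMap.lTensor H M.coinv.subtype ∘ₗ M.coinvρ = M.left.ρ ∘ₗ M.coinv.subtype := by
  ext x
  have h := LinearEquiv.apply_symm_apply (LinearEquiv.ofInjective _ M.lTensor_coinv_injective)
    (LinearMap.codRestrict _ (M.left.ρ ∘ₗ M.coinv.subtype) M.left_mem_range x)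
  exact congrArg Subtype.val h

/-- The left `H`-comodule of right coinvariants of `M`. -/
def QuasiHopfBicomodule.coinvComodule (M : QuasiHopfBicomodule B) : LeftComodule k H where
  carrier := M.coinv
  left :=
    { ρ := M.coinvρ
      coassoc := by
        have hinj : Function.Injective
            (LinearMap.lTensor H (LinearMap.lTensor H M.coinv.subtype)) :=
          Module.Flat.lTensor_preserves_injective_linearMap _ M.lTensor_coinv_injective
        refine LinearMap.cancel_left hinj |>.1 ?_
        have e1 : LinearMap.lTensor H (LinearMap.lTensor H M.coinv.subtype) ∘ₗ
            (TensorProduct.assoc k H H M.coinv).toLinearMap ∘ₗ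
              LinearMap.rTensor M.coinv (Coalgebra.comul (R := k) (A := H)) =
            (TensorProduct.assoc k H H M.carrier).toLinearMap ∘ₗ
              LinearMap.rTensor M.carrier (Coalgebra.comul (R := k) (A := H)) ∘ₗ
                LinearMap.lTensor H M.coinv.subtype := by
          ext h x
          simp only [AlgebraTensorModule.curry_apply, curry_apply,
            LinearMap.coe_restrictScalars, LinearMap.comp_apply, LinearMap.rTensor_tmul,
            LinearMap.lTensor_tmul]
          induction Coalgebra.comul (R := k) h with
          | zero => simp
          | add y z hy hz => simp only [map_add, add_tmul, hy, hz]
          | tmul c v => simp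
        have e2 := congrArg (fun q => LinearMap.lTensor H q) M.coinvρ_spec
        simp only [LinearMap.lTensor_comp] at e2
        have h := congrArg (fun q => q ∘ₗ M.coinv.subtype) M.left.coassoc
        simp only [LinearMap.comp_assoc] at h
        rw [← M.coinvρ_spec] at h
        have l := congrArg (fun q => q ∘ₗ M.coinvρ) e1
        simp only [LinearMap.comp_assoc] at l
        have r := congrArg (fun q => q ∘ₗ M.coinvρ) e2
        simp only [LinearMap.comp_assoc] at r
        rw [l, r, h]
      counit := by
        refine LinearMap.cancel_left M.coinv.injective_subtype |>.1 ?_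
        have e1 : M.coinv.subtype ∘ₗ (TensorProduct.lid k M.coinv).toLinearMap ∘ₗ
            LinearMap.rTensor M.coinv (Coalgebra.counit (R := k) (A := H)) =
            (TensorProduct.lid k M.carrier).toLinearMap ∘ₗ
              LinearMap.rTensor M.carrier (Coalgebra.counit (R := k) (A := H)) ∘ₗ
                LinearMap.lTensor H M.coinv.subtype := by
          ext h x
          simp
        have h := congrArg (fun q => q ∘ₗ M.coinv.subtype) M.left.counit
        simp only [LinearMap.comp_assoc] at h
        rw [← M.coinvρ_spec] at h
        have l := congrArg (fun q => q ∘ₗ M.coinvρ) e1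
        simp only [LinearMap.comp_assoc] at l
        rw [l, h]
        rfl }

/-- A morphism of dual quasi-Hopf bicomodules restricts to the right coinvariants. -/
def QuasiHopfBicomodule.Hom.coinvMap {M N : QuasiHopfBicomodule B}
    (f : QuasiHopfBicomodule.Hom M N) : M.coinv →ₗ[k] N.coinv :=
  LinearMap.restrict f.toLin (by
    intro x hx
    have h := LinearMap.congr_fun f.right_colin x
    simp only [LinearMap.comp_apply] at h
    have hx : M.right.ρ x = x ⊗ₜ B.u 1 := hx
    rw [hx, LinearMap.rTensor_tmul] at h
    exact h)

variable (B)

/-- The functor `G`, `M ↦ M^{co H}`, from dual quasi-Hopf bicomodules to left comodules. -/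
def coinvFunctor : QuasiHopfBicomodule B ⥤ LeftComodule k H where
  obj M := M.coinvComodule
  map {M N} f :=
    { toLin := QuasiHopfBicomodule.Hom.coinvMap f
      left_colin := by
        refine LinearMap.cancel_left N.lTensor_coinv_injective |>.1 ?_
        have e : N.coinv.subtype ∘ₗ QuasiHopfBicomodule.Hom.coinvMap f =
            (QuasiHopfBicomodule.Hom.toLin f) ∘ₗ M.coinv.subtype := rfl
        have h1 : LinearMap.lTensor H N.coinv.subtype ∘ₗ
            LinearMap.lTensor H (QuasiHopfBicomodule.Hom.coinvMap f) =
            LinearMap.lTensor H (QuasiHopfBicomodule.Hom.toLin f) ∘ₗ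
              LinearMap.lTensor H M.coinv.subtype := by
          rw [← LinearMap.lTensor_comp, e, LinearMap.lTensor_comp]
        change LinearMap.lTensor H N.coinv.subtype ∘ₗ N.coinvρ ∘ₗ _ =
          LinearMap.lTensor H N.coinv.subtype ∘ₗ LinearMap.lTensor H _ ∘ₗ M.coinvρ
        rw [← LinearMap.comp_assoc M.coinvρ, h1, LinearMap.comp_assoc M.coinvρ, M.coinvρ_spec,
          ← LinearMap.comp_assoc, N.coinvρ_spec, LinearMap.comp_assoc, e,
          ← LinearMap.comp_assoc, QuasiHopfBicomodule.Hom.left_colin f]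
        rfl }
  map_id _ := rfl
  map_comp _ _ := rfl

variable {B}

/-! ### The functor `F`: the bicomodule `V ⊗ H` -/

/-- `V ⊗ m : (v ⊗ h) ⊗ l ↦ v ⊗ hl`. -/
def DualQuasiBialgebra.mulLast (B : DualQuasiBialgebra k H) (V : Type*) [AddCommGroup V]
    [Module k V] : V ⊗[k] H ⊗[k] H →ₗ[k] V ⊗[k] H :=
  LinearMap.lTensor V B.m.toLinearMap ∘ₗ (TensorProduct.assoc k V H H).toLinearMap

section Free

variable {V : Type*} [AddCommGroup V] [Module k V] (a : LeftCoaction k H V)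

/-- The right coaction `v ⊗ h ↦ (v ⊗ h₁) ⊗ h₂` on `V ⊗ H`. -/
def freeRight (k : Type*) (H V : Type*) [Field k] [AddCommGroup H] [Module k H] [Coalgebra k H]
    [AddCommGroup V] [Module k V] : RightCoaction k H (V ⊗[k] H) where
  ρ := (TensorProduct.assoc k V H H).symm.toLinearMap ∘ₗ LinearMap.lTensor V Coalgebra.comul
  coassoc := by
    ext v h
    have hc := congrArg (fun x => (TensorProduct.assoc k V H (H ⊗[k] H)).symm (v ⊗ₜ x))
      (Coalgebra.coassoc_apply (R := k) h)
    have e1 : ∀ x : H ⊗[k] H, TensorProduct.assoc k (V ⊗[k] H) H H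
        (LinearMap.rTensor H ((TensorProduct.assoc k V H H).symm.toLinearMap ∘ₗ
          LinearMap.lTensor V Coalgebra.comul) ((TensorProduct.assoc k V H H).symm (v ⊗ₜ x))) =
        (TensorProduct.assoc k V H (H ⊗[k] H)).symm
          (v ⊗ₜ (TensorProduct.assoc k H H H (LinearMap.rTensor H Coalgebra.comul x))) := by
      intro x
      induction x with
      | zero => simp
      | add y z hy hz => simp only [map_add, tmul_add, hy, hz]
      | tmul c d =>
        simp only [TensorProduct.assoc_symm_tmul, LinearMap.rTensor_tmul, LinearMap.comp_apply,
          LinearMap.lTensor_tmul, LinearEquiv.coe_coe]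
        induction Coalgebra.comul (R := k) c with
        | zero => simp
        | add y z hy hz => simp only [map_add, tmul_add, add_tmul, hy, hz]
        | tmul c d => simp
    have e2 : ∀ x : H ⊗[k] H, LinearMap.lTensor (V ⊗[k] H) Coalgebra.comul
        ((TensorProduct.assoc k V H H).symm (v ⊗ₜ x)) =
        (TensorProduct.assoc k V H (H ⊗[k] H)).symm
          (v ⊗ₜ (LinearMap.lTensor H Coalgebra.comul x)) := by
      intro x
      induction x with
      | zero => simp
      | add y z hy hz => simp only [map_add, tmul_add, hy, hz]
      | tmul c d => simp
    exact (e1 _).trans (hc.trans (e2 _).symm)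
  counit := by
    ext v h
    have hc := congrArg (fun x => v ⊗ₜ[k] TensorProduct.rid k H x)
      (Coalgebra.lTensor_counit_comul (R := k) h)
    have e : ∀ x : H ⊗[k] H, TensorProduct.rid k (V ⊗[k] H)
        (LinearMap.lTensor (V ⊗[k] H) Coalgebra.counit
          ((TensorProduct.assoc k V H H).symm (v ⊗ₜ x))) =
        v ⊗ₜ TensorProduct.rid k H (LinearMap.lTensor H Coalgebra.counit x) := by
      intro x
      induction x with
      | zero => simp
      | add y z hy hz => simp only [map_add, tmul_add, hy, hz]
      | tmul c d => simp
    refine (e _).trans (hc.trans ?_)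
    simp

theorem free_compat : Compat (a.tensor (LeftCoaction.reg k H)) (freeRight k H V) := by
  have e1 : ∀ (v : V) (x : H ⊗[k] H), TensorProduct.assoc k (H ⊗[k] H) (V ⊗[k] H) H
      (LinearMap.rTensor H (a.tensor (LeftCoaction.reg k H)).ρ
        ((TensorProduct.assoc k V H H).symm (v ⊗ₜ x))) =
      LinearMap.lTensor (H ⊗[k] H) (TensorProduct.assoc k V H H).symm.toLinearMap
        (TensorProduct.tensorTensorTensorComm k H V H (H ⊗[k] H)
          (a.ρ v ⊗ₜ TensorProduct.assoc k H H H (LinearMap.rTensor H Coalgebra.comul x))) := by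
    intro v x
    induction x with
    | zero => simp
    | add y z hy hz => simp only [map_add, tmul_add, hy, hz]
    | tmul c d =>
      simp only [TensorProduct.assoc_symm_tmul, LinearMap.rTensor_tmul, LinearMap.comp_apply,
        LeftCoaction.tensor, LeftCoaction.reg, TensorProduct.map_tmul]
      induction a.ρ v with
      | zero => simp
      | add y z hy hz => simp only [map_add, add_tmul, hy, hz]
      | tmul g w =>
        induction Coalgebra.comul (R := k) c with
        | zero => simp
        | add y z hy hz => simp only [map_add, tmul_add, add_tmul, hy, hz]
        | tmul c d => simp
  have e2 : ∀ (y : H ⊗[k] V) (x : H ⊗[k] H), LinearMap.lTensor (H ⊗[k] H) (freeRight k H V).ρ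
      (TensorProduct.tensorTensorTensorComm k H V H H (y ⊗ₜ x)) =
      LinearMap.lTensor (H ⊗[k] H) (TensorProduct.assoc k V H H).symm.toLinearMap
        (TensorProduct.tensorTensorTensorComm k H V H (H ⊗[k] H)
          (y ⊗ₜ LinearMap.lTensor H Coalgebra.comul x)) := by
    intro y x
    induction x with
    | zero => simp
    | add y z hy hz => simp only [map_add, tmul_add, hy, hz]
    | tmul c d =>
      induction y with
      | zero => simp
      | add y z hy hz => simp only [map_add, add_tmul, hy, hz]
      | tmul g w => simp [freeRight]
  unfold Compat
  ext v h
  have h1 := e1 v (Coalgebra.comul h)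
  have h2 := e2 (a.ρ v) (Coalgebra.comul h)
  rw [Coalgebra.coassoc_apply] at h1
  exact h1.trans h2.symm

/-- The right action `(v ⊗ h) l = ω⁻¹(v₍₋₁₎ ⊗ h₁ ⊗ l₁) v₍₀₎ ⊗ h₂ l₂` of `H` on `V ⊗ H`. -/
def DualQuasiBialgebra.freeAct (B : DualQuasiBialgebra k H) (a : LeftCoaction k H V) :
    V ⊗[k] H ⊗[k] H →ₗ[k] V ⊗[k] H :=
  B.mulLast V ∘ₗ
    ((a.tensor (LeftCoaction.reg k H)).tensor (LeftCoaction.reg k H)).op B.ω⁻¹.val.ofConv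

variable (B)

theorem DualQuasiBialgebra.op_quasi_assoc :
    (B.m.toLinearMap ∘ₗ mulRight B.m) ∘ₗ
        (RightCoaction.reg k (H ⊗[k] H ⊗[k] H)).op B.ω.val.ofConv =
      (B.m.toLinearMap ∘ₗ mulLeft B.m) ∘ₗ
        (LeftCoaction.reg k (H ⊗[k] H ⊗[k] H)).op B.ω.val.ofConv := by
  rw [← convL_eq, ← convR_eq, B.quasi_assoc]

theorem DualQuasiBialgebra.quasi_assoc_inv :
    convL B.ω⁻¹.val.ofConv (B.m.toLinearMap ∘ₗ mulRight B.m) =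
      convR (B.m.toLinearMap ∘ₗ mulLeft B.m) B.ω⁻¹.val.ofConv := by
  rw [convL_eq, convR_eq]
  have hl : (LeftCoaction.reg k (H ⊗[k] H ⊗[k] H)).op B.ω.val.ofConv ∘ₗ
      (LeftCoaction.reg k (H ⊗[k] H ⊗[k] H)).op B.ω⁻¹.val.ofConv = LinearMap.id := by
    rw [LeftCoaction.op_comp]
    exact (congrArg (fun f => (LeftCoaction.reg k (H ⊗[k] H ⊗[k] H)).op (WithConv.ofConv f))
      B.ω.inv_mul).trans (LeftCoaction.op_counit _)
  have hr : (RightCoaction.reg k (H ⊗[k] H ⊗[k] H)).op B.ω.val.ofConv ∘ₗ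
      (RightCoaction.reg k (H ⊗[k] H ⊗[k] H)).op B.ω⁻¹.val.ofConv = LinearMap.id := by
    rw [RightCoaction.op_comp]
    exact (congrArg (fun f => (RightCoaction.reg k (H ⊗[k] H ⊗[k] H)).op (WithConv.ofConv f))
      B.ω.mul_inv).trans (RightCoaction.op_counit _)
  have hcomm := Compat.op_comm (Compat.reg (k := k) (C := H ⊗[k] H ⊗[k] H))
    B.ω⁻¹.val.ofConv B.ω⁻¹.val.ofConv
  have h := B.op_quasi_assoc
  ext1
  refine LinearMap.ext fun x => ?_
  refine LinearMap.ext fun y => ?_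
  let L' := (LeftCoaction.reg k (H ⊗[k] H ⊗[k] H)).op B.ω⁻¹.val.ofConv
  let R' := (RightCoaction.reg k (H ⊗[k] H ⊗[k] H)).op B.ω⁻¹.val.ofConv
  have h1 := LinearMap.congr_fun h (R' (L' (x ⊗ₜ y)))
  have h2 := LinearMap.congr_fun hr (L' (x ⊗ₜ y))
  have h3 := LinearMap.congr_fun hl (R' (x ⊗ₜ y))
  have h4 := LinearMap.congr_fun hcomm (x ⊗ₜ y)
  simp only [LinearMap.comp_apply, LinearMap.id_apply] at h1 h2 h3 h4
  simp only [L', R'] at h1 h2 h3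
  rw [h2, ← h4, h3] at h1
  exact h1

theorem DualQuasiBialgebra.freeAct_left_colin :
    (B.tensorLeft a).ρ ∘ₗ B.freeAct a =
      LinearMap.lTensor H (B.freeAct a) ∘ₗ (B.tensorLeft (B.tensorLeft a)).ρ := by
  let c := (a.tensor (LeftCoaction.reg k H)).tensor (LeftCoaction.reg k H)
  have hν : (a.tensor (LeftCoaction.reg k H)).ρ ∘ₗ B.mulLast V =
      TensorProduct.map (mulRight B.m) (B.mulLast V) ∘ₗ c.ρ := Colin.mulLast a B.m
  have h1 : (B.tensorLeft (B.tensorLeft a)).ρ =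
      LinearMap.rTensor _ (B.m.toLinearMap ∘ₗ mulLeft B.m) ∘ₗ c.ρ := by
    have : Colin (a.tensor (LeftCoaction.reg k H)) (B.tensorLeft a) B.m.toLinearMap
        LinearMap.id := rfl
    have := this.rTensor (LeftCoaction.reg k H)
    unfold Colin at this
    rw [LinearMap.rTensor_id, LinearMap.comp_id] at this
    change LinearMap.rTensor _ B.m.toLinearMap ∘ₗ
      ((B.tensorLeft a).tensor (LeftCoaction.reg k H)).ρ = _
    rw [this, LinearMap.rTensor_comp]
    rfl
  have h2 : (B.tensorLeft a).ρ ∘ₗ B.freeAct a = LinearMap.lTensor H (B.mulLast V) ∘ₗ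
      LinearMap.rTensor _ (B.m.toLinearMap ∘ₗ mulRight B.m) ∘ₗ c.ρ ∘ₗ c.op B.ω⁻¹.val.ofConv := by
    change LinearMap.rTensor _ B.m.toLinearMap ∘ₗ ((a.tensor (LeftCoaction.reg k H)).ρ ∘ₗ
      B.mulLast V) ∘ₗ c.op _ = _
    rw [hν, LinearMap.comp_assoc, ← LinearMap.comp_assoc, ← LinearMap.comp_assoc _ _
      (LinearMap.lTensor _ _)]
    congr 1
    ext x y
    simp
  have h3 : LinearMap.lTensor H (B.freeAct a) ∘ₗ (B.tensorLeft (B.tensorLeft a)).ρ =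
      LinearMap.lTensor H (B.mulLast V) ∘ₗ
        TensorProduct.map (B.m.toLinearMap ∘ₗ mulLeft B.m) (c.op B.ω⁻¹.val.ofConv) ∘ₗ c.ρ := by
    rw [h1, ← LinearMap.comp_assoc, ← LinearMap.comp_assoc]
    congr 1
    ext x y
    simp [DualQuasiBialgebra.freeAct, c]
  rw [h2, h3, LeftCoaction.map_op, LeftCoaction.op_map, B.quasi_assoc_inv]

theorem DualQuasiBialgebra.freeAct_right_colin :
    (freeRight k H V).ρ ∘ₗ B.freeAct a =
      LinearMap.rTensor H (B.freeAct a) ∘ₗ (B.tensorRight (freeRight k H V)).ρ := by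
  let c := (a.tensor (LeftCoaction.reg k H)).tensor (LeftCoaction.reg k H)
  let d := (freeRight k H V).tensor (RightCoaction.reg k H)
  have hc : Compat c d := (free_compat a).tensor Compat.reg
  have hν : (freeRight k H V).ρ ∘ₗ B.mulLast V =
      TensorProduct.map (B.mulLast V) B.m.toLinearMap ∘ₗ d.ρ := by
    have e : ∀ (v : V) (x y : H ⊗[k] H), (TensorProduct.assoc k V H H).symm
        (v ⊗ₜ TensorProduct.map B.m.toLinearMap B.m.toLinearMap
          (TensorProduct.tensorTensorTensorComm k H H H H (x ⊗ₜ y))) =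
        TensorProduct.map (B.mulLast V) B.m.toLinearMap
          (TensorProduct.tensorTensorTensorComm k (V ⊗[k] H) H H H
            ((TensorProduct.assoc k V H H).symm (v ⊗ₜ x) ⊗ₜ y)) := by
      intro v x y
      induction x with
      | zero => simp
      | add x x' hx hx' => simp only [map_add, add_tmul, tmul_add, hx, hx']
      | tmul x x' =>
        induction y with
        | zero => simp
        | add x x' hx hx' => simp only [map_add, tmul_add, hx, hx']
        | tmul y y' => simp [DualQuasiBialgebra.mulLast]
    ext v x y
    have h := LinearMap.congr_fun B.m.map_comp_comul (x ⊗ₜ y)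
    have h1 := e v (Coalgebra.comul x) (Coalgebra.comul y)
    refine Eq.trans ?_ h1
    exact congrArg (fun z => (TensorProduct.assoc k V H H).symm (v ⊗ₜ z)) h.symm
  have h1 := hc.ρ_op B.ω⁻¹.val.ofConv
  change ((freeRight k H V).ρ ∘ₗ B.mulLast V) ∘ₗ c.op _ =
    LinearMap.rTensor H (B.mulLast V ∘ₗ c.op _) ∘ₗ LinearMap.lTensor _ B.m.toLinearMap ∘ₗ d.ρ
  rw [hν, LinearMap.comp_assoc, h1, ← LinearMap.comp_assoc, ← LinearMap.comp_assoc]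
  congr 1
  ext x y
  simp

/-- The pull-back of the reassociator along a coalgebra map, as a convolution unit. -/
def DualQuasiBialgebra.pull {C : Type*} [AddCommGroup C] [Module k C] [Coalgebra k C]
    (j : C →ₗc[k] H ⊗[k] H ⊗[k] H) : (WithConv (C →ₗ[k] k))ˣ where
  val := toConv (B.ω.val.ofConv ∘ₗ j.toLinearMap)
  inv := toConv (B.ω⁻¹.val.ofConv ∘ₗ j.toLinearMap)
  val_inv := by
    have h := LinearMap.convMul_comp_coalgHom_distrib B.ω.val B.ω⁻¹.val j
    rw [B.ω.mul_inv] at h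
    refine (congrArg toConv h).symm.trans (congrArg toConv ?_)
    exact congrArg (fun q => Algebra.linearMap k k ∘ₗ q) j.counit_comp
  inv_val := by
    have h := LinearMap.convMul_comp_coalgHom_distrib B.ω⁻¹.val B.ω.val j
    rw [B.ω.inv_mul] at h
    refine (congrArg toConv h).symm.trans (congrArg toConv ?_)
    exact congrArg (fun q => Algebra.linearMap k k ∘ₗ q) j.counit_comp

theorem DualQuasiBialgebra.ω_inv_one_right (x : H ⊗[k] H) :
    B.ω⁻¹.val.ofConv (x ⊗ₜ B.u 1) = Coalgebra.counit (R := k) x := by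
  let j : H ⊗[k] H →ₗc[k] H ⊗[k] H ⊗[k] H :=
    (Coalgebra.TensorProduct.map (CoalgHom.id k (H ⊗[k] H)) B.u).comp
      (Coalgebra.TensorProduct.rid k k (H ⊗[k] H)).symm.toCoalgHom
  have h1 : B.pull j = 1 := by
    refine Units.ext (congrArg toConv ?_)
    ext h l
    refine (B.ω_one_right h l).trans ?_
    simp [mul_comm]
  have h2 : (B.pull j)⁻¹ = 1 := by rw [h1, inv_one]
  have h3 := congrArg (fun q => q.val.ofConv x) h2
  exact h3

theorem DualQuasiBialgebra.freeAct_one (x : V ⊗[k] H) : B.freeAct a (x ⊗ₜ B.u 1) = x := by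
  let ι : V ⊗[k] H →ₗ[k] V ⊗[k] H ⊗[k] H := (TensorProduct.mk k (V ⊗[k] H) H).flip (B.u 1)
  let κ : H ⊗[k] H →ₗ[k] H ⊗[k] H ⊗[k] H := (TensorProduct.mk k (H ⊗[k] H) H).flip (B.u 1)
  let c := (a.tensor (LeftCoaction.reg k H)).tensor (LeftCoaction.reg k H)
  have hu : Coalgebra.comul (R := k) (B.u 1) = B.u 1 ⊗ₜ[k] B.u 1 := by
    have := LinearMap.congr_fun B.u.map_comp_comul 1
    refine this.symm.trans ?_
    simp only [LinearMap.comp_apply, CommSemiring.comul_apply, TensorProduct.map_tmul]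
    rfl
  have hι : Colin (a.tensor (LeftCoaction.reg k H)) c κ ι := by
    have e : ∀ y : (H ⊗[k] H) ⊗[k] (V ⊗[k] H),
        TensorProduct.tensorTensorTensorComm k (H ⊗[k] H) (V ⊗[k] H) H H
          (y ⊗ₜ (B.u 1 ⊗ₜ[k] B.u 1)) = TensorProduct.map κ ι y := by
      intro y
      induction y with
      | zero => simp
      | add x y hx hy => simp only [map_add, add_tmul, hx, hy]
      | tmul x y => simp [κ, ι]
    refine LinearMap.ext fun x => ?_
    refine Eq.trans ?_ (e _)
    rw [← hu]
    rfl
  have hκ : B.ω⁻¹.val.ofConv ∘ₗ κ = Coalgebra.counit :=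
    LinearMap.ext fun y => B.ω_inv_one_right y
  have h := LinearMap.congr_fun (hι.op_natural B.ω⁻¹.val.ofConv) x
  rw [hκ, LeftCoaction.op_counit, LinearMap.comp_id] at h
  refine (congrArg (B.mulLast V) h).trans ?_
  change B.mulLast V (x ⊗ₜ B.u 1) = x
  induction x with
  | zero => simp
  | add x y hx hy =>
    rw [add_tmul, map_add, hx (LinearMap.congr_fun (hι.op_natural _) x |>.trans (by
      rw [hκ, LeftCoaction.op_counit, LinearMap.comp_id])),
      hy (LinearMap.congr_fun (hι.op_natural _) y |>.trans (by
      rw [hκ, LeftCoaction.op_counit, LinearMap.comp_id]))]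
  | tmul v g => exact congrArg (fun z => v ⊗ₜ[k] z) (B.mul_one g)

/-- The cocycle identity, rewritten for the inverse of the reassociator. -/
theorem DualQuasiBialgebra.cocycle_inv :
    toConv (B.ω⁻¹.val.ofConv ∘ₗ mul₁₂ B.m) * toConv (B.ω⁻¹.val.ofConv ∘ₗ mul₃₄ B.m) *
        toConv (counitTensor B.ω.val.ofConv) =
      toConv (tensorCounit B.ω⁻¹.val.ofConv) * toConv (B.ω⁻¹.val.ofConv ∘ₗ mul₂₃ B.m) := by
  let j₁₂ : H ⊗[k] H ⊗[k] H ⊗[k] H →ₗc[k] H ⊗[k] H ⊗[k] H :=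
    Coalgebra.TensorProduct.map (Coalgebra.TensorProduct.map B.m (CoalgHom.id k H))
      (CoalgHom.id k H)
  let j₂₃ : H ⊗[k] H ⊗[k] H ⊗[k] H →ₗc[k] H ⊗[k] H ⊗[k] H :=
    Coalgebra.TensorProduct.map ((Coalgebra.TensorProduct.map (CoalgHom.id k H) B.m).comp
      (Coalgebra.TensorProduct.assoc k k H H H).toCoalgHom) (CoalgHom.id k H)
  let j₃₄ : H ⊗[k] H ⊗[k] H ⊗[k] H →ₗc[k] H ⊗[k] H ⊗[k] H :=
    (Coalgebra.TensorProduct.map (CoalgHom.id k (H ⊗[k] H)) B.m).comp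
      (Coalgebra.TensorProduct.assoc k k (H ⊗[k] H) H H).toCoalgHom
  let l : H ⊗[k] H ⊗[k] H ⊗[k] H →ₗc[k] H ⊗[k] H ⊗[k] H :=
    (Coalgebra.TensorProduct.lid k (H ⊗[k] H ⊗[k] H)).toCoalgHom.comp
      ((Coalgebra.TensorProduct.map (Coalgebra.counitCoalgHom k H) (CoalgHom.id k _)).comp
        ((Coalgebra.TensorProduct.assoc k k H (H ⊗[k] H) H).toCoalgHom.comp
          (Coalgebra.TensorProduct.map (Coalgebra.TensorProduct.assoc k k H H H).toCoalgHom
            (CoalgHom.id k H))))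
  let r : H ⊗[k] H ⊗[k] H ⊗[k] H →ₗc[k] H ⊗[k] H ⊗[k] H :=
    (Coalgebra.TensorProduct.rid k k (H ⊗[k] H ⊗[k] H)).toCoalgHom.comp
      (Coalgebra.TensorProduct.map (CoalgHom.id k _) (Coalgebra.counitCoalgHom k H))
  have e₁₂ : j₁₂.toLinearMap = mul₁₂ B.m := by ext; rfl
  have e₂₃ : j₂₃.toLinearMap = mul₂₃ B.m := by ext; rfl
  have e₃₄ : j₃₄.toLinearMap = mul₃₄ B.m := by ext; rfl
  have el : ∀ f : H ⊗[k] H ⊗[k] H →ₗ[k] k, f ∘ₗ l.toLinearMap = counitTensor f := by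
    intro f
    ext h p q s
    simp [l, counitTensor]
  have er : ∀ f : H ⊗[k] H ⊗[k] H →ₗ[k] k, f ∘ₗ r.toLinearMap = tensorCounit f := by
    intro f
    ext h p q s
    simp [r, tensorCounit, mul_comm]
  let P : (H ⊗[k] H ⊗[k] H ⊗[k] H →ₗc[k] H ⊗[k] H ⊗[k] H) →
      (WithConv (H ⊗[k] H ⊗[k] H ⊗[k] H →ₗ[k] k))ˣ :=
    fun j => B.pull (C := H ⊗[k] H ⊗[k] H ⊗[k] H) j
  have hc : P j₃₄ * P j₁₂ = P l * P j₂₃ * P r := by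
    refine Units.ext ?_
    have := B.cocycle
    rw [← e₁₂, ← e₂₃, ← e₃₄, ← el, ← er] at this
    exact this
  have hi : (P j₁₂)⁻¹ * (P j₃₄)⁻¹ * P l = (P r)⁻¹ * (P j₂₃)⁻¹ := by
    rw [← mul_inv_rev, hc]
    group
  have := congrArg Units.val hi
  rw [← e₁₂, ← e₂₃, ← e₃₄, ← el, ← er]
  exact this

theorem DualQuasiBialgebra.freeAct_assoc :
    B.freeAct a ∘ₗ LinearMap.rTensor H (B.freeAct a) =
      B.freeAct a ∘ₗ LinearMap.lTensor (V ⊗[k] H) B.m.toLinearMap ∘ₗ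
        B.assocConstraint (B.tensorLeft a) (freeRight k H V) := by
  let c₂ := a.tensor (LeftCoaction.reg k H)
  let c₃ := c₂.tensor (LeftCoaction.reg k H)
  let c₄ := c₃.tensor (LeftCoaction.reg k H)
  let d := ((freeRight k H V).tensor (RightCoaction.reg k H)).tensor (RightCoaction.reg k H)
  have hcd : Compat c₄ d := ((free_compat a).tensor Compat.reg).tensor Compat.reg
  let ν := B.mulLast V
  let σ := B.mulLast (V ⊗[k] H)
  let w := B.ω.val.ofConv
  let w' := B.ω⁻¹.val.ofConv
  have hν : Colin c₃ c₂ (mulRight B.m) ν := Colin.mulLast a B.m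
  have hσ : Colin c₄ c₃ (mul₃₄ B.m) σ := Colin.mulLast c₂ B.m
  have hν' : Colin c₄ c₃ (mul₂₃ B.m) (LinearMap.rTensor H ν) :=
    hν.rTensor (LeftCoaction.reg k H)
  have h₁ : B.freeAct a ∘ₗ LinearMap.rTensor H (B.freeAct a) =
      ν ∘ₗ LinearMap.rTensor H ν ∘ₗ
        c₄.op (toConv (tensorCounit w') * toConv (w' ∘ₗ mul₂₃ B.m)).ofConv := by
    change (ν ∘ₗ c₃.op w') ∘ₗ LinearMap.rTensor H (ν ∘ₗ c₃.op w') = _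
    rw [LinearMap.rTensor_comp, LinearMap.comp_assoc,
      ← LinearMap.comp_assoc _ _ (c₃.op w'), hν'.op_natural,
      ← LeftCoaction.op_tensor_counit c₃ (LeftCoaction.reg k H), LinearMap.comp_assoc]
    congr 2
    exact LeftCoaction.op_comp c₄ (w' ∘ₗ mul₂₃ B.m) (tensorCounit w')
  have hL : (((B.tensorLeft a).tensor (LeftCoaction.reg k H)).tensor
      (LeftCoaction.reg k H)).op w' = c₄.op (w' ∘ₗ mul₁₂ B.m) := by
    have : Colin c₂ (B.tensorLeft a) B.m.toLinearMap LinearMap.id := rfl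
    have := (this.rTensor (LeftCoaction.reg k H)).rTensor (LeftCoaction.reg k H)
    have := this.op_natural w'
    rw [LinearMap.rTensor_id, LinearMap.rTensor_id, LinearMap.comp_id, LinearMap.id_comp] at this
    exact this
  have h₂ : B.freeAct a ∘ₗ LinearMap.lTensor (V ⊗[k] H) B.m.toLinearMap ∘ₗ
        B.assocConstraint (B.tensorLeft a) (freeRight k H V) =
      (ν ∘ₗ σ) ∘ₗ d.op w ∘ₗ
        c₄.op (toConv (w' ∘ₗ mul₁₂ B.m) * toConv (w' ∘ₗ mul₃₄ B.m)).ofConv := by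
    change (ν ∘ₗ c₃.op w') ∘ₗ σ ∘ₗ d.op w ∘ₗ (((B.tensorLeft a).tensor
      (LeftCoaction.reg k H)).tensor (LeftCoaction.reg k H)).op w' = _
    rw [hL, LinearMap.comp_assoc, ← LinearMap.comp_assoc _ _ (c₃.op w'),
      hσ.op_natural, LinearMap.comp_assoc,
      ← LinearMap.comp_assoc _ _ (c₄.op _), hcd.op_comm, LinearMap.comp_assoc,
      ← LinearMap.comp_assoc]
    exact congrArg (fun q => (ν ∘ₗ σ) ∘ₗ d.op w ∘ₗ q)
      (LeftCoaction.op_comp c₄ (w' ∘ₗ mul₃₄ B.m) (w' ∘ₗ mul₁₂ B.m))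
  let A : V ⊗[k] H ⊗[k] H ⊗[k] H →ₗ[k] V ⊗[k] (H ⊗[k] H ⊗[k] H) :=
    (TensorProduct.assoc k V (H ⊗[k] H) H).toLinearMap ∘ₗ
      LinearMap.rTensor H (TensorProduct.assoc k V H H).toLinearMap
  have hσA : ν ∘ₗ σ = LinearMap.lTensor V (B.m.toLinearMap ∘ₗ mulRight B.m) ∘ₗ A := by
    ext v x y z
    simp [ν, σ, A, DualQuasiBialgebra.mulLast, mulRight]
  have hνA : ν ∘ₗ LinearMap.rTensor H ν =
      LinearMap.lTensor V (B.m.toLinearMap ∘ₗ mulLeft B.m) ∘ₗ A := by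
    ext v x y z
    simp [ν, A, DualQuasiBialgebra.mulLast, mulLeft]
  have hd : ∀ f, A ∘ₗ d.op f =
      LinearMap.lTensor V ((RightCoaction.reg k (H ⊗[k] H ⊗[k] H)).op f) ∘ₗ A := by
    intro f
    have e : ∀ (v : V) (x y z : H ⊗[k] H),
        A (TensorProduct.rid k (V ⊗[k] H ⊗[k] H ⊗[k] H) (LinearMap.lTensor _ f
          (TensorProduct.tensorTensorTensorComm k (V ⊗[k] H ⊗[k] H) (H ⊗[k] H) H H
            (TensorProduct.tensorTensorTensorComm k (V ⊗[k] H) H H H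
              ((TensorProduct.assoc k V H H).symm (v ⊗ₜ x) ⊗ₜ y) ⊗ₜ z)))) =
          v ⊗ₜ TensorProduct.rid k (H ⊗[k] H ⊗[k] H) (LinearMap.lTensor _ f
            (TensorProduct.tensorTensorTensorComm k (H ⊗[k] H) (H ⊗[k] H) H H
              (TensorProduct.tensorTensorTensorComm k H H H H (x ⊗ₜ y) ⊗ₜ z))) := by
      intro v x y z
      induction x with
      | zero => simp
      | add x x' hx hx' => simp only [map_add, add_tmul, tmul_add, hx, hx']
      | tmul x x' =>
        induction y with
        | zero => simp
        | add x x' hx hx' => simp only [map_add, add_tmul, tmul_add, hx, hx']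
        | tmul y y' =>
          induction z with
          | zero => simp
          | add x x' hx hx' => simp only [map_add, tmul_add, hx, hx']
          | tmul z z' => simp [A]
    ext v x y z
    exact e v (Coalgebra.comul x) (Coalgebra.comul y) (Coalgebra.comul z)
  have hc : ∀ f, A ∘ₗ c₄.op (counitTensor f) =
      LinearMap.lTensor V ((LeftCoaction.reg k (H ⊗[k] H ⊗[k] H)).op f) ∘ₗ A := by
    intro f
    have e : ∀ (t : H ⊗[k] V) (x y z : H ⊗[k] H),
        A (TensorProduct.lid k (V ⊗[k] H ⊗[k] H ⊗[k] H) (LinearMap.rTensor _ (counitTensor f)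
          (TensorProduct.tensorTensorTensorComm k (H ⊗[k] H ⊗[k] H) (V ⊗[k] H ⊗[k] H) H H
            (TensorProduct.tensorTensorTensorComm k (H ⊗[k] H) (V ⊗[k] H) H H
              (TensorProduct.tensorTensorTensorComm k H V H H (t ⊗ₜ x) ⊗ₜ y) ⊗ₜ z)))) =
          TensorProduct.lid k V (LinearMap.rTensor V Coalgebra.counit t) ⊗ₜ
            TensorProduct.lid k (H ⊗[k] H ⊗[k] H) (LinearMap.rTensor _ f
            (TensorProduct.tensorTensorTensorComm k (H ⊗[k] H) (H ⊗[k] H) H H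
              (TensorProduct.tensorTensorTensorComm k H H H H (x ⊗ₜ y) ⊗ₜ z))) := by
      intro t x y z
      induction x with
      | zero => simp
      | add x x' hx hx' => simp only [map_add, add_tmul, tmul_add, hx, hx']
      | tmul x x' =>
        induction y with
        | zero => simp
        | add x x' hx hx' => simp only [map_add, add_tmul, tmul_add, hx, hx']
        | tmul y y' =>
          induction z with
          | zero => simp
          | add x x' hx hx' => simp only [map_add, tmul_add, hx, hx']
          | tmul z z' =>
            induction t with
            | zero => simp
            | add x x' hx hx' => simp only [map_add, add_tmul, hx, hx']
            | tmul t t' =>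
              simp only [tensorTensorTensorComm_tmul, LinearMap.rTensor_tmul,
                TensorProduct.lid_tmul, map_smul, smul_tmul_smul]
              simp [A, counitTensor]
    ext v x y z
    have hv := LinearMap.congr_fun a.counit v
    simp only [LinearMap.comp_apply, LinearEquiv.coe_coe] at hv
    have h1 := e (a.ρ v) (Coalgebra.comul x) (Coalgebra.comul y) (Coalgebra.comul z)
    rw [hv] at h1
    exact h1
  have h₃ : (ν ∘ₗ σ) ∘ₗ d.op w =
      (ν ∘ₗ LinearMap.rTensor H ν) ∘ₗ c₄.op (counitTensor w) := by
    have hq := congrArg (fun q => LinearMap.lTensor V q ∘ₗ A) B.op_quasi_assoc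
    have hl := congrArg (fun q => LinearMap.lTensor V (B.m.toLinearMap ∘ₗ mulRight B.m) ∘ₗ q) (hd w)
    have hr := congrArg (fun q => LinearMap.lTensor V (B.m.toLinearMap ∘ₗ mulLeft B.m) ∘ₗ q) (hc w)
    simp only [LinearMap.lTensor_comp V (B.m.toLinearMap ∘ₗ mulRight B.m),
      LinearMap.lTensor_comp V (B.m.toLinearMap ∘ₗ mulLeft B.m)] at hq
    rw [hσA, hνA]
    exact hl.trans (hq.trans hr.symm)
  have h₄ := LeftCoaction.op_comp c₄ (counitTensor w)
    (toConv (w' ∘ₗ mul₁₂ B.m) * toConv (w' ∘ₗ mul₃₄ B.m)).ofConv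
  have h₅ := congrArg (fun q => c₄.op (WithConv.ofConv q)) B.cocycle_inv
  have h₆ := congrArg (fun q => (ν ∘ₗ LinearMap.rTensor H ν) ∘ₗ q) (h₄.trans h₅)
  have h₇ := congrArg (fun q => q ∘ₗ
    c₄.op (toConv (w' ∘ₗ mul₁₂ B.m) * toConv (w' ∘ₗ mul₃₄ B.m)).ofConv) h₃
  rw [h₁, h₂]
  exact (h₇.trans h₆).symm

end Free

variable (B)

/-- The right dual quasi-Hopf bicomodule `V ⊗ H`, for a left `H`-comodule `V`: the left coaction is
codiagonal, the right coaction is that of `H`, and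
`(v ⊗ h) l = ω⁻¹(v₍₋₁₎ ⊗ h₁ ⊗ l₁) v₍₀₎ ⊗ h₂ l₂`. -/
def freeBicomodule (V : LeftComodule k H) : QuasiHopfBicomodule B where
  carrier := V.carrier ⊗[k] H
  left := B.tensorLeft V.left
  right := freeRight k H V.carrier
  compat := (free_compat V.left).push B.m
  act := B.freeAct V.left
  act_left_colin := B.freeAct_left_colin V.left
  act_right_colin := B.freeAct_right_colin V.left
  act_one := B.freeAct_one V.left
  act_assoc := B.freeAct_assoc V.left

/-- The functor `F`, `V ↦ V ⊗ H`, from left comodules to dual quasi-Hopf bicomodules. -/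
def freeFunctor : LeftComodule k H ⥤ QuasiHopfBicomodule B where
  obj V := freeBicomodule B V
  map {V W} f :=
    let f' : LeftComodule.Hom V W := f
    { toLin := LinearMap.rTensor H f'.toLin
      left_colin := by
        have h : Colin V.left W.left LinearMap.id f'.toLin := f'.left_colin
        have h2 := h.rTensor (LeftCoaction.reg k H)
        unfold Colin at h2
        change LinearMap.rTensor _ B.m.toLinearMap ∘ₗ
          (W.left.tensor (LeftCoaction.reg k H)).ρ ∘ₗ _ = LinearMap.lTensor _ _ ∘ₗ
          LinearMap.rTensor _ B.m.toLinearMap ∘ₗ (V.left.tensor (LeftCoaction.reg k H)).ρ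
        rw [h2, LinearMap.rTensor_id, ← LinearMap.comp_assoc, ← LinearMap.comp_assoc]
        congr 1
        ext x y
        simp
      right_colin := by
        change ((TensorProduct.assoc k W.carrier H H).symm.toLinearMap ∘ₗ
          LinearMap.lTensor W.carrier Coalgebra.comul) ∘ₗ _ = _ ∘ₗ
          (TensorProduct.assoc k V.carrier H H).symm.toLinearMap ∘ₗ
          LinearMap.lTensor V.carrier Coalgebra.comul
        have e : ∀ (v : V.carrier) (x : H ⊗[k] H),
            (TensorProduct.assoc k W.carrier H H).symm (f'.toLin v ⊗ₜ x) =
            LinearMap.rTensor H (LinearMap.rTensor H f'.toLin)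
              ((TensorProduct.assoc k V.carrier H H).symm (v ⊗ₜ x)) := by
          intro v x
          induction x with
          | zero => simp
          | add y z hy hz => simp only [map_add, tmul_add, hy, hz]
          | tmul c d => simp
        ext v h
        exact e v (Coalgebra.comul h)
      map_act := by
        have h : Colin V.left W.left LinearMap.id f'.toLin := f'.left_colin
        have h2 := (h.rTensor (LeftCoaction.reg k H)).rTensor (LeftCoaction.reg k H)
        have h3 := h2.op_natural B.ω⁻¹.val.ofConv
        rw [LinearMap.rTensor_id, LinearMap.rTensor_id, LinearMap.comp_id] at h3
        change _ ∘ₗ B.mulLast V.carrier ∘ₗ LeftCoaction.op _ _ =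
          (B.mulLast W.carrier ∘ₗ LeftCoaction.op _ _) ∘ₗ _
        have h4 : LinearMap.rTensor H f'.toLin ∘ₗ B.mulLast V.carrier =
            B.mulLast W.carrier ∘ₗ LinearMap.rTensor H (LinearMap.rTensor H f'.toLin) := by
          ext x y z
          simp [DualQuasiBialgebra.mulLast]
        have h5 := congrArg (fun q => B.mulLast W.carrier ∘ₗ q) h3
        have h6 := congrArg (fun q => q ∘ₗ ((V.left.tensor (LeftCoaction.reg k H)).tensor
          (LeftCoaction.reg k H)).op B.ω⁻¹.val.ofConv) h4
        exact h6.trans h5.symm }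
  map_id V := QuasiHopfBicomodule.Hom.ext (LinearMap.rTensor_id H V.carrier)
  map_comp {U V W} f g := QuasiHopfBicomodule.Hom.ext
    (LinearMap.rTensor_comp H (LeftComodule.Hom.toLin g) (LeftComodule.Hom.toLin f))

end Category

end

end DualQuasi

/-!
The equivalence rests on the *preantipode* `S(h) = β(h₁) s(h₂) α(h₃)` of a dual quasi-Hopf algebra
(`DualQuasiHopfAlgebra.isPreantipode`), which satisfies
`S(h₁)₁ h₂ ⊗ S(h₁)₂ = 1 ⊗ S(h)`, `S(h₂)₁ ⊗ h₁ S(h₂)₂ = S(h) ⊗ 1` and `ω(h₁ ⊗ S(h₂) ⊗ h₃) = ε(h)`.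

For a dual quasi-Hopf bicomodule `M` put
`proj(x) = ω(x₍₋₁₎ ⊗ S(x₍₁₎)₁ ⊗ x₍₂₎) x₍₀₎ S(x₍₁₎)₂`. Then
* `proj(x)` is right coinvariant (`QuasiHopfBicomodule.proj_mem_coinv`), by right colinearity of the
  action and the second identity;
* `proj(x₍₀₎) x₍₁₎ = x` (`QuasiHopfBicomodule.act_rTensor_proj`): in `(x₍₀₎ S(x₍₁₎)₂) x₍₂₎` the
  associativity constraint produces an `ω⁻¹` that cancels the `ω` in the definition, and the first
  and third identities collapse the rest;
* `proj(x h) = ε(h) x` for `x` coinvariant (`IsPreantipode.proj_coinvAct`). The projection is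
  natural and `x ⊗ h ↦ x h` is a morphism `M^{co H} ⊗ H → M`, so it suffices to treat the free
  bicomodule `V ⊗ H`; there the coefficient of `v₍₀₎ ⊗ 1` is the value of
  `ω(m ⊗ H ⊗ H) ∗ (ω⁻¹ ⊗ ε)` at `v₍₋₁₎ ⊗ h₁ ⊗ S(h₂) ⊗ h₃`, which the cocycle identity evaluates
  (`IsPreantipode.ω_mul₁₂_convMul`).

Hence `x ↦ proj(x₍₀₎) ⊗ x₍₁₎` inverts the counit of the adjunction. The unit `v ↦ v ⊗ 1` is
bijective onto `(V ⊗ H)^{co H}` with inverse `V ⊗ ε`. Bijective morphisms are isomorphisms in both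
categories, so the adjunction is an equivalence.

Sweedler calculations are carried out with the operators `LeftCoaction.op` and `RightCoaction.op`
of functionals, and with the map `v ↦ v₍₀₎ ⊗ S(v₍₁₎) ⊗ v₍₂₎` (`RightCoaction.antiTriple`), which is
used both for `M` and for `H` as a comodule over itself.
-/

namespace DualQuasi

noncomputable section

/-! ### Preantipodes -/

section Preantipode

variable {k H : Type*} [Field k] [AddCommGroup H] [Module k H] [Coalgebra k H]

/-- `Δ(h₁ f(h₂)) = h₁ ⊗ h₂ f(h₃)`. -/
theorem comul_rightOp (f : H →ₗ[k] k) :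
    Coalgebra.comul ∘ₗ (RightCoaction.reg k H).op f =
      LinearMap.lTensor H ((RightCoaction.reg k H).op f) ∘ₗ Coalgebra.comul := by
  have e1 : ∀ x : H ⊗[k] H, Coalgebra.comul (R := k)
      (TensorProduct.rid k H (LinearMap.lTensor H f x)) =
      LinearMap.lTensor H ((TensorProduct.rid k H).toLinearMap ∘ₗ LinearMap.lTensor H f)
        (TensorProduct.assoc k H H H (LinearMap.rTensor H Coalgebra.comul x)) := by
    intro x
    induction x with
    | zero => simp
    | add x y hx hy => simp only [map_add, hx, hy]
    | tmul a b =>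
      simp only [LinearMap.lTensor_tmul, LinearMap.rTensor_tmul, TensorProduct.rid_tmul, map_smul]
      induction Coalgebra.comul (R := k) a with
      | zero => simp
      | add x y hx hy => simp only [map_add, add_tmul, smul_add, hx, hy]
      | tmul c d => simp
  ext h
  refine (e1 _).trans ?_
  refine (congrArg _ (Coalgebra.coassoc_apply (R := k) h)).trans ?_
  rw [← LinearMap.comp_apply, ← LinearMap.lTensor_comp]
  rfl

/-- The comultiplication of `f(h₁) s(h₂) g(h₃)` for a coalgebra antimorphism `s`: it is
`s(h₃) g(h₄) ⊗ f(h₁) s(h₂)`. -/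
theorem comul_convR_convL {s : H →ₗ[k] H} (hs : Coalgebra.comul ∘ₗ s = TensorProduct.map s s ∘ₗ
    (TensorProduct.comm k H H).toLinearMap ∘ₗ Coalgebra.comul) (f g : H →ₗ[k] k) :
    Coalgebra.comul ∘ₗ convR (convL f s) g =
      TensorProduct.map (convR s g) (convL f s) ∘ₗ
        (TensorProduct.comm k H H).toLinearMap ∘ₗ Coalgebra.comul := by
  ext h
  have hL := LinearMap.congr_fun ((Compat.reg (k := k) (C := H)).ρ_op f)
    ((RightCoaction.reg k H).op g h)
  have hR := LinearMap.congr_fun (comul_rightOp (k := k) g) h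
  have hs' := LinearMap.congr_fun hs
    ((LeftCoaction.reg k H).op f ((RightCoaction.reg k H).op g h))
  simp only [LinearMap.comp_apply, LinearEquiv.coe_coe] at hL hR hs'
  have hL' : Coalgebra.comul (R := k)
      ((LeftCoaction.reg k H).op f ((RightCoaction.reg k H).op g h)) = _ := hL.trans (congrArg _ hR)
  rw [hL'] at hs'
  rw [convR_eq, convR_eq, convL_eq]
  refine hs'.trans ?_
  simp only [LinearMap.comp_apply, LinearEquiv.coe_coe]
  induction Coalgebra.comul (R := k) h with
  | zero => simp
  | add x y hx hy => simp only [map_add, hx, hy]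
  | tmul x y => simp

/-- A preantipode of a dual quasi-bialgebra: a linear map `S` with
`S(h₁)₁ h₂ ⊗ S(h₁)₂ = 1 ⊗ S(h)`, `S(h₂)₁ ⊗ h₁ S(h₂)₂ = S(h) ⊗ 1` and
`ω(h₁ ⊗ S(h₂) ⊗ h₃) = ε(h)`. -/
structure IsPreantipode (B : DualQuasiBialgebra k H) (S : H →ₗ[k] H) : Prop where
  left : ∀ h, LinearMap.rTensor H B.m.toLinearMap (TensorProduct.rightComm k H H H
    (LinearMap.rTensor H (Coalgebra.comul ∘ₗ S) (Coalgebra.comul (R := k) h))) = B.u 1 ⊗ₜ S h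
  right : ∀ h, LinearMap.lTensor H B.m.toLinearMap (TensorProduct.leftComm k H H H
    (LinearMap.lTensor H (Coalgebra.comul ∘ₗ S) (Coalgebra.comul (R := k) h))) = S h ⊗ₜ B.u 1
  ω : B.ω.val.ofConv ∘ₗ LinearMap.rTensor H (LinearMap.lTensor H S ∘ₗ Coalgebra.comul) ∘ₗ
    Coalgebra.comul = Coalgebra.counit

/-- In a dual quasi-Hopf algebra `h ↦ β(h₁) s(h₂) α(h₃)` is a preantipode. -/
theorem DualQuasiHopfAlgebra.isPreantipode (A : DualQuasiHopfAlgebra k H) :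
    IsPreantipode A.toDualQuasiBialgebra (convR (convL A.β A.s) A.α) where
  ω := A.ω_antipode
  left h := by
    rw [comul_convR_convL A.comul_s]
    have e : ∀ x : H ⊗[k] H, LinearMap.rTensor H A.m.toLinearMap (TensorProduct.rightComm k H H H
        (LinearMap.rTensor H (TensorProduct.map (convR A.s A.α) (convL A.β A.s) ∘ₗ
          (TensorProduct.comm k H H).toLinearMap ∘ₗ Coalgebra.comul) x)) =
        TensorProduct.comm k H H (TensorProduct.map (convL A.β A.s)
          (A.m.toLinearMap ∘ₗ LinearMap.rTensor H (convR A.s A.α))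
            (TensorProduct.assoc k H H H (LinearMap.rTensor H Coalgebra.comul x))) := by
      intro x
      induction x with
      | zero => simp
      | add x y hx hy => simp only [map_add, hx, hy]
      | tmul a b =>
        simp only [LinearMap.rTensor_tmul, LinearMap.comp_apply]
        induction Coalgebra.comul (R := k) a with
        | zero => simp
        | add x y hx hy => simp only [map_add, add_tmul, hx, hy]
        | tmul c d => simp
    have e2 : ∀ x : H ⊗[k] H, TensorProduct.comm k H H (TensorProduct.map (convL A.β A.s)
          (A.m.toLinearMap ∘ₗ LinearMap.rTensor H (convR A.s A.α))
            (LinearMap.lTensor H Coalgebra.comul x)) =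
        A.u 1 ⊗ₜ (convL A.β A.s) (TensorProduct.rid k H (LinearMap.lTensor H A.α x)) := by
      intro x
      induction x with
      | zero => simp
      | add x y hx hy => simp only [map_add, tmul_add, hx, hy]
      | tmul a b =>
        have := A.mul_s_α b
        simp only [LinearMap.lTensor_tmul, LinearMap.comp_apply, TensorProduct.map_tmul,
          TensorProduct.comm_tmul, TensorProduct.rid_tmul, map_smul, tmul_smul]
        refine (congrArg (fun z => z ⊗ₜ[k] convL A.β A.s a) this).trans ?_
        rw [smul_tmul']
    rw [e, Coalgebra.coassoc_apply, e2, convR_eq]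
    rfl
  right h := by
    rw [comul_convR_convL A.comul_s]
    have e : ∀ x : H ⊗[k] H, LinearMap.lTensor H A.m.toLinearMap (TensorProduct.leftComm k H H H
        (LinearMap.lTensor H (TensorProduct.map (convR A.s A.α) (convL A.β A.s) ∘ₗ
          (TensorProduct.comm k H H).toLinearMap ∘ₗ Coalgebra.comul) x)) =
        TensorProduct.comm k H H (TensorProduct.map
          (A.m.toLinearMap ∘ₗ LinearMap.lTensor H (convL A.β A.s)) (convR A.s A.α)
            ((TensorProduct.assoc k H H H).symm (LinearMap.lTensor H Coalgebra.comul x))) := by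
      intro x
      induction x with
      | zero => simp
      | add x y hx hy => simp only [map_add, hx, hy]
      | tmul a b =>
        simp only [LinearMap.lTensor_tmul, LinearMap.comp_apply]
        induction Coalgebra.comul (R := k) b with
        | zero => simp
        | add x y hx hy => simp only [map_add, tmul_add, hx, hy]
        | tmul c d => simp
    have e2 : ∀ x : H ⊗[k] H, TensorProduct.comm k H H (TensorProduct.map
          (A.m.toLinearMap ∘ₗ LinearMap.lTensor H (convL A.β A.s)) (convR A.s A.α)
            (LinearMap.rTensor H Coalgebra.comul x)) =
        (convR A.s A.α) (TensorProduct.lid k H (LinearMap.rTensor H A.β x)) ⊗ₜ A.u 1 := by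
      intro x
      induction x with
      | zero => simp
      | add x y hx hy => simp only [map_add, add_tmul, hx, hy]
      | tmul a b =>
        have := A.mul_β_s a
        simp only [LinearMap.rTensor_tmul, LinearMap.comp_apply, TensorProduct.map_tmul,
          TensorProduct.comm_tmul, TensorProduct.lid_tmul, map_smul]
        refine (congrArg (fun z => convR A.s A.α b ⊗ₜ[k] z) this).trans ?_
        rw [smul_tmul]
    rw [e, Coalgebra.coassoc_symm_apply, e2]
    congr 1
    have hc := LinearMap.congr_fun
      ((Compat.reg (k := k) (C := H)).op_comm A.β A.α) h
    rw [convR_eq, convR_eq, convL_eq]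
    exact congrArg A.s hc.symm

end Preantipode

/-! ### The maps `v ↦ v₍₀₎ ⊗ S(v₍₁₎) ⊗ v₍₂₎` -/

section Triple

variable {k H : Type*} [Field k] [AddCommGroup H] [Module k H] [Coalgebra k H]

variable {V : Type*} [AddCommGroup V] [Module k V]

/-- The map `h ↦ S(h₁) ⊗ h₂`. -/
def antiTmulId (S : H →ₗ[k] H) : H →ₗ[k] H ⊗[k] H := LinearMap.rTensor H S ∘ₗ Coalgebra.comul

/-- The map `v ↦ v₍₀₎ ⊗ S(v₍₁₎)`. -/
def RightCoaction.tmulAnti (b : RightCoaction k H V) (S : H →ₗ[k] H) : V →ₗ[k] V ⊗[k] H :=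
  LinearMap.lTensor V S ∘ₗ b.ρ

/-- The map `v ↦ (v₍₀₎ ⊗ S(v₍₁₎)) ⊗ v₍₂₎`. -/
def RightCoaction.antiTriple (b : RightCoaction k H V) (S : H →ₗ[k] H) :
    V →ₗ[k] V ⊗[k] H ⊗[k] H :=
  LinearMap.rTensor H (b.tmulAnti S) ∘ₗ b.ρ

/-- The codiagonal right coaction of `H ⊗ H ⊗ H` on `V ⊗ H ⊗ H`. -/
abbrev RightCoaction.tensor₃ (b : RightCoaction k H V) :
    RightCoaction k (H ⊗[k] H ⊗[k] H) (V ⊗[k] H ⊗[k] H) :=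
  (b.tensor (RightCoaction.reg k H)).tensor (RightCoaction.reg k H)

theorem RightCoaction.coassoc_apply (b : RightCoaction k H V) (v : V) :
    TensorProduct.assoc k V H H (LinearMap.rTensor H b.ρ (b.ρ v)) =
      LinearMap.lTensor V Coalgebra.comul (b.ρ v) :=
  LinearMap.congr_fun b.coassoc v

theorem RightCoaction.coassoc_symm_apply (b : RightCoaction k H V) (v : V) :
    (TensorProduct.assoc k V H H).symm (LinearMap.lTensor V Coalgebra.comul (b.ρ v)) =
      LinearMap.rTensor H b.ρ (b.ρ v) := by
  rw [← b.coassoc_apply, LinearEquiv.symm_apply_apply]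

/-- The other bracketing of `v₍₀₎ ⊗ S(v₍₁₎) ⊗ v₍₂₎`, by coassociativity. -/
theorem RightCoaction.antiTriple_eq (b : RightCoaction k H V) (S : H →ₗ[k] H) (v : V) :
    b.antiTriple S v = (TensorProduct.assoc k V H H).symm
      (LinearMap.lTensor V (antiTmulId S) (b.ρ v)) := by
  have e : ∀ x : V ⊗[k] H, LinearMap.rTensor H (b.tmulAnti S) x =
      LinearMap.rTensor H (LinearMap.lTensor V S) (LinearMap.rTensor H b.ρ x) := by
    intro x
    rw [← LinearMap.comp_apply, ← LinearMap.rTensor_comp]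
    rfl
  have e2 : ∀ x : V ⊗[k] (H ⊗[k] H), LinearMap.rTensor H (LinearMap.lTensor V S)
      ((TensorProduct.assoc k V H H).symm x) = (TensorProduct.assoc k V H H).symm
        (LinearMap.lTensor V (LinearMap.rTensor H S) x) := by
    intro x
    refine LinearMap.congr_fun (f := LinearMap.rTensor H (LinearMap.lTensor V S) ∘ₗ
      (TensorProduct.assoc k V H H).symm.toLinearMap) (g :=
      (TensorProduct.assoc k V H H).symm.toLinearMap ∘ₗ
        LinearMap.lTensor V (LinearMap.rTensor H S)) ?_ x
    ext a b c
    simp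
  refine (e _).trans ?_
  rw [← b.coassoc_symm_apply, e2, ← LinearMap.comp_apply, ← LinearMap.lTensor_comp]
  rfl

theorem RightCoaction.tensor₃_assoc_symm (b : RightCoaction k H V) (z : V ⊗[k] (H ⊗[k] H)) :
    b.tensor₃.ρ ((TensorProduct.assoc k V H H).symm z) =
      TensorProduct.map (TensorProduct.assoc k V H H).symm.toLinearMap
        (TensorProduct.assoc k H H H).symm.toLinearMap
        ((b.tensor (RightCoaction.reg k (H ⊗[k] H))).ρ z) := by
  have e : ∀ x y z : _ ⊗[k] H,
      TensorProduct.tensorTensorTensorComm k (V ⊗[k] H) (H ⊗[k] H) H H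
        (TensorProduct.tensorTensorTensorComm k V H H H (x ⊗ₜ y) ⊗ₜ z) =
      TensorProduct.map (TensorProduct.assoc k V H H).symm.toLinearMap
        (TensorProduct.assoc k H H H).symm.toLinearMap
        (TensorProduct.tensorTensorTensorComm k V H (H ⊗[k] H) (H ⊗[k] H)
          (x ⊗ₜ TensorProduct.tensorTensorTensorComm k H H H H (y ⊗ₜ z))) := by
    intro x y z
    induction x with
    | zero => simp
    | add x x' hx hx' => simp only [map_add, add_tmul, hx, hx']
    | tmul x x' =>
      induction y with
      | zero => simp
      | add y y' hy hy' => simp only [map_add, add_tmul, tmul_add, hy, hy']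
      | tmul y y' =>
        induction z with
        | zero => simp
        | add z z' hz hz' => simp only [map_add, tmul_add, hz, hz']
        | tmul z z' => simp
  induction z with
  | zero => simp
  | add x y hx hy => simp only [map_add, hx, hy]
  | tmul v z =>
    induction z with
    | zero => simp
    | add x y hx hy => simp only [map_add, tmul_add, hx, hy]
    | tmul x y => exact e (b.ρ v) (Coalgebra.comul x) (Coalgebra.comul y)

namespace IsPreantipode

variable {B : DualQuasiBialgebra k H} {S : H →ₗ[k] H}

/-- `v₍₀₎ ⊗ S(v₍₂₎)₁ ⊗ v₍₁₎ S(v₍₂₎)₂ = v₍₀₎ ⊗ S(v₍₁₎) ⊗ 1`. -/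
theorem lTensor_tmulAnti (hS : IsPreantipode B S) (b : RightCoaction k H V) (v : V) :
    LinearMap.lTensor (V ⊗[k] H) B.m.toLinearMap
        ((b.tensor (RightCoaction.reg k H)).ρ (b.tmulAnti S v)) =
      b.tmulAnti S v ⊗ₜ B.u 1 := by
  let K : H ⊗[k] H →ₗ[k] H ⊗[k] H := LinearMap.lTensor H B.m.toLinearMap ∘ₗ
    (TensorProduct.leftComm k H H H).toLinearMap ∘ₗ LinearMap.lTensor H (Coalgebra.comul ∘ₗ S)
  have e0 : ∀ (x : V ⊗[k] H) (c : H) (y : H ⊗[k] H),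
      Coalgebra.comul (R := k) (S c) = y → LinearMap.lTensor (V ⊗[k] H) B.m.toLinearMap
        (TensorProduct.tensorTensorTensorComm k V H H H (x ⊗ₜ y)) =
      (TensorProduct.assoc k V H H).symm (LinearMap.lTensor V K
        (TensorProduct.assoc k V H H (x ⊗ₜ c))) := by
    rintro x c y rfl
    induction x with
    | zero => simp
    | add x y hx hy => simp only [map_add, add_tmul, hx, hy]
    | tmul a a' =>
      simp only [K, TensorProduct.assoc_tmul, LinearMap.lTensor_tmul, LinearMap.comp_apply]
      induction Coalgebra.comul (R := k) (S c) with
      | zero => simp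
      | add x y hx hy => simp only [map_add, tmul_add, hx, hy]
      | tmul c d => simp
  have e1 : ∀ x : V ⊗[k] H, LinearMap.lTensor (V ⊗[k] H) B.m.toLinearMap
      ((b.tensor (RightCoaction.reg k H)).ρ (LinearMap.lTensor V S x)) =
      (TensorProduct.assoc k V H H).symm (LinearMap.lTensor V K
        (TensorProduct.assoc k V H H (LinearMap.rTensor H b.ρ x))) := by
    intro x
    induction x with
    | zero => simp
    | add x y hx hy => simp only [map_add, hx, hy]
    | tmul v c => exact e0 (b.ρ v) c _ rfl
  have hK : K ∘ₗ Coalgebra.comul = (TensorProduct.mk k H H).flip (B.u 1) ∘ₗ S :=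
    LinearMap.ext hS.right
  refine (e1 _).trans ?_
  rw [b.coassoc_apply, ← LinearMap.comp_apply, ← LinearMap.lTensor_comp, hK]
  change _ = LinearMap.lTensor V S (b.ρ v) ⊗ₜ B.u 1
  induction b.ρ v with
  | zero => simp
  | add x y hx hy => simp only [map_add, add_tmul, hx, hy]
  | tmul x y => simp

/-- `S(h₁)₁ h₂ ⊗ S(h₁)₂ ⊗ h₃ = 1 ⊗ S(h₁) ⊗ h₂`. -/
theorem rTensor_comul_antiTmulId (hS : IsPreantipode B S) (h : H) :
    LinearMap.rTensor (H ⊗[k] H) B.m.toLinearMap (Coalgebra.comul (R := k) (antiTmulId S h)) =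
      B.u 1 ⊗ₜ antiTmulId S h := by
  let K : H ⊗[k] H →ₗ[k] H ⊗[k] H := LinearMap.rTensor H B.m.toLinearMap ∘ₗ
    (TensorProduct.rightComm k H H H).toLinearMap ∘ₗ LinearMap.rTensor H (Coalgebra.comul ∘ₗ S)
  have e1 : ∀ x : H ⊗[k] H, LinearMap.rTensor (H ⊗[k] H) B.m.toLinearMap
      (Coalgebra.comul (R := k) (LinearMap.rTensor H S x)) =
      TensorProduct.assoc k H H H (LinearMap.rTensor H K
        ((TensorProduct.assoc k H H H).symm (LinearMap.lTensor H Coalgebra.comul x))) := by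
    intro x
    induction x with
    | zero => simp
    | add x y hx hy => simp only [map_add, hx, hy]
    | tmul a b =>
      simp only [LinearMap.lTensor_tmul, LinearMap.rTensor_tmul, comul_tmul]
      induction Coalgebra.comul (R := k) b with
      | zero => simp
      | add x y hx hy => simp only [map_add, tmul_add, hx, hy]
      | tmul b b' =>
        simp only [K, TensorProduct.assoc_symm_tmul, LinearMap.rTensor_tmul, LinearMap.comp_apply]
        induction Coalgebra.comul (R := k) (S a) with
        | zero => simp
        | add x y hx hy => simp only [map_add, add_tmul, hx, hy]
        | tmul c d => simp
  have hK : K ∘ₗ Coalgebra.comul = TensorProduct.mk k H H (B.u 1) ∘ₗ S :=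
    LinearMap.ext hS.left
  refine (e1 _).trans ?_
  rw [Coalgebra.coassoc_symm_apply, ← LinearMap.comp_apply, ← LinearMap.rTensor_comp, hK]
  change _ = B.u 1 ⊗ₜ LinearMap.rTensor H S (Coalgebra.comul h)
  induction Coalgebra.comul (R := k) h with
  | zero => simp
  | add x y hx hy => simp only [map_add, tmul_add, hx, hy]
  | tmul x y => simp

/-- For `T(v) = v₍₀₎ ⊗ S(v₍₁₎) ⊗ v₍₂₎`, multiplying the first two factors of `T(v)₍₁₎` in
`T(v)₍₀₎ ⊗ T(v)₍₁₎` yields `T(v₍₀₎) ⊗ (1 ⊗ v₍₁₎)`. -/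
theorem lTensor_antiTriple (hS : IsPreantipode B S) (b : RightCoaction k H V) (v : V) :
    LinearMap.lTensor (V ⊗[k] H ⊗[k] H) (LinearMap.rTensor H B.m.toLinearMap)
        (b.tensor₃.ρ (b.antiTriple S v)) =
      TensorProduct.map (b.antiTriple S) (TensorProduct.mk k H H (B.u 1)) (b.ρ v) := by
  have e1 : ∀ x : V ⊗[k] H, LinearMap.lTensor (V ⊗[k] H ⊗[k] H)
      (LinearMap.rTensor H B.m.toLinearMap) (b.tensor₃.ρ (LinearMap.rTensor H (b.tmulAnti S) x)) =
      TensorProduct.map (LinearMap.rTensor H (b.tmulAnti S)) (TensorProduct.mk k H H (B.u 1))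
        ((TensorProduct.assoc k V H H).symm (LinearMap.lTensor V Coalgebra.comul x)) := by
    have e2 : ∀ (y : (V ⊗[k] H) ⊗[k] (H ⊗[k] H)) (z : H ⊗[k] H),
        LinearMap.lTensor (V ⊗[k] H ⊗[k] H) (LinearMap.rTensor H B.m.toLinearMap)
          (TensorProduct.tensorTensorTensorComm k (V ⊗[k] H) (H ⊗[k] H) H H (y ⊗ₜ z)) =
        TensorProduct.tensorTensorTensorComm k (V ⊗[k] H) H H H
          (LinearMap.lTensor (V ⊗[k] H) B.m.toLinearMap y ⊗ₜ z) := by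
      intro y z
      induction y with
      | zero => simp
      | add x y hx hy => simp only [map_add, add_tmul, hx, hy]
      | tmul y y' =>
        induction z with
        | zero => simp
        | add x y hx hy => simp only [map_add, tmul_add, hx, hy]
        | tmul z z' => simp
    intro x
    induction x with
    | zero => simp
    | add x y hx hy => simp only [map_add, hx, hy]
    | tmul v c =>
      refine (e2 ((b.tensor (RightCoaction.reg k H)).ρ (b.tmulAnti S v))
        (Coalgebra.comul c)).trans ?_
      rw [hS.lTensor_tmulAnti, LinearMap.lTensor_tmul]
      induction Coalgebra.comul (R := k) c with
      | zero => simp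
      | add x y hx hy => simp only [map_add, tmul_add, hx, hy]
      | tmul x y => simp
  refine (e1 _).trans ?_
  rw [b.coassoc_symm_apply, LinearMap.map_rTensor]
  rfl

/-- For `T(v) = v₍₀₎ ⊗ S(v₍₁₎) ⊗ v₍₂₎`, multiplying the last two factors of `T(v)₍₀₎` in
`T(v)₍₀₎ ⊗ T(v)₍₁₎` yields `(v₍₀₎ ⊗ 1) ⊗ (v₍₁₎ ⊗ S(v₍₂₎) ⊗ v₍₃₎)`. -/
theorem rTensor_antiTriple (hS : IsPreantipode B S) (b : RightCoaction k H V) (v : V) :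
    LinearMap.rTensor (H ⊗[k] H ⊗[k] H)
        (LinearMap.lTensor V B.m.toLinearMap ∘ₗ (TensorProduct.assoc k V H H).toLinearMap)
        (b.tensor₃.ρ (b.antiTriple S v)) =
      TensorProduct.map ((TensorProduct.mk k V H).flip (B.u 1))
        ((RightCoaction.reg k H).antiTriple S) (b.ρ v) := by
  have e1 : ∀ x : V ⊗[k] H, TensorProduct.map (LinearMap.lTensor V B.m.toLinearMap)
      (TensorProduct.assoc k H H H).symm.toLinearMap
      ((b.tensor (RightCoaction.reg k (H ⊗[k] H))).ρ (LinearMap.lTensor V (antiTmulId S) x)) =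
      TensorProduct.map ((TensorProduct.mk k V H).flip (B.u 1))
        ((TensorProduct.assoc k H H H).symm.toLinearMap ∘ₗ LinearMap.lTensor H (antiTmulId S))
        (TensorProduct.assoc k V H H (LinearMap.rTensor H b.ρ x)) := by
    have e2 : ∀ (y : V ⊗[k] H) (z : (H ⊗[k] H) ⊗[k] (H ⊗[k] H)),
        LinearMap.rTensor (H ⊗[k] (H ⊗[k] H)) (LinearMap.lTensor V B.m.toLinearMap)
          (TensorProduct.tensorTensorTensorComm k V H (H ⊗[k] H) (H ⊗[k] H) (y ⊗ₜ z)) =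
        TensorProduct.tensorTensorTensorComm k V H H (H ⊗[k] H)
          (y ⊗ₜ LinearMap.rTensor (H ⊗[k] H) B.m.toLinearMap z) := by
      intro y z
      induction y with
      | zero => simp
      | add x y hx hy => simp only [map_add, add_tmul, hx, hy]
      | tmul y y' =>
        induction z with
        | zero => simp
        | add x y hx hy => simp only [map_add, tmul_add, hx, hy]
        | tmul z z' => simp
    intro x
    induction x with
    | zero => simp
    | add x y hx hy => simp only [map_add, hx, hy]
    | tmul v c =>
      rw [← LinearMap.lTensor_comp_rTensor, LinearMap.comp_apply]
      refine (congrArg _ (e2 (b.ρ v) (Coalgebra.comul (antiTmulId S c)))).trans ?_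
      rw [hS.rTensor_comul_antiTmulId, LinearMap.rTensor_tmul]
      induction b.ρ v with
      | zero => simp
      | add x y hx hy => simp only [map_add, add_tmul, hx, hy]
      | tmul x y => simp
  have hm : ∀ z : (V ⊗[k] (H ⊗[k] H)) ⊗[k] (H ⊗[k] (H ⊗[k] H)),
      LinearMap.rTensor (H ⊗[k] H ⊗[k] H)
        (LinearMap.lTensor V B.m.toLinearMap ∘ₗ (TensorProduct.assoc k V H H).toLinearMap)
      (TensorProduct.map (TensorProduct.assoc k V H H).symm.toLinearMap
        (TensorProduct.assoc k H H H).symm.toLinearMap z) =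
      TensorProduct.map (LinearMap.lTensor V B.m.toLinearMap)
      (TensorProduct.assoc k H H H).symm.toLinearMap z := by
    intro z
    induction z with
    | zero => simp
    | add x y hx hy => simp only [map_add, hx, hy]
    | tmul x y => simp
  rw [b.antiTriple_eq, b.tensor₃_assoc_symm]
  refine (hm _).trans ((e1 _).trans ?_)
  rw [b.coassoc_apply, LinearMap.map_lTensor]
  congr 2
  ext x
  exact ((RightCoaction.reg k H).antiTriple_eq S x).symm

end IsPreantipode

end Triple

/-! ### The projection onto the right coinvariants -/

section Projection

variable {k : Type v} {H : Type u} [Field k] [AddCommGroup H] [Module k H] [Coalgebra k H]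

/-- The codiagonal left coaction of `H ⊗ H ⊗ H` on `V ⊗ H ⊗ H`. -/
abbrev LeftCoaction.tensor₃ {V : Type*} [AddCommGroup V] [Module k V] (a : LeftCoaction k H V) :
    LeftCoaction k (H ⊗[k] H ⊗[k] H) (V ⊗[k] H ⊗[k] H) :=
  (a.tensor (LeftCoaction.reg k H)).tensor (LeftCoaction.reg k H)

theorem LeftCoaction.op_op_eq_self {C V : Type*} [AddCommGroup C] [Module k C] [Coalgebra k C]
    [AddCommGroup V] [Module k V] (a : LeftCoaction k C V) {f g : C →ₗ[k] k}
    (h : toConv g * toConv f = 1) : a.op f ∘ₗ a.op g = LinearMap.id := by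
  rw [a.op_comp, h]
  exact a.op_counit

/-- The map `f ⊗ ε`, `z ⊗ h ↦ ε(h) f(z)`. -/
def mapCounit {V W : Type*} [AddCommGroup V] [Module k V] [AddCommGroup W] [Module k W]
    (H : Type*) [AddCommGroup H] [Module k H] [Coalgebra k H] (f : V →ₗ[k] W) :
    V ⊗[k] H →ₗ[k] W :=
  (TensorProduct.rid k W).toLinearMap ∘ₗ TensorProduct.map f Coalgebra.counit

@[simp]
theorem mapCounit_tmul {V W : Type*} [AddCommGroup V] [Module k V] [AddCommGroup W] [Module k W]
    (f : V →ₗ[k] W) (z : V) (h : H) :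
    mapCounit H f (z ⊗ₜ[k] h) = Coalgebra.counit (R := k) h • f z := by
  simp [mapCounit]

/-- The right coaction of `H` on the last factor of `V ⊗ H` commutes with the codiagonal left
coaction of `C ⊗ H`, for a left coaction of an arbitrary coalgebra `C` on `V`. -/
theorem freeRight_compat {C V : Type*} [AddCommGroup C] [Module k C] [Coalgebra k C]
    [AddCommGroup V] [Module k V] (a : LeftCoaction k C V) :
    Compat (a.tensor (LeftCoaction.reg k H)) (freeRight k H V) := by
  let Φ : (C ⊗[k] V) ⊗[k] (H ⊗[k] (H ⊗[k] H)) →ₗ[k] (C ⊗[k] H) ⊗[k] (V ⊗[k] H ⊗[k] H) :=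
    LinearMap.lTensor (C ⊗[k] H) (TensorProduct.assoc k V H H).symm.toLinearMap ∘ₗ
      (TensorProduct.tensorTensorTensorComm k C V H (H ⊗[k] H)).toLinearMap
  have e1 : ∀ (v : V) (x : H ⊗[k] H), TensorProduct.assoc k (C ⊗[k] H) (V ⊗[k] H) H
      (LinearMap.rTensor H (a.tensor (LeftCoaction.reg k H)).ρ
        ((TensorProduct.assoc k V H H).symm (v ⊗ₜ x))) =
      Φ (a.ρ v ⊗ₜ TensorProduct.assoc k H H H (LinearMap.rTensor H Coalgebra.comul x)) := by
    intro v x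
    induction x with
    | zero => simp
    | add y z hy hz => simp only [map_add, tmul_add, hy, hz]
    | tmul c d =>
      simp only [TensorProduct.assoc_symm_tmul, LinearMap.rTensor_tmul, LinearMap.comp_apply,
        LeftCoaction.tensor, LeftCoaction.reg, TensorProduct.map_tmul]
      induction a.ρ v with
      | zero => simp
      | add y z hy hz => simp only [map_add, add_tmul, hy, hz]
      | tmul g w =>
        induction Coalgebra.comul (R := k) c with
        | zero => simp
        | add y z hy hz => simp only [map_add, tmul_add, add_tmul, hy, hz]
        | tmul c d => simp [Φ]
  have e2 : ∀ (y : C ⊗[k] V) (x : H ⊗[k] H), LinearMap.lTensor (C ⊗[k] H) (freeRight k H V).ρ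
      (TensorProduct.tensorTensorTensorComm k C V H H (y ⊗ₜ x)) =
      Φ (y ⊗ₜ LinearMap.lTensor H Coalgebra.comul x) := by
    intro y x
    induction x with
    | zero => simp
    | add y z hy hz => simp only [map_add, tmul_add, hy, hz]
    | tmul c d =>
      induction y with
      | zero => simp
      | add y z hy hz => simp only [map_add, add_tmul, hy, hz]
      | tmul g w => simp [freeRight, Φ]
  refine TensorProduct.ext' fun v h => ?_
  have h1 := e1 v (Coalgebra.comul h)
  rw [Coalgebra.coassoc_apply] at h1
  exact h1.trans (e2 (a.ρ v) (Coalgebra.comul h)).symm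

/-- `T(v₍₀₎) ⊗ v₍₁₎ = v₍₀₎ ⊗ S(v₍₁₎) ⊗ (v₍₂₎ ⊗ v₍₃₎)` for `T(v) = v₍₀₎ ⊗ S(v₍₁₎) ⊗ v₍₂₎`. -/
theorem RightCoaction.rTensor_antiTriple_ρ {V : Type*} [AddCommGroup V] [Module k V]
    (S : H →ₗ[k] H) (b : RightCoaction k H V) (v : V) :
    LinearMap.rTensor H (b.antiTriple S) (b.ρ v) =
      (freeRight k H (V ⊗[k] H)).ρ (b.antiTriple S v) := by
  have e1 : ∀ x : V ⊗[k] H, LinearMap.rTensor H (LinearMap.rTensor H (b.tmulAnti S))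
      ((TensorProduct.assoc k V H H).symm (LinearMap.lTensor V Coalgebra.comul x)) =
      (freeRight k H (V ⊗[k] H)).ρ (LinearMap.rTensor H (b.tmulAnti S) x) := by
    intro x
    induction x with
    | zero => simp
    | add x y hx hy => simp only [map_add, hx, hy]
    | tmul v h =>
      simp only [freeRight, LinearMap.lTensor_tmul, LinearMap.rTensor_tmul, LinearMap.comp_apply,
        LinearEquiv.coe_coe]
      induction Coalgebra.comul (R := k) h with
      | zero => simp
      | add x y hx hy => simp only [map_add, tmul_add, hx, hy]
      | tmul a b => simp
  refine Eq.trans ?_ (e1 (b.ρ v))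
  rw [b.coassoc_symm_apply]
  exact LinearMap.rTensor_comp_apply H _ b.ρ (b.ρ v)

variable {B : DualQuasiBialgebra k H}

namespace QuasiHopfBicomodule

variable (M : QuasiHopfBicomodule B) (S : H →ₗ[k] H)

/-- The map `x ↦ ω(x₍₋₁₎ ⊗ S(x₍₁₎)₁ ⊗ x₍₂₎) x₍₀₎ S(x₍₁₎)₂`. For a preantipode `S` it projects the
dual quasi-Hopf bicomodule `M` onto its right coinvariants. -/
def proj : M.carrier →ₗ[k] M.carrier :=
  mapCounit H M.act ∘ₗ M.left.tensor₃.op B.ω.val.ofConv ∘ₗ M.right.antiTriple S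

/-- `proj(x₍₀₎) ⊗ x₍₁₎ = ω(x₍₋₁₎ ⊗ S(x₍₁₎)₁ ⊗ x₍₂₎) x₍₀₎ S(x₍₁₎)₂ ⊗ x₍₃₎`. -/
theorem rTensor_proj_ρ (x : M.carrier) :
    LinearMap.rTensor H (M.proj S) (M.right.ρ x) =
      LinearMap.rTensor H M.act
        (M.left.tensor₃.op B.ω.val.ofConv (M.right.antiTriple S x)) := by
  have h1 := LinearMap.congr_fun
    ((freeRight_compat (M.left.tensor (LeftCoaction.reg k H))).ρ_op B.ω.val.ofConv)
    (M.right.antiTriple S x)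
  simp only [LinearMap.comp_apply] at h1
  have h2 : LinearMap.rTensor H (mapCounit H M.act) ∘ₗ (freeRight k H _).ρ =
      LinearMap.rTensor H M.act := by
    refine TensorProduct.ext' fun z h => ?_
    have e : ∀ y : H ⊗[k] H, LinearMap.rTensor H (mapCounit H M.act)
        ((TensorProduct.assoc k (M.carrier ⊗[k] H) H H).symm (z ⊗ₜ y)) =
        M.act z ⊗ₜ TensorProduct.lid k H (LinearMap.rTensor H Coalgebra.counit y) := by
      intro y
      induction y with
      | zero => simp
      | add x y hx hy => simp only [map_add, tmul_add, hx, hy]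
      | tmul a b => simp [smul_tmul]
    refine (e (Coalgebra.comul h)).trans ?_
    simp
  rw [← h2, LinearMap.comp_apply, h1, ← RightCoaction.rTensor_antiTriple_ρ]
  simp only [proj, LinearMap.rTensor_comp, LinearMap.comp_apply]

/-- Every element of `M` is recovered from its projections: `proj(x₍₀₎) x₍₁₎ = x`. -/
theorem act_rTensor_proj {S : H →ₗ[k] H} (hS : IsPreantipode B S) (x : M.carrier) :
    M.act (LinearMap.rTensor H (M.proj S) (M.right.ρ x)) = x := by
  have h1 := LinearMap.congr_fun M.act_assoc
    (M.left.tensor₃.op B.ω.val.ofConv (M.right.antiTriple S x))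
  -- The factor `ω⁻¹` of the associativity constraint cancels the factor `ω` of the projection.
  have h2 := LinearMap.congr_fun (M.left.tensor₃.op_op_eq_self
    (f := B.ω⁻¹.val.ofConv) (g := B.ω.val.ofConv) B.ω.mul_inv)
    (M.right.antiTriple S x)
  have h3 : LinearMap.lTensor M.carrier B.m.toLinearMap ∘ₗ
      (TensorProduct.assoc k M.carrier H H).toLinearMap ∘ₗ
        (TensorProduct.rid k _).toLinearMap ∘ₗ LinearMap.lTensor _ B.ω.val.ofConv =
      (TensorProduct.rid k _).toLinearMap ∘ₗ LinearMap.lTensor _ B.ω.val.ofConv ∘ₗ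
        LinearMap.rTensor _ (LinearMap.lTensor M.carrier B.m.toLinearMap ∘ₗ
          (TensorProduct.assoc k M.carrier H H).toLinearMap) := by
    ext; simp
  have h4 := LinearMap.congr_fun h3 (M.right.tensor₃.ρ (M.right.antiTriple S x))
  have h5 := hS.rTensor_antiTriple M.right x
  simp only [LinearMap.comp_apply, LinearEquiv.coe_coe] at h4
  rw [h5] at h4
  rw [rTensor_proj_ρ]
  refine h1.trans ?_
  change M.act (LinearMap.lTensor M.carrier B.m.toLinearMap (TensorProduct.assoc k _ _ _
    (M.right.tensor₃.op B.ω.val.ofConv ((M.left.tensor₃.op B.ω⁻¹.val.ofConv ∘ₗ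
      M.left.tensor₃.op B.ω.val.ofConv) (M.right.antiTriple S x))))) = x
  rw [h2]
  refine (congrArg M.act h4).trans ?_
  have h7 : ∀ y : M.carrier ⊗[k] H, M.act (TensorProduct.rid k _ (LinearMap.lTensor _
      B.ω.val.ofConv (TensorProduct.map ((TensorProduct.mk k M.carrier H).flip (B.u 1))
        ((RightCoaction.reg k H).antiTriple S) y))) =
      TensorProduct.rid k _ (LinearMap.lTensor _ Coalgebra.counit y) := by
    intro y
    induction y with
    | zero => simp
    | add x y hx hy => simp only [map_add, hx, hy]
    | tmul y h =>
      have := LinearMap.congr_fun hS.ω h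
      change B.ω.val.ofConv ((RightCoaction.reg k H).antiTriple S h) = _ at this
      simp [this, M.act_one]
  rw [h7]
  exact LinearMap.congr_fun M.right.counit x

theorem proj_mem_coinv {S : H →ₗ[k] H} (hS : IsPreantipode B S) (x : M.carrier) :
    M.proj S x ∈ M.coinv := by
  have hc : Compat M.left.tensor₃ M.right.tensor₃ := (M.compat.tensor Compat.reg).tensor Compat.reg
  -- Right colinearity of the action, applied to the first two factors.
  have h1 : M.right.ρ ∘ₗ mapCounit H M.act =
      TensorProduct.map (mapCounit H M.act) (mapCounit H LinearMap.id) ∘ₗ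
        LinearMap.lTensor _ (LinearMap.rTensor H B.m.toLinearMap) ∘ₗ M.right.tensor₃.ρ := by
    have e : ∀ (y : (M.carrier ⊗[k] H) ⊗[k] (H ⊗[k] H)) (z : H ⊗[k] H),
        TensorProduct.map (mapCounit H M.act) (mapCounit H LinearMap.id)
          (LinearMap.lTensor _ (LinearMap.rTensor H B.m.toLinearMap)
            (TensorProduct.tensorTensorTensorComm k _ _ H H (y ⊗ₜ z))) =
        TensorProduct.lid k k (TensorProduct.map Coalgebra.counit Coalgebra.counit z) •
          LinearMap.rTensor H M.act (LinearMap.lTensor _ B.m.toLinearMap y) := by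
      intro y z
      induction y with
      | zero => simp
      | add x y hx hy => simp only [map_add, add_tmul, smul_add, hx, hy]
      | tmul y y' =>
        induction z with
        | zero => simp
        | add x y hx hy => simp only [map_add, tmul_add, add_smul, hx, hy]
        | tmul z z' => simp [smul_tmul', smul_smul, mul_comm, tmul_smul]
    refine TensorProduct.ext' fun z h => ?_
    refine Eq.trans ?_ (e ((M.right.tensor (RightCoaction.reg k H)).ρ z)
      (Coalgebra.comul h)).symm
    have h0 := LinearMap.congr_fun M.act_right_colin z
    have h2 : TensorProduct.lid k k (TensorProduct.map Coalgebra.counit Coalgebra.counit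
        (Coalgebra.comul (R := k) h)) = Coalgebra.counit h := by
      rw [← LinearMap.lTensor_comp_rTensor, LinearMap.comp_apply]
      simp
    rw [h2, LinearMap.comp_apply, mapCounit_tmul, map_smul]
    exact congrArg _ h0
  have h2 := LinearMap.congr_fun (hc.ρ_op B.ω.val.ofConv) (M.right.antiTriple S x)
  have h3 := LinearMap.congr_fun h1
    (M.left.tensor₃.op B.ω.val.ofConv (M.right.antiTriple S x))
  simp only [LinearMap.comp_apply] at h2 h3
  rw [h2] at h3
  refine h3.trans ?_
  have h4 : ∀ y : (M.carrier ⊗[k] H ⊗[k] H) ⊗[k] (H ⊗[k] H ⊗[k] H),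
      LinearMap.lTensor _ (LinearMap.rTensor H B.m.toLinearMap)
        (LinearMap.rTensor _ (M.left.tensor₃.op B.ω.val.ofConv) y) =
      LinearMap.rTensor _ (M.left.tensor₃.op B.ω.val.ofConv)
        (LinearMap.lTensor _ (LinearMap.rTensor H B.m.toLinearMap) y) := by
    intro y
    simp only [← LinearMap.comp_apply, LinearMap.lTensor_comp_rTensor,
      LinearMap.rTensor_comp_lTensor]
  rw [h4, hS.lTensor_antiTriple]
  have h5 : ∀ y : M.carrier ⊗[k] H,
      TensorProduct.map (mapCounit H M.act) (mapCounit H LinearMap.id)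
        (LinearMap.rTensor _ (M.left.tensor₃.op B.ω.val.ofConv)
          (TensorProduct.map (M.right.antiTriple S) (TensorProduct.mk k H H (B.u 1)) y)) =
      M.proj S (TensorProduct.rid k _ (LinearMap.lTensor _ Coalgebra.counit y)) ⊗ₜ B.u 1 := by
    intro y
    induction y with
    | zero => simp
    | add x y hx hy => simp only [map_add, add_tmul, hx, hy]
    | tmul y h => simp [proj, smul_tmul]
  rw [h5]
  exact congrArg (fun z => M.proj S z ⊗ₜ[k] B.u 1) (LinearMap.congr_fun M.right.counit x)

/-- The projection is natural in the bicomodule. -/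
theorem Hom.proj_apply {M N : QuasiHopfBicomodule B} (f : QuasiHopfBicomodule.Hom M N)
    (x : M.carrier) : N.proj S (f.toLin x) = f.toLin (M.proj S x) := by
  have h0 : N.right.tmulAnti S ∘ₗ f.toLin = LinearMap.rTensor H f.toLin ∘ₗ M.right.tmulAnti S := by
    unfold RightCoaction.tmulAnti
    rw [LinearMap.comp_assoc, f.right_colin, ← LinearMap.comp_assoc, ← LinearMap.comp_assoc,
      LinearMap.lTensor_comp_rTensor, LinearMap.rTensor_comp_lTensor]
  have h1 : N.right.antiTriple S ∘ₗ f.toLin =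
      LinearMap.rTensor H (LinearMap.rTensor H f.toLin) ∘ₗ M.right.antiTriple S := by
    unfold RightCoaction.antiTriple
    rw [LinearMap.comp_assoc, f.right_colin, ← LinearMap.comp_assoc, ← LinearMap.comp_assoc,
      ← LinearMap.rTensor_comp, h0, LinearMap.rTensor_comp]
  have hf : Colin M.left N.left LinearMap.id f.toLin := f.left_colin
  have h2 := ((hf.rTensor (LeftCoaction.reg k H)).rTensor
    (LeftCoaction.reg k H)).op_natural B.ω.val.ofConv
  rw [LinearMap.rTensor_id, LinearMap.rTensor_id, LinearMap.comp_id] at h2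
  have h3 : mapCounit H N.act ∘ₗ LinearMap.rTensor H (LinearMap.rTensor H f.toLin) =
      f.toLin ∘ₗ mapCounit H M.act := by
    refine TensorProduct.ext' fun z h => ?_
    have := LinearMap.congr_fun f.map_act z
    simp only [LinearMap.comp_apply] at this
    simp [this]
  have e1 := LinearMap.congr_fun h1 x
  have e2 := LinearMap.congr_fun h2 (M.right.antiTriple S x)
  have e3 := LinearMap.congr_fun h3 (M.left.tensor₃.op B.ω.val.ofConv (M.right.antiTriple S x))
  simp only [LinearMap.comp_apply] at e1 e2 e3
  simp only [proj, LinearMap.comp_apply]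
  rw [e1, e2, e3]

end QuasiHopfBicomodule

end Projection

/-! ### The projection of a free bicomodule -/

section Reassoc

variable {k H V : Type*} [Field k] [AddCommGroup H] [Module k H] [AddCommGroup V] [Module k V]

/-- The reassociation `x ⊗ ((y ⊗ z) ⊗ w) ↦ ((x ⊗ y) ⊗ z) ⊗ w`. -/
def reassoc (k H V : Type*) [Field k] [AddCommGroup H] [Module k H] [AddCommGroup V] [Module k V] :
    V ⊗[k] (H ⊗[k] H ⊗[k] H) →ₗ[k] V ⊗[k] H ⊗[k] H ⊗[k] H :=
  LinearMap.rTensor H (TensorProduct.assoc k V H H).symm.toLinearMap ∘ₗ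
    (TensorProduct.assoc k V (H ⊗[k] H) H).symm.toLinearMap

@[simp]
theorem reassoc_tmul (x : V) (y z w : H) :
    reassoc k H V (x ⊗ₜ (y ⊗ₜ z ⊗ₜ w)) = x ⊗ₜ y ⊗ₜ z ⊗ₜ w := by
  simp [reassoc]

end Reassoc

section FreeProjection

variable {k : Type v} {H : Type u} [Field k] [AddCommGroup H] [Module k H] [Coalgebra k H]
variable (B : DualQuasiBialgebra k H)

/-- The cocycle identity in the form
`ω(m ⊗ H ⊗ H) ∗ (ω⁻¹ ⊗ ε) = ω⁻¹(H ⊗ H ⊗ m) ∗ (ε ⊗ ω) ∗ ω(H ⊗ m ⊗ H)`. -/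
theorem DualQuasiBialgebra.cocycle_mixed :
    toConv (B.ω.val.ofConv ∘ₗ mul₁₂ B.m) * toConv (tensorCounit B.ω⁻¹.val.ofConv) =
      toConv (B.ω⁻¹.val.ofConv ∘ₗ mul₃₄ B.m) * toConv (counitTensor B.ω.val.ofConv) *
        toConv (B.ω.val.ofConv ∘ₗ mul₂₃ B.m) := by
  let j₁₂ : H ⊗[k] H ⊗[k] H ⊗[k] H →ₗc[k] H ⊗[k] H ⊗[k] H :=
    Coalgebra.TensorProduct.map (Coalgebra.TensorProduct.map B.m (CoalgHom.id k H))
      (CoalgHom.id k H)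
  let j₂₃ : H ⊗[k] H ⊗[k] H ⊗[k] H →ₗc[k] H ⊗[k] H ⊗[k] H :=
    Coalgebra.TensorProduct.map ((Coalgebra.TensorProduct.map (CoalgHom.id k H) B.m).comp
      (Coalgebra.TensorProduct.assoc k k H H H).toCoalgHom) (CoalgHom.id k H)
  have e₁₂ : j₁₂.toLinearMap = mul₁₂ B.m := by ext; rfl
  have e₂₃ : j₂₃.toLinearMap = mul₂₃ B.m := by ext; rfl
  have h₁₂ := (B.pull (C := H ⊗[k] H ⊗[k] H ⊗[k] H) j₁₂).mul_inv
  have h₂₃ := (B.pull (C := H ⊗[k] H ⊗[k] H ⊗[k] H) j₂₃).inv_mul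
  change toConv (B.ω.val.ofConv ∘ₗ j₁₂.toLinearMap) *
    toConv (B.ω⁻¹.val.ofConv ∘ₗ j₁₂.toLinearMap) = 1 at h₁₂
  change toConv (B.ω⁻¹.val.ofConv ∘ₗ j₂₃.toLinearMap) *
    toConv (B.ω.val.ofConv ∘ₗ j₂₃.toLinearMap) = 1 at h₂₃
  rw [e₁₂] at h₁₂
  rw [e₂₃] at h₂₃
  have h := congrArg (fun q => toConv (B.ω.val.ofConv ∘ₗ mul₁₂ B.m) * q *
    toConv (B.ω.val.ofConv ∘ₗ mul₂₃ B.m)) B.cocycle_inv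
  simp only [mul_assoc] at h
  rw [h₂₃, _root_.mul_one, ← mul_assoc, h₁₂, _root_.one_mul, ← mul_assoc] at h
  exact h.symm

/-- The inverse of the reassociator is unital in its second argument, being pulled back to the
inverse of the trivial functional along `h ⊗ l ↦ h ⊗ 1 ⊗ l`. -/
theorem DualQuasiBialgebra.ω_inv_one_mid (h l : H) :
    B.ω⁻¹.val.ofConv (h ⊗ₜ B.u 1 ⊗ₜ l) =
      Coalgebra.counit (R := k) h * Coalgebra.counit (R := k) l := by
  let j : H ⊗[k] H →ₗc[k] H ⊗[k] H ⊗[k] H :=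
    Coalgebra.TensorProduct.map ((Coalgebra.TensorProduct.map (CoalgHom.id k H) B.u).comp
      (Coalgebra.TensorProduct.rid k k H).symm.toCoalgHom) (CoalgHom.id k H)
  have h1 : B.pull j = 1 := by
    refine Units.ext (congrArg toConv ?_)
    ext h l
    refine (B.ω_one_mid h l).trans ?_
    simp [mul_comm]
  have h2 : (B.pull j)⁻¹ = 1 := by rw [h1, inv_one]
  refine (congrArg (fun q => q.val.ofConv (h ⊗ₜ l)) h2).trans ?_
  change Coalgebra.counit (R := k) (h ⊗ₜ[k] l) = _
  simp [mul_comm]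

/-- The reassociation intertwines the codiagonal left coactions. -/
theorem reassoc_colin {V : Type*} [AddCommGroup V] [Module k V] (a : LeftCoaction k H V) :
    Colin (a.tensor (LeftCoaction.reg k (H ⊗[k] H ⊗[k] H)))
      (a.tensor₃.tensor (LeftCoaction.reg k H)) (reassoc k H H) (reassoc k H V) := by
  have e : ∀ (t : H ⊗[k] V) (x y z : H ⊗[k] H),
      TensorProduct.tensorTensorTensorComm k (H ⊗[k] H ⊗[k] H) (V ⊗[k] H ⊗[k] H) H H
        (TensorProduct.tensorTensorTensorComm k (H ⊗[k] H) (V ⊗[k] H) H H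
          (TensorProduct.tensorTensorTensorComm k H V H H (t ⊗ₜ x) ⊗ₜ y) ⊗ₜ z) =
      TensorProduct.map (reassoc k H H) (reassoc k H V)
        (TensorProduct.tensorTensorTensorComm k H V (H ⊗[k] H ⊗[k] H) (H ⊗[k] H ⊗[k] H)
          (t ⊗ₜ TensorProduct.tensorTensorTensorComm k (H ⊗[k] H) (H ⊗[k] H) H H
            (TensorProduct.tensorTensorTensorComm k H H H H (x ⊗ₜ y) ⊗ₜ z))) := by
    intro t x y z
    induction t with
    | zero => simp
    | add x x' hx hx' => simp only [map_add, add_tmul, hx, hx']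
    | tmul t t' =>
      induction x with
      | zero => simp
      | add x x' hx hx' => simp only [map_add, add_tmul, tmul_add, hx, hx']
      | tmul x x' =>
        induction y with
        | zero => simp
        | add x x' hx hx' => simp only [map_add, add_tmul, tmul_add, hx, hx']
        | tmul y y' =>
          induction z with
          | zero => simp
          | add x x' hx hx' => simp only [map_add, tmul_add, hx, hx']
          | tmul z z' => simp
  unfold Colin
  ext v x y z
  change (a.tensor₃.tensor (LeftCoaction.reg k H)).ρ (reassoc k H V (v ⊗ₜ (x ⊗ₜ y ⊗ₜ z))) =
    TensorProduct.map (reassoc k H H) (reassoc k H V)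
      ((a.tensor (LeftCoaction.reg k (H ⊗[k] H ⊗[k] H))).ρ (v ⊗ₜ (x ⊗ₜ y ⊗ₜ z)))
  rw [reassoc_tmul]
  exact (e (a.ρ v) (Coalgebra.comul x) (Coalgebra.comul y) (Coalgebra.comul z))

/-- The convolution product of functionals on `H ⊗ H ⊗ H ⊗ H`, evaluated on
`x ⊗ y` for `y` in the product of the last three factors. -/
theorem convMul_reassoc (f g : H ⊗[k] H ⊗[k] H ⊗[k] H →ₗ[k] k) (x : H) (y : H ⊗[k] H ⊗[k] H) :
    (toConv f * toConv g).ofConv (reassoc k H H (x ⊗ₜ y)) =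
      TensorProduct.lid k k (TensorProduct.map (f ∘ₗ reassoc k H H) (g ∘ₗ reassoc k H H)
        (TensorProduct.tensorTensorTensorComm k H H (H ⊗[k] H ⊗[k] H) (H ⊗[k] H ⊗[k] H)
          (Coalgebra.comul (R := k) x ⊗ₜ Coalgebra.comul (R := k) y))) := by
  have h := LinearMap.congr_fun (reassoc_colin (k := k) (LeftCoaction.reg k H)) (x ⊗ₜ y)
  have e : (toConv f * toConv g).ofConv (reassoc k H H (x ⊗ₜ y)) =
      TensorProduct.lid k k (TensorProduct.map f g
        (Coalgebra.comul (R := k) (reassoc k H H (x ⊗ₜ y)))) := by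
    rw [LinearMap.convMul_def]
    simp only [LinearMap.comp_apply]
    induction Coalgebra.comul (R := k) (reassoc k H H (x ⊗ₜ y)) with
    | zero => simp
    | add x y hx hy => simp only [map_add, hx, hy]
    | tmul x y => simp
  rw [e]
  refine (congrArg (fun z => TensorProduct.lid k k (TensorProduct.map f g z)) h).trans ?_
  rw [TensorProduct.map_comp]
  rfl

variable {B} {S : H →ₗ[k] H}

/-- At `x ⊗ h₁ ⊗ S(h₂) ⊗ h₃` the factor `ω(H ⊗ m ⊗ H)` on the right of a convolution product is
trivial: its argument becomes `x ⊗ 1 ⊗ h`. -/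
theorem IsPreantipode.convMul_mul₂₃ (hS : IsPreantipode B S)
    (f : H ⊗[k] H ⊗[k] H ⊗[k] H →ₗ[k] k) (x h : H) :
    (toConv f * toConv (B.ω.val.ofConv ∘ₗ mul₂₃ B.m)).ofConv
        (reassoc k H H (x ⊗ₜ (RightCoaction.reg k H).antiTriple S h)) =
      f (reassoc k H H (x ⊗ₜ (RightCoaction.reg k H).antiTriple S h)) := by
  let U := (RightCoaction.reg k H).antiTriple S
  let F : H ⊗[k] (H ⊗[k] H) →ₗ[k] k := B.ω.val.ofConv ∘ₗ (TensorProduct.assoc k H H H).symm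
  have e1 : (B.ω.val.ofConv ∘ₗ mul₂₃ B.m) ∘ₗ reassoc k H H =
      F ∘ₗ LinearMap.lTensor H (LinearMap.rTensor H B.m.toLinearMap) := by
    ext x y z w
    simp [F, mul₂₃, mulRight]
  have e2 : ∀ (z : H ⊗[k] H) (y : (H ⊗[k] H ⊗[k] H) ⊗[k] (H ⊗[k] H ⊗[k] H)),
      TensorProduct.map (f ∘ₗ reassoc k H H)
        (F ∘ₗ LinearMap.lTensor H (LinearMap.rTensor H B.m.toLinearMap))
        (TensorProduct.tensorTensorTensorComm k H H (H ⊗[k] H ⊗[k] H) (H ⊗[k] H ⊗[k] H)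
          (z ⊗ₜ y)) = TensorProduct.map (f ∘ₗ reassoc k H H) F
        (TensorProduct.tensorTensorTensorComm k H H (H ⊗[k] H ⊗[k] H) (H ⊗[k] H)
          (z ⊗ₜ LinearMap.lTensor _ (LinearMap.rTensor H B.m.toLinearMap) y)) := by
    intro z y
    induction z with
    | zero => simp
    | add x x' hx hx' => simp only [map_add, add_tmul, hx, hx']
    | tmul z z' =>
      induction y with
      | zero => simp
      | add x x' hx hx' => simp only [map_add, tmul_add, hx, hx']
      | tmul y y' => simp
  have e3 : ∀ z y : H ⊗[k] H, TensorProduct.lid k k (TensorProduct.map (f ∘ₗ reassoc k H H) F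
        (TensorProduct.tensorTensorTensorComm k H H (H ⊗[k] H ⊗[k] H) (H ⊗[k] H)
          (z ⊗ₜ TensorProduct.map U (TensorProduct.mk k H H (B.u 1)) y))) =
      f (reassoc k H H (TensorProduct.rid k H (LinearMap.lTensor H Coalgebra.counit z) ⊗ₜ
        U (TensorProduct.rid k H (LinearMap.lTensor H Coalgebra.counit y)))) := by
    intro z y
    induction z with
    | zero => simp
    | add x x' hx hx' => simp only [map_add, add_tmul, hx, hx']
    | tmul z z' =>
      induction y with
      | zero => simp
      | add x x' hx hx' => simp only [map_add, tmul_add, hx, hx']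
      | tmul y y' => 
        simp [F, B.ω_one_mid, ← smul_tmul', tmul_smul, mul_assoc, mul_comm, mul_left_comm]
  have h1 := hS.lTensor_antiTriple (RightCoaction.reg k H) h
  rw [convMul_reassoc, e1, e2]
  refine (congrArg (fun y => TensorProduct.lid k k (TensorProduct.map (f ∘ₗ reassoc k H H) F
    (TensorProduct.tensorTensorTensorComm k H H (H ⊗[k] H ⊗[k] H) (H ⊗[k] H)
      (Coalgebra.comul (R := k) x ⊗ₜ y)))) h1).trans ((e3 _ _).trans ?_)
  have h2 := LinearMap.congr_fun (RightCoaction.reg k H).counit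
  simp only [LinearMap.comp_apply, LinearEquiv.coe_coe, LinearMap.id_apply] at h2
  exact congrArg₂ (fun a b => f (reassoc k H H (a ⊗ₜ U b))) (h2 x) (h2 h)

/-- At `x ⊗ h₁ ⊗ S(h₂) ⊗ h₃` the factor `ω⁻¹(H ⊗ H ⊗ m)` on the left of a convolution product is
trivial: its argument becomes `x ⊗ h ⊗ 1`. -/
theorem IsPreantipode.mul₃₄_convMul (hS : IsPreantipode B S)
    (f : H ⊗[k] H ⊗[k] H ⊗[k] H →ₗ[k] k) (x h : H) :
    (toConv (B.ω⁻¹.val.ofConv ∘ₗ mul₃₄ B.m) * toConv f).ofConv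
        (reassoc k H H (x ⊗ₜ (RightCoaction.reg k H).antiTriple S h)) =
      f (reassoc k H H (x ⊗ₜ (RightCoaction.reg k H).antiTriple S h)) := by
  let U := (RightCoaction.reg k H).antiTriple S
  let F : H ⊗[k] (H ⊗[k] H) →ₗ[k] k := B.ω⁻¹.val.ofConv ∘ₗ (TensorProduct.assoc k H H H).symm
  let ν := LinearMap.lTensor H B.m.toLinearMap ∘ₗ (TensorProduct.assoc k H H H).toLinearMap
  have e1 : (B.ω⁻¹.val.ofConv ∘ₗ mul₃₄ B.m) ∘ₗ reassoc k H H = F ∘ₗ LinearMap.lTensor H ν := by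
    ext x y z w
    simp [F, ν, mul₃₄]
  have e2 : ∀ (z : H ⊗[k] H) (y : (H ⊗[k] H ⊗[k] H) ⊗[k] (H ⊗[k] H ⊗[k] H)),
      TensorProduct.map (F ∘ₗ LinearMap.lTensor H ν) (f ∘ₗ reassoc k H H)
        (TensorProduct.tensorTensorTensorComm k H H (H ⊗[k] H ⊗[k] H) (H ⊗[k] H ⊗[k] H)
          (z ⊗ₜ y)) = TensorProduct.map F (f ∘ₗ reassoc k H H)
        (TensorProduct.tensorTensorTensorComm k H H (H ⊗[k] H) (H ⊗[k] H ⊗[k] H)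
          (z ⊗ₜ LinearMap.rTensor _ ν y)) := by
    intro z y
    induction z with
    | zero => simp
    | add x x' hx hx' => simp only [map_add, add_tmul, hx, hx']
    | tmul z z' =>
      induction y with
      | zero => simp
      | add x x' hx hx' => simp only [map_add, tmul_add, hx, hx']
      | tmul y y' => simp
  have e3 : ∀ z y : H ⊗[k] H, TensorProduct.lid k k (TensorProduct.map F (f ∘ₗ reassoc k H H)
        (TensorProduct.tensorTensorTensorComm k H H (H ⊗[k] H) (H ⊗[k] H ⊗[k] H)
          (z ⊗ₜ TensorProduct.map ((TensorProduct.mk k H H).flip (B.u 1)) U y))) =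
      f (reassoc k H H (TensorProduct.lid k H (LinearMap.rTensor H Coalgebra.counit z) ⊗ₜ
        U (TensorProduct.lid k H (LinearMap.rTensor H Coalgebra.counit y)))) := by
    intro z y
    induction z with
    | zero => simp
    | add x x' hx hx' => simp only [map_add, add_tmul, hx, hx']
    | tmul z z' =>
      induction y with
      | zero => simp
      | add x x' hx hx' => simp only [map_add, tmul_add, hx, hx']
      | tmul y y' =>
        simp [F, B.ω_inv_one_right, ← smul_tmul', tmul_smul, mul_assoc, mul_comm, mul_left_comm]
  have h1 := hS.rTensor_antiTriple (RightCoaction.reg k H) h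
  rw [convMul_reassoc, e1, e2]
  refine (congrArg (fun y => TensorProduct.lid k k (TensorProduct.map F (f ∘ₗ reassoc k H H)
    (TensorProduct.tensorTensorTensorComm k H H (H ⊗[k] H) (H ⊗[k] H ⊗[k] H)
      (Coalgebra.comul (R := k) x ⊗ₜ y)))) h1).trans ((e3 _ _).trans ?_)
  have h2 := LinearMap.congr_fun (LeftCoaction.reg k H).counit
  simp only [LinearMap.comp_apply, LinearEquiv.coe_coe, LinearMap.id_apply] at h2
  exact congrArg₂ (fun a b => f (reassoc k H H (a ⊗ₜ U b))) (h2 x) (h2 h)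

/-- For `U(h) = h₁ ⊗ S(h₂) ⊗ h₃`, the functional `ω(m ⊗ H ⊗ H) ∗ (ω⁻¹ ⊗ ε)` takes the value
`ε(x) ε(h)` at `x ⊗ U(h)`: by the cocycle identity it is a product of three factors, of which the
preantipode trivializes the outer two, and the middle one is `ε(x) ω(U(h)) = ε(x) ε(h)`. -/
theorem IsPreantipode.ω_mul₁₂_convMul (hS : IsPreantipode B S) (x h : H) :
    (toConv (B.ω.val.ofConv ∘ₗ mul₁₂ B.m) * toConv (tensorCounit B.ω⁻¹.val.ofConv)).ofConv
        (reassoc k H H (x ⊗ₜ (RightCoaction.reg k H).antiTriple S h)) =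
      Coalgebra.counit (R := k) x * Coalgebra.counit (R := k) h := by
  have h1 := LinearMap.congr_fun hS.ω h
  change B.ω.val.ofConv ((RightCoaction.reg k H).antiTriple S h) = _ at h1
  rw [B.cocycle_mixed]
  refine (hS.convMul_mul₂₃ _ x h).trans ((hS.mul₃₄_convMul _ x h).trans ?_)
  rw [← h1]
  generalize (RightCoaction.reg k H).antiTriple S h = y
  refine LinearMap.congr_fun (f := counitTensor B.ω.val.ofConv ∘ₗ reassoc k H H ∘ₗ
    TensorProduct.mk k H _ x) (g := Coalgebra.counit (R := k) x • B.ω.val.ofConv) ?_ y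
  ext a b c
  simp [counitTensor]

/-- On the free bicomodule `V ⊗ H` the projection is `v ⊗ h ↦ ε(h) v ⊗ 1`. -/
theorem IsPreantipode.proj_freeBicomodule (hS : IsPreantipode B S) (V : LeftComodule k H)
    (v : V.carrier) (h : H) :
    (freeBicomodule B V).proj S (v ⊗ₜ[k] h) = Coalgebra.counit (R := k) h • v ⊗ₜ[k] B.u 1 := by
  let a := V.left
  let c₃ := a.tensor₃
  let c₄ := c₃.tensor (LeftCoaction.reg k H)
  let U := (RightCoaction.reg k H).antiTriple S
  let w := B.ω.val.ofConv
  let w' := B.ω⁻¹.val.ofConv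
  let g := (toConv (w ∘ₗ mul₁₂ B.m) * toConv (tensorCounit w')).ofConv
  let D : H ⊗[k] H ⊗[k] H →ₗ[k] H := mapCounit H LinearMap.id ∘ₗ LinearMap.rTensor H B.m.toLinearMap
  have h₁ : (B.tensorLeft a).tensor₃.op w = c₄.op (w ∘ₗ mul₁₂ B.m) := by
    have : Colin (a.tensor (LeftCoaction.reg k H)) (B.tensorLeft a) B.m.toLinearMap
      LinearMap.id := rfl
    have := (this.rTensor (LeftCoaction.reg k H)).rTensor (LeftCoaction.reg k H)
    have := this.op_natural w
    rw [LinearMap.rTensor_id, LinearMap.rTensor_id, LinearMap.comp_id, LinearMap.id_comp] at this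
    exact this
  have h₂ : mapCounit H (B.freeAct a) = mapCounit H (B.mulLast V.carrier) ∘ₗ
      c₄.op (tensorCounit w') := by
    have : c₄.op (tensorCounit w') = LinearMap.rTensor H (c₃.op w') :=
      LeftCoaction.op_tensor_counit c₃ (LeftCoaction.reg k H) w'
    rw [this]
    refine TensorProduct.ext' fun z l => ?_
    simp [DualQuasiBialgebra.freeAct, c₃, w', a]
  have h₃ : (freeRight k H V.carrier).antiTriple S (v ⊗ₜ h) = reassoc k H V.carrier (v ⊗ₜ U h) := by
    have e : ∀ l : H, (freeRight k H V.carrier).tmulAnti S (v ⊗ₜ[k] l) =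
        (TensorProduct.assoc k V.carrier H H).symm
          (v ⊗ₜ (RightCoaction.reg k H).tmulAnti S l) := by
      intro l
      change LinearMap.lTensor _ S ((TensorProduct.assoc k V.carrier H H).symm
        (v ⊗ₜ Coalgebra.comul l)) = (TensorProduct.assoc k V.carrier H H).symm
          (v ⊗ₜ LinearMap.lTensor H S (Coalgebra.comul l))
      induction Coalgebra.comul (R := k) l with
      | zero => simp
      | add x y hx hy => simp only [map_add, tmul_add, hx, hy]
      | tmul x y => simp
    change LinearMap.rTensor H _ ((TensorProduct.assoc k V.carrier H H).symm
      (v ⊗ₜ Coalgebra.comul h)) = reassoc k H V.carrier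
        (v ⊗ₜ LinearMap.rTensor H _ (Coalgebra.comul h))
    induction Coalgebra.comul (R := k) h with
    | zero => simp
    | add x y hx hy => simp only [map_add, tmul_add, hx, hy]
    | tmul x y => simp [e, reassoc]
  have h₄ : mapCounit H (B.mulLast V.carrier) ∘ₗ reassoc k H V.carrier =
      LinearMap.lTensor V.carrier D := by
    ext v x y z
    simp [D, DualQuasiBialgebra.mulLast]
  have h₅ := (reassoc_colin a).op_natural g
  -- Here `D` multiplies the factors `h₂` and `S(h₃)₂` of `U(h)₂ = h₂ ⊗ S(h₃)₂ ⊗ h₅`.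
  have h₆ : LinearMap.lTensor _ D (Coalgebra.comul (R := k) (U h)) = U h ⊗ₜ B.u 1 := by
    have e : ∀ y : H ⊗[k] H, LinearMap.lTensor (H ⊗[k] H ⊗[k] H) (mapCounit H LinearMap.id)
        (TensorProduct.map U (TensorProduct.mk k H H (B.u 1)) y) =
        U (TensorProduct.rid k H (LinearMap.lTensor H Coalgebra.counit y)) ⊗ₜ B.u 1 := by
      intro y
      induction y with
      | zero => simp
      | add x y hx hy => simp only [map_add, add_tmul, hx, hy]
      | tmul x y => simp [smul_tmul]
    rw [LinearMap.lTensor_comp_apply]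
    refine (congrArg _ (hS.lTensor_antiTriple (RightCoaction.reg k H) h)).trans ((e _).trans ?_)
    exact congrArg (fun z => U z ⊗ₜ[k] B.u 1)
      (LinearMap.congr_fun (RightCoaction.reg k H).counit h)
  have h₇ : ∀ (t : H ⊗[k] V.carrier) (y : (H ⊗[k] H ⊗[k] H) ⊗[k] (H ⊗[k] H ⊗[k] H)),
      LinearMap.lTensor V.carrier D (TensorProduct.lid k _ (LinearMap.rTensor _
        (g ∘ₗ reassoc k H H) (TensorProduct.tensorTensorTensorComm k H V.carrier _ _ (t ⊗ₜ y)))) =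
      TensorProduct.lid k _ (LinearMap.rTensor _ (g ∘ₗ reassoc k H H)
        (TensorProduct.tensorTensorTensorComm k H V.carrier _ _
          (t ⊗ₜ LinearMap.lTensor _ D y))) := by
    intro t y
    induction t with
    | zero => simp
    | add x x' hx hx' => simp only [map_add, add_tmul, hx, hx']
    | tmul t t' =>
      induction y with
      | zero => simp
      | add x x' hx hx' => simp only [map_add, tmul_add, hx, hx']
      | tmul y y' => simp
  have h₈ : ∀ t : H ⊗[k] V.carrier, TensorProduct.lid k _ (LinearMap.rTensor _
      (g ∘ₗ reassoc k H H) (TensorProduct.tensorTensorTensorComm k H V.carrier _ _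
          (t ⊗ₜ (U h ⊗ₜ B.u 1)))) =
      Coalgebra.counit (R := k) h •
        TensorProduct.lid k _ (LinearMap.rTensor _ Coalgebra.counit t) ⊗ₜ[k] B.u 1 := by
    intro t
    induction t with
    | zero => simp
    | add x x' hx hx' => simp only [map_add, add_tmul, smul_add, hx, hx']
    | tmul x y =>
      have : g (reassoc k H H (x ⊗ₜ U h)) = _ := hS.ω_mul₁₂_convMul x h
      simp [this, smul_tmul', smul_smul, mul_comm]
  have h₉ : (freeBicomodule B V).proj S (v ⊗ₜ[k] h) =
      mapCounit H (B.mulLast V.carrier) ((c₄.op (tensorCounit w') ∘ₗ c₄.op (w ∘ₗ mul₁₂ B.m))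
        (reassoc k H V.carrier (v ⊗ₜ U h))) := by
    rw [← h₃, ← h₁]
    exact LinearMap.congr_fun h₂ _
  rw [h₉, c₄.op_comp]
  refine (congrArg _ (LinearMap.congr_fun h₅ (v ⊗ₜ U h))).trans ?_
  refine (LinearMap.congr_fun h₄ _).trans ((h₇ (a.ρ v) (Coalgebra.comul (U h))).trans ?_)
  rw [h₆, h₈]
  exact congrArg (fun z => Coalgebra.counit (R := k) h • z ⊗ₜ[k] B.u 1)
    (LinearMap.congr_fun a.counit v)

end FreeProjection

/-! ### The adjunction and the equivalence -/

section Adjunction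

variable {k : Type v} {H : Type u} [Field k] [AddCommGroup H] [Module k H] [Coalgebra k H]

theorem DualQuasiBialgebra.comul_one (B : DualQuasiBialgebra k H) :
    Coalgebra.comul (R := k) (B.u 1) = B.u 1 ⊗ₜ[k] B.u 1 := by
  refine (LinearMap.congr_fun B.u.map_comp_comul 1).symm.trans ?_
  simp only [LinearMap.comp_apply, CommSemiring.comul_apply, TensorProduct.map_tmul]
  rfl

theorem DualQuasiBialgebra.counit_one (B : DualQuasiBialgebra k H) :
    Coalgebra.counit (R := k) (B.u 1) = 1 := by
  refine (LinearMap.congr_fun B.u.counit_comp 1).trans ?_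
  simp

theorem LeftComodule.isIso_of_bijective {V W : LeftComodule k H} (f : V ⟶ W)
    (hf : Function.Bijective (LeftComodule.Hom.toLin f)) : IsIso f := by
  let f' : LeftComodule.Hom V W := f
  let e := LinearEquiv.ofBijective f'.toLin hf
  have h1 : e.symm.toLinearMap ∘ₗ f'.toLin = LinearMap.id :=
    LinearMap.ext fun x => e.symm_apply_apply x
  have h2 : f'.toLin ∘ₗ e.symm.toLinearMap = LinearMap.id :=
    LinearMap.ext fun x => e.apply_symm_apply x
  let g : LeftComodule.Hom W V :=
    { toLin := e.symm.toLinearMap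
      left_colin := by
        have h := congrArg (fun q => LinearMap.lTensor H e.symm.toLinearMap ∘ₗ q ∘ₗ
          e.symm.toLinearMap) f'.left_colin
        simp only [LinearMap.comp_assoc, h2, LinearMap.comp_id] at h
        rw [h, ← LinearMap.comp_assoc, ← LinearMap.lTensor_comp, h1, LinearMap.lTensor_id,
          LinearMap.id_comp] }
  exact ⟨g, LeftComodule.Hom.ext h1, LeftComodule.Hom.ext h2⟩

variable {B : DualQuasiBialgebra k H}

theorem QuasiHopfBicomodule.isIso_of_bijective {M N : QuasiHopfBicomodule B} (f : M ⟶ N)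
    (hf : Function.Bijective (QuasiHopfBicomodule.Hom.toLin f)) : IsIso f := by
  let f' : QuasiHopfBicomodule.Hom M N := f
  let e := LinearEquiv.ofBijective f'.toLin hf
  have h1 : e.symm.toLinearMap ∘ₗ f'.toLin = LinearMap.id :=
    LinearMap.ext fun x => e.symm_apply_apply x
  have h2 : f'.toLin ∘ₗ e.symm.toLinearMap = LinearMap.id :=
    LinearMap.ext fun x => e.apply_symm_apply x
  let g : QuasiHopfBicomodule.Hom N M :=
    { toLin := e.symm.toLinearMap
      left_colin := by
        have h := congrArg (fun q => LinearMap.lTensor H e.symm.toLinearMap ∘ₗ q ∘ₗ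
          e.symm.toLinearMap) f'.left_colin
        simp only [LinearMap.comp_assoc, h2, LinearMap.comp_id] at h
        rw [h, ← LinearMap.comp_assoc, ← LinearMap.lTensor_comp, h1, LinearMap.lTensor_id,
          LinearMap.id_comp]
      right_colin := by
        have h := congrArg (fun q => LinearMap.rTensor H e.symm.toLinearMap ∘ₗ q ∘ₗ
          e.symm.toLinearMap) f'.right_colin
        simp only [LinearMap.comp_assoc, h2, LinearMap.comp_id] at h
        rw [h, ← LinearMap.comp_assoc, ← LinearMap.rTensor_comp, h1, LinearMap.rTensor_id,
          LinearMap.id_comp]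
      map_act := by
        have h := congrArg (fun q => e.symm.toLinearMap ∘ₗ q ∘ₗ
          LinearMap.rTensor H e.symm.toLinearMap) f'.map_act
        simp only [LinearMap.comp_assoc, ← LinearMap.rTensor_comp, h2, LinearMap.rTensor_id,
          LinearMap.comp_id] at h
        rw [← h, ← LinearMap.comp_assoc, h1, LinearMap.id_comp] }
  exact ⟨g, QuasiHopfBicomodule.Hom.ext h1, QuasiHopfBicomodule.Hom.ext h2⟩

namespace QuasiHopfBicomodule

variable (M : QuasiHopfBicomodule B)

/-- The left coaction of `H` on the right coinvariants of `M`. -/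
def coinvLeft : LeftCoaction k H M.coinv := M.coinvComodule.left

/-- The action of `H` on the right coinvariants of `M`, `x ⊗ h ↦ x h`. -/
def coinvActLin : M.coinv ⊗[k] H →ₗ[k] M.carrier := M.act ∘ₗ LinearMap.rTensor H M.coinv.subtype

theorem subtype_colin : Colin M.coinvLeft M.left LinearMap.id M.coinv.subtype :=
  M.coinvρ_spec.symm

theorem coinvActLin_left_colin : M.left.ρ ∘ₗ M.coinvActLin =
    LinearMap.lTensor H M.coinvActLin ∘ₗ (B.tensorLeft M.coinvLeft).ρ := by
  have h1 : (B.tensorLeft M.left).ρ ∘ₗ LinearMap.rTensor H M.coinv.subtype =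
      LinearMap.lTensor H (LinearMap.rTensor H M.coinv.subtype) ∘ₗ
        (B.tensorLeft M.coinvLeft).ρ := by
    have h2 := M.subtype_colin.rTensor (LeftCoaction.reg k H)
    unfold Colin at h2
    change LinearMap.rTensor _ B.m.toLinearMap ∘ₗ
      (M.left.tensor (LeftCoaction.reg k H)).ρ ∘ₗ _ = LinearMap.lTensor _ _ ∘ₗ
      LinearMap.rTensor _ B.m.toLinearMap ∘ₗ (M.coinvLeft.tensor (LeftCoaction.reg k H)).ρ
    rw [h2, LinearMap.rTensor_id, ← LinearMap.comp_assoc, ← LinearMap.comp_assoc]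
    congr 1
    exact TensorProduct.ext' fun x y => by simp
  rw [coinvActLin, ← LinearMap.comp_assoc, M.act_left_colin, LinearMap.comp_assoc, h1,
    LinearMap.lTensor_comp, LinearMap.comp_assoc]

theorem coinvActLin_right_colin : M.right.ρ ∘ₗ M.coinvActLin =
    LinearMap.rTensor H M.coinvActLin ∘ₗ (freeRight k H M.coinv).ρ := by
  rw [coinvActLin, ← LinearMap.comp_assoc, M.act_right_colin, LinearMap.comp_assoc,
    LinearMap.rTensor_comp, LinearMap.comp_assoc]
  congr 1
  refine TensorProduct.ext' fun x h => ?_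
  have e : ∀ y : H ⊗[k] H, LinearMap.lTensor (M.carrier ⊗[k] H) B.m.toLinearMap
      (TensorProduct.tensorTensorTensorComm k M.carrier H H H ((x.1 ⊗ₜ B.u 1) ⊗ₜ y)) =
      LinearMap.rTensor H (LinearMap.rTensor H M.coinv.subtype)
        ((TensorProduct.assoc k M.coinv H H).symm (x ⊗ₜ y)) := by
    intro y
    induction y with
    | zero => simp
    | add x y hx hy => simp only [map_add, tmul_add, hx, hy]
    | tmul a b => exact congrArg (fun z => (x.1 ⊗ₜ[k] a) ⊗ₜ[k] z) (B.one_mul b)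
  have hx : M.right.ρ x.1 = x.1 ⊗ₜ B.u 1 := x.2
  refine Eq.trans ?_ (e (Coalgebra.comul h))
  rw [← hx]
  rfl

theorem coinvActLin_freeAct : M.coinvActLin ∘ₗ B.freeAct M.coinvLeft =
    M.act ∘ₗ LinearMap.rTensor H M.coinvActLin := by
  let ι₃ := LinearMap.rTensor H (LinearMap.rTensor H M.coinv.subtype)
  have h1 : M.left.tensor₃.op B.ω⁻¹.val.ofConv ∘ₗ ι₃ =
      ι₃ ∘ₗ M.coinvLeft.tensor₃.op B.ω⁻¹.val.ofConv := by
    have h := ((M.subtype_colin.rTensor (LeftCoaction.reg k H)).rTensor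
      (LeftCoaction.reg k H)).op_natural B.ω⁻¹.val.ofConv
    rw [LinearMap.rTensor_id, LinearMap.rTensor_id, LinearMap.comp_id] at h
    exact h
  -- On coinvariants the factor `ω` of the associativity constraint is evaluated at `1`.
  have h2 : M.right.tensor₃.op B.ω.val.ofConv ∘ₗ ι₃ = ι₃ := by
    have e : ∀ (x : M.carrier) (y z : H ⊗[k] H), TensorProduct.rid k _ (LinearMap.lTensor _
        B.ω.val.ofConv (TensorProduct.tensorTensorTensorComm k _ _ H H
          (TensorProduct.tensorTensorTensorComm k M.carrier H H H
            ((x ⊗ₜ B.u 1) ⊗ₜ y) ⊗ₜ z))) =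
        x ⊗ₜ TensorProduct.rid k _ (LinearMap.lTensor H Coalgebra.counit y) ⊗ₜ
          TensorProduct.rid k _ (LinearMap.lTensor H Coalgebra.counit z) := by
      intro x y z
      induction y with
      | zero => simp
      | add x y hx hy => simp only [map_add, tmul_add, add_tmul, hx, hy]
      | tmul a b =>
        induction z with
        | zero => simp
        | add x y hx hy => simp only [map_add, tmul_add, hx, hy]
        | tmul c d => simp [B.ω_one_left, tmul_smul, smul_smul, ← smul_tmul', mul_comm]
    refine TensorProduct.ext_threefold fun x a b => ?_
    have hx : M.right.ρ x.1 = x.1 ⊗ₜ B.u 1 := x.2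
    have h := e x.1 (Coalgebra.comul a) (Coalgebra.comul b)
    rw [← hx] at h
    refine h.trans ?_
    simp [ι₃]
  have h3 : M.act ∘ₗ LinearMap.lTensor M.carrier B.m.toLinearMap ∘ₗ
      (TensorProduct.assoc k M.carrier H H).toLinearMap ∘ₗ ι₃ =
      M.coinvActLin ∘ₗ B.mulLast M.coinv := by
    refine TensorProduct.ext_threefold fun x a b => ?_
    simp [ι₃, DualQuasiBialgebra.mulLast, coinvActLin]
  have h4 : LinearMap.rTensor H M.coinvActLin = LinearMap.rTensor H M.act ∘ₗ ι₃ :=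
    LinearMap.rTensor_comp ..
  rw [h4, ← LinearMap.comp_assoc, M.act_assoc, DualQuasiBialgebra.freeAct, ← LinearMap.comp_assoc,
    ← h3]
  simp only [DualQuasiBialgebra.assocConstraint, LinearMap.comp_assoc]
  rw [h1, ← LinearMap.comp_assoc _ ι₃ (M.right.tensor₃.op B.ω.val.ofConv), h2]

/-- The action of `H` on right coinvariants, as a morphism of dual quasi-Hopf bicomodules
`M^{co H} ⊗ H → M`. -/
def coinvAct : QuasiHopfBicomodule.Hom (freeBicomodule B M.coinvComodule) M where
  toLin := M.coinvActLin
  left_colin := M.coinvActLin_left_colin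
  right_colin := M.coinvActLin_right_colin
  map_act := M.coinvActLin_freeAct

end QuasiHopfBicomodule

/-- The map `v ↦ v ⊗ 1`, as a morphism of left comodules `V → (V ⊗ H)^{co H}`. -/
def LeftComodule.toCoinv (B : DualQuasiBialgebra k H) (V : LeftComodule k H) :
    LeftComodule.Hom V (freeBicomodule B V).coinvComodule :=
  let N := freeBicomodule B V
  let ι : V.carrier →ₗ[k] N.carrier := (TensorProduct.mk k V.carrier H).flip (B.u 1)
  let j : V.carrier →ₗ[k] N.coinv := LinearMap.codRestrict N.coinv ι (fun v => by
    change (TensorProduct.assoc k V.carrier H H).symm (v ⊗ₜ Coalgebra.comul (B.u 1)) =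
      (v ⊗ₜ B.u 1) ⊗ₜ B.u 1
    rw [B.comul_one, TensorProduct.assoc_symm_tmul])
  { toLin := j
    left_colin := by
      refine LinearMap.ext fun v => N.lTensor_coinv_injective ?_
      refine (LinearMap.congr_fun N.coinvρ_spec (j v)).trans ?_
      refine Eq.trans ?_ (LinearMap.lTensor_comp_apply H N.coinv.subtype j (V.left.ρ v))
      change LinearMap.rTensor _ B.m.toLinearMap (TensorProduct.tensorTensorTensorComm k H _ H H
        (V.left.ρ v ⊗ₜ Coalgebra.comul (B.u 1))) =
          LinearMap.lTensor H ((TensorProduct.mk k V.carrier H).flip (B.u 1)) (V.left.ρ v)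
      rw [B.comul_one]
      induction V.left.ρ v with
      | zero => simp
      | add x y hx hy => simp only [map_add, add_tmul, hx, hy]
      | tmul c x => exact congrArg (fun z => z ⊗ₜ[k] (x ⊗ₜ[k] B.u 1)) (B.mul_one c) }

theorem DualQuasiBialgebra.freeAct_one_mid {V : Type*} [AddCommGroup V] [Module k V]
    (B : DualQuasiBialgebra k H) (a : LeftCoaction k H V) (v : V) (h : H) :
    B.freeAct a (v ⊗ₜ B.u 1 ⊗ₜ h) = v ⊗ₜ h := by
  have e : ∀ (t : H ⊗[k] V) (y : H ⊗[k] H), TensorProduct.lid k _ (LinearMap.rTensor _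
      B.ω⁻¹.val.ofConv (TensorProduct.tensorTensorTensorComm k _ _ H H
        (TensorProduct.tensorTensorTensorComm k H V H H
          (t ⊗ₜ (B.u 1 ⊗ₜ[k] B.u 1)) ⊗ₜ y))) =
      TensorProduct.lid k _ (LinearMap.rTensor _ Coalgebra.counit t) ⊗ₜ B.u 1 ⊗ₜ
        TensorProduct.lid k _ (LinearMap.rTensor _ Coalgebra.counit y) := by
    intro t y
    induction t with
    | zero => simp
    | add x y hx hy => simp only [map_add, add_tmul, hx, hy]
    | tmul c x =>
      induction y with
      | zero => simp
      | add x y hx hy => simp only [map_add, tmul_add, hx, hy]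
      | tmul y z => simp [B.ω_inv_one_mid, tmul_smul, smul_smul, ← smul_tmul', mul_comm]
  have h1 := e (a.ρ v) (Coalgebra.comul h)
  rw [← B.comul_one] at h1
  have h2 := LinearMap.congr_fun a.counit v
  have h3 := LinearMap.congr_fun (LeftCoaction.reg k H).counit h
  simp only [LinearMap.comp_apply, LinearEquiv.coe_coe, LinearMap.id_apply] at h2 h3
  have h4 : LinearMap.rTensor H Coalgebra.counit (Coalgebra.comul (R := k) h) = _ :=
    Coalgebra.rTensor_counit_comul h
  rw [h2, h4, TensorProduct.lid_tmul, one_smul] at h1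
  refine (congrArg (B.mulLast V) h1).trans ?_
  exact congrArg (fun z => v ⊗ₜ[k] z) (B.one_mul h)

variable (B)

/-- The functor `V ↦ V ⊗ H` is left adjoint to the functor of right coinvariants. -/
def freeCoinvAdjunction : freeFunctor B ⊣ coinvFunctor B :=
  Adjunction.mkOfUnitCounit
    { unit :=
        { app := fun V => LeftComodule.toCoinv B V
          naturality := fun V W f => LeftComodule.Hom.ext (LinearMap.ext fun v => rfl) }
      counit :=
        { app := fun M => M.coinvAct
          naturality := fun M N f => QuasiHopfBicomodule.Hom.ext (TensorProduct.ext' fun x h =>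
            (LinearMap.congr_fun (QuasiHopfBicomodule.Hom.map_act f) (x.1 ⊗ₜ h)).symm) }
      left_triangle := by
        ext V
        refine QuasiHopfBicomodule.Hom.ext (TensorProduct.ext' fun v h => ?_)
        exact B.freeAct_one_mid V.left v h
      right_triangle := by
        ext M
        refine LeftComodule.Hom.ext (LinearMap.ext fun x => Subtype.ext ?_)
        exact M.act_one x.1 }

variable {B}

theorem LeftComodule.toCoinv_bijective (V : LeftComodule k H) :
    Function.Bijective (LeftComodule.toCoinv B V).toLin := by
  constructor
  · refine Function.LeftInverse.injective (g := fun x => TensorProduct.rid k V.carrier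
      (LinearMap.lTensor V.carrier Coalgebra.counit x.1)) fun v => ?_
    change TensorProduct.rid k V.carrier (LinearMap.lTensor V.carrier Coalgebra.counit
      (v ⊗ₜ B.u 1)) = v
    simp [B.counit_one]
  · intro x
    -- Applying `V ⊗ ε ⊗ H` to the coinvariance of `x` recovers `x` as a multiple of `1`.
    have hx : (TensorProduct.assoc k V.carrier H H).symm
      (LinearMap.lTensor V.carrier Coalgebra.comul x.1) = x.1 ⊗ₜ B.u 1 := x.2
    have e1 : ∀ z : V.carrier ⊗[k] H, LinearMap.rTensor H
        ((TensorProduct.rid k V.carrier).toLinearMap ∘ₗ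
          LinearMap.lTensor V.carrier Coalgebra.counit) ((TensorProduct.assoc k V.carrier H H).symm
            (LinearMap.lTensor V.carrier Coalgebra.comul z)) = z := by
      intro z
      induction z with
      | zero => simp
      | add x y hx hy => simp only [map_add, hx, hy]
      | tmul v h =>
        have e : ∀ y : H ⊗[k] H, LinearMap.rTensor H
            ((TensorProduct.rid k V.carrier).toLinearMap ∘ₗ
              LinearMap.lTensor V.carrier Coalgebra.counit)
            ((TensorProduct.assoc k V.carrier H H).symm (v ⊗ₜ y)) =
            v ⊗ₜ TensorProduct.lid k H (LinearMap.rTensor H Coalgebra.counit y) := by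
          intro y
          induction y with
          | zero => simp
          | add x y hx hy => simp only [map_add, tmul_add, hx, hy]
          | tmul a b => simp [smul_tmul]
        rw [LinearMap.lTensor_tmul, e]
        simp
    refine ⟨TensorProduct.rid k V.carrier (LinearMap.lTensor V.carrier Coalgebra.counit x.1),
      Subtype.ext ?_⟩
    have h1 := e1 x.1
    rw [hx] at h1
    exact h1

/-- `proj(x h) = ε(h) x` for a right coinvariant `x`: by naturality of the projection along the
action `M^{co H} ⊗ H → M`, this reduces to the free bicomodule. -/
theorem IsPreantipode.proj_coinvAct {S : H →ₗ[k] H} (hS : IsPreantipode B S)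
    (M : QuasiHopfBicomodule B) (x : M.coinv) (h : H) :
    M.proj S (M.act (x.1 ⊗ₜ h)) = Coalgebra.counit (R := k) h • x.1 := by
  have h1 := QuasiHopfBicomodule.Hom.proj_apply S M.coinvAct (x ⊗ₜ[k] h)
  refine h1.trans ?_
  refine (congrArg M.coinvActLin (hS.proj_freeBicomodule M.coinvComodule x h)).trans ?_
  refine (map_smul M.coinvActLin _ (x ⊗ₜ B.u 1)).trans ?_
  exact congrArg _ (M.act_one x.1)

/-- The inverse of `x ⊗ h ↦ x h` is `x ↦ proj(x₍₀₎) ⊗ x₍₁₎`. -/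
theorem IsPreantipode.coinvActLin_bijective {S : H →ₗ[k] H} (hS : IsPreantipode B S)
    (M : QuasiHopfBicomodule B) : Function.Bijective M.coinvActLin := by
  let p : M.carrier →ₗ[k] M.coinv :=
    LinearMap.codRestrict M.coinv (M.proj S) (M.proj_mem_coinv hS)
  let q : M.carrier →ₗ[k] M.coinv ⊗[k] H := LinearMap.rTensor H p ∘ₗ M.right.ρ
  constructor
  · refine Function.LeftInverse.injective (g := q) fun z => ?_
    have h1 := LinearMap.congr_fun M.coinvActLin_right_colin z
    have e : ∀ (x : M.coinv) (y : H ⊗[k] H), LinearMap.rTensor H p (LinearMap.rTensor H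
        M.coinvActLin ((TensorProduct.assoc k M.coinv H H).symm (x ⊗ₜ y))) =
        x ⊗ₜ TensorProduct.lid k H (LinearMap.rTensor H Coalgebra.counit y) := by
      intro x y
      induction y with
      | zero => simp
      | add x y hx hy => simp only [map_add, tmul_add, hx, hy]
      | tmul a b =>
        have : p (M.coinvActLin (x ⊗ₜ a)) = Coalgebra.counit (R := k) a • x :=
          Subtype.ext (hS.proj_coinvAct M x a)
        simp only [TensorProduct.assoc_symm_tmul, LinearMap.rTensor_tmul, TensorProduct.lid_tmul]
        refine (congrArg (fun w => w ⊗ₜ[k] b) this).trans ?_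
        rw [smul_tmul]
    refine (congrArg (LinearMap.rTensor H p) h1).trans ?_
    change LinearMap.rTensor H p (LinearMap.rTensor H M.coinvActLin
      ((TensorProduct.assoc k M.coinv H H).symm
        (LinearMap.lTensor M.coinv Coalgebra.comul z))) = z
    clear h1
    induction z with
    | zero => simp
    | add x y hx hy => simp only [map_add, hx, hy]
    | tmul x h =>
      rw [LinearMap.lTensor_tmul, e]
      simp
  · intro x
    refine ⟨q x, ?_⟩
    refine Eq.trans ?_ (M.act_rTensor_proj hS x)
    change M.act (LinearMap.rTensor H M.coinv.subtype (LinearMap.rTensor H p (M.right.ρ x))) = _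
    rw [← LinearMap.rTensor_comp_apply]
    rfl

end Adjunction

end

end DualQuasi

theorem mainTheorem4 {k : Type v} {H : Type u} [Field k] [AddCommGroup H] [Module k H]
    [Coalgebra k H] (A : DualQuasi.DualQuasiHopfAlgebra k H) :
    ∃ adj : DualQuasi.freeFunctor A.toDualQuasiBialgebra ⊣
        DualQuasi.coinvFunctor A.toDualQuasiBialgebra,
      (∀ (M : DualQuasi.QuasiHopfBicomodule A.toDualQuasiBialgebra) (x : M.coinv) (h : H),
        DualQuasi.QuasiHopfBicomodule.Hom.toLin (adj.counit.app M) (x ⊗ₜ[k] h) =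
          M.act ((x : M.carrier) ⊗ₜ[k] h)) ∧
      (∀ (V : DualQuasi.LeftComodule k H) (v : V.carrier),
        Subtype.val (DualQuasi.LeftComodule.Hom.toLin (adj.unit.app V) v) = v ⊗ₜ[k] A.u 1) ∧
      IsIso adj.unit ∧ IsIso adj.counit ∧
      (DualQuasi.freeFunctor A.toDualQuasiBialgebra).IsEquivalence ∧
      (DualQuasi.coinvFunctor A.toDualQuasiBialgebra).IsEquivalence := by
  let adj := DualQuasi.freeCoinvAdjunction A.toDualQuasiBialgebra
  have hη : ∀ V, IsIso (adj.unit.app V) := fun V =>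
    DualQuasi.LeftComodule.isIso_of_bijective _ V.toCoinv_bijective
  have hε : ∀ M, IsIso (adj.counit.app M) := fun M =>
    DualQuasi.QuasiHopfBicomodule.isIso_of_bijective _ (A.isPreantipode.coinvActLin_bijective M)
  exact ⟨adj, fun _ _ _ => rfl, fun _ _ => rfl, NatIso.isIso_of_isIso_app _,
    NatIso.isIso_of_isIso_app _, adj.toEquivalence.isEquivalence_functor,
    adj.toEquivalence.isEquivalence_inverse⟩
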